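/- Let $q\in\mathbb C$ be nonzero and not a root of unity, let $N\ge 0$, and let $\mathfrak g_N$ be $\mathfrak o_N$, or $\mathfrak{sp}_N$ with $N=2n$. Let $E_{ij}$ be the matrix units of $\mathrm{End}\,\mathbb C^N$ and put $$R(x,y)=(x-y)\sum_{i\ne j}E_{ii}\otimes E_{jj}+(q^{-1}x-qy)\sum_iE_{ii}\otimes E_{ii}+(q^{-1}-q)x\sum_{i>j}E_{ij}\otimes E_{ji}+(q^{-1}-q)y\sum_{i<j}E_{ij}\otimes E_{ji}.$$ Let $R^t$ be the transpose of $R$ in the first tensor factor, and let $\overline R^{\,t}(x)=R^t(x,1)/(x-1)$. **The algebra.** The twisted $q$-Yangian $\mathrm Y^{\mathrm{tw}}_q(\mathfrak g_N)$ is the unital associative $\mathbb C$-algebra generated by $s_{ij}^{(r)}$ ($1\le i,j\le N$, $r\ge 0$) and, in the symplectic case, also by $(s^{(0)}_{ii'})^{-1}$ for $i=1,3,\dots,2n-1$, where $(2k-1)'=2k$ and $(2k)'=2k-1$. Put $s_{ij}(u)=\sum_{r\ge0}s_{ij}^{(r)}u^{-r}$ and $S(u)=(s_{ij}(u))$. The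 defining relations are the $q$-reflection relation $$R(u,v)\,S_1(u)\,R^t(u^{-1}v^{-1},1)\,S_2(v)=S_2(v)\,R^t(u^{-1}v^{-1},1)\,S_1(u)\,R(u,v)$$ together with * in the orthogonal case: $s_{ij}^{(0)}=0$ for $i<j$ and $s_{ii}^{(0)}=1$; * in the symplectic case: $s_{ij}^{(0)}=0$ for $i<j$, $j\ne i'$, and, for $i=1,3,\dots,2n-1$, $s_{i'i'}^{(0)}s_{ii}^{(0)}-q^2s_{i'i}^{(0)}s_{ii'}^{(0)}=q^3$ and $s^{(0)}_{ii'}(s^{(0)}_{ii'})^{-1}=(s^{(0)}_{ii'})^{-1}s^{(0)}_{ii'}=1$. **Sklyanin minors.** Let $P^q=\sum_iE_{ii}\otimes E_{ii}+q\sum_{i>j}E_{ij}\otimes E_{ji}+q^{-1}\sum_{i<j}E_{ij}\otimes E_{ji}$. Let $\sigma\mapsto P^q_\sigma$ be the action of the symmetric group $\mathfrak S_m$ on $(\mathbb C^N)^{\otimes m}$ in which the transposition $(i,i+1)$ acts as $P^q_{i,i+1}$, and let $A^q_m=\frac1{m!}\sum_{\sigma\in\mathfrak S_m}\mathrm{sgn}(\sigma)P^q_\sigma$.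 For an $N\times N$ matrix $S(u)$ of power series in $u^{-1}$, with $u_i=uq^{-2i+2}$ and $\overline R^{\,t}_{ij}=\overline R^{\,t}_{ij}(u_i^{-1}u_j^{-1})$ expanded in powers of $u^{-1}$, put $$\langle S_1,\dots,S_m\rangle=S_1(u_1)\,(\overline R^{\,t}_{12}\cdots\overline R^{\,t}_{1m})\,S_2(u_2)\,(\overline R^{\,t}_{23}\cdots\overline R^{\,t}_{2m})\cdots S_m(u_m).$$ The Sklyanin minors $s^{i_1\cdots i_m}_{j_1\cdots j_m}(u)$ are defined by $$A^q_m\langle S_1,\dots,S_m\rangle=\frac1{m!}\sum s^{i_1\cdots i_m}_{j_1\cdots j_m}(u)\otimes E_{i_1j_1}\otimes\cdots\otimes E_{i_mj_m}.$$ Put $\mathrm{sdet}_q S(u)=s^{1\cdots N}_{1\cdots N}(u)$ and $\mathrm{sdet}_q S_I(u)=s^{i_1\cdots i_k}_{i_1\cdots i_k}(u)$ for $I=\{i_1<\dots<i_k\}\subseteq[1,N]$. For $I=\emptyset$ this equals $1$. The notions with $q^{-1}$ in place of $q$ are obtained by replacing $q$ by $q^{-1}$ in all these definitions, in particular also in $u_i$.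 **Theorem (Jacobi's theorem for Sklyanin determinants).** Let $S(u)$ be the generator matrix of $\mathrm Y^{\mathrm{tw}}_q(\mathfrak g_N)$ and let $C=\mathrm{diag}\big((-q)^{\frac{N-1}2},(-q)^{\frac{N-3}2},\dots,(-q)^{-\frac{N-1}2}\big)$, for either choice of $(-q)^{1/2}$. Then: 1. The matrix $S(q^{-N}u)$ is invertible over $\mathrm Y^{\mathrm{tw}}_q(\mathfrak g_N)[[u^{-1}]]$, and $X(u)=C^{-1}S(q^{-N}u)^{-1}C$ satisfies the $q^{-1}$-reflection relation, that is, the relation displayed above with $q^{-1}$ in place of $q$ and $X$ in place of $S$. 2. For every subset $I\subseteq[1,N]$ with complement $I^c$, $$\mathrm{sdet}_q S_I(u)=\mathrm{sdet}_q S(u)\;\mathrm{sdet}_{q^{-1}}X_{I^c}(q^{2-N}u).$$ 3. In particular, for $I=\emptyset$, $\ \mathrm{sdet}_qS(u)\,\mathrm{sdet}_{q^{-1}}X(q^{2-N}u)=1$. -/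

import Mathlib

namespace SklyaninJacobi

/-! ### Operators on tensor powers

The space `(ℂ^N)^{⊗m}` has the basis `e_{a 0} ⊗ ⋯ ⊗ e_{a (m-1)}` indexed by `a : Fin m → Fin N`,
and `B ⊗ (End ℂ^N)^{⊗m}` is the ring of matrices over `B` with rows and columns indexed by
`Fin m → Fin N`.  Indices `1, …, N` are replaced by `0, …, N - 1` throughout. -/

section Slots

variable {N m : ℕ} {B : Type*} [Zero B]

/-- The operator on `(ℂ^N)^{⊗m}` acting as `M` on the tensor factor `p` and as the identity on
all other factors. -/
def onSlot (p : Fin m) (M : Matrix (Fin N) (Fin N) B) :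
    Matrix (Fin m → Fin N) (Fin m → Fin N) B :=
  fun a b => if ∀ k, k ≠ p → a k = b k then M (a p) (b p) else 0

/-- The operator on `(ℂ^N)^{⊗m}` acting as `M` on the tensor factors `p`, `p'` (in this order)
and as the identity on all other factors. -/
def onSlots (p p' : Fin m) (M : Matrix (Fin N × Fin N) (Fin N × Fin N) B) :
    Matrix (Fin m → Fin N) (Fin m → Fin N) B :=
  fun a b => if ∀ k, k ≠ p → k ≠ p' → a k = b k then M (a p, a p') (b p, b p') else 0

/-- Transposition in the first tensor factor, `E_{ij} ⊗ E_{kl} ↦ E_{ji} ⊗ E_{kl}`. -/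
def partialTranspose (M : Matrix (Fin N × Fin N) (Fin N × Fin N) B) :
    Matrix (Fin N × Fin N) (Fin N × Fin N) B :=
  fun a b => M (b.1, a.2) (a.1, b.2)

end Slots

/-! ### R-matrices -/

/-- The trigonometric R-matrix
`R(x, y) = (x - y) ∑_{i ≠ j} E_{ii} ⊗ E_{jj} + (q⁻¹ x - q y) ∑_i E_{ii} ⊗ E_{ii}
  + (q⁻¹ - q) x ∑_{i > j} E_{ij} ⊗ E_{ji} + (q⁻¹ - q) y ∑_{i < j} E_{ij} ⊗ E_{ji}`.
The entry at row `(i, j)` and column `(k, l)` is the coefficient of `E_{ik} ⊗ E_{jl}`. -/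
noncomputable def rMatrix (N : ℕ) {B : Type*} [CommRing B] [Algebra ℂ B] (q : ℂ) (x y : B) :
    Matrix (Fin N × Fin N) (Fin N × Fin N) B :=
  fun a b =>
    if a = b then (if a.1 = a.2 then q⁻¹ • x - q • y else x - y)
    else if a.1 = b.2 ∧ a.2 = b.1 then (if a.2 < a.1 then (q⁻¹ - q) • x else (q⁻¹ - q) • y)
    else 0

/-- The matrix `R̄^t(x) = R^t(x, 1) / (x - 1)`, where `x` is a power series (in `u⁻¹`) without
constant term, so that `x - 1` is invertible. -/
noncomputable def rBarT (N : ℕ) (q : ℂ) (x : PowerSeries ℂ) :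
    Matrix (Fin N × Fin N) (Fin N × Fin N) (PowerSeries ℂ) :=
  (x - 1)⁻¹ • partialTranspose (rMatrix N q x 1)

/-! ### Series in `u⁻¹`

A series `∑ f_r u^{-r}` with coefficients in `A` is the power series `∑ f_r X^r`. -/

section Series

variable {A : Type*} [Ring A] [Algebra ℂ A]

/-- For `f(u) = ∑ f_r u^{-r}`, the series `f(c u) = ∑ c^{-r} f_r u^{-r}`. -/
noncomputable def dilate (c : ℂ) (f : PowerSeries A) : PowerSeries A :=
  PowerSeries.mk fun r => (c⁻¹) ^ r • PowerSeries.coeff r f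

/-- For `f(u) = ∑ f_r u^{-r}`, the series `f(u_k)` as a series in the two variables
`u_0⁻¹, u_1⁻¹`. -/
noncomputable def inVar (k : Fin 2) (f : PowerSeries A) : MvPowerSeries (Fin 2) A :=
  fun d => if d = Finsupp.single k (d k) then PowerSeries.coeff (d k) f else 0

/-! ### The reflection relation -/

/-- `R(u, v)` with coefficients in `A`, multiplied by the scalar `u⁻¹ v⁻¹`, which gives
`R(v⁻¹, u⁻¹)`; here `u = u_0` and `v = u_1`. -/
noncomputable def reflR (N : ℕ) (A : Type*) [Ring A] [Algebra ℂ A] (q : ℂ) :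
    Matrix (Fin 2 → Fin N) (Fin 2 → Fin N) (MvPowerSeries (Fin 2) A) :=
  onSlots 0 1 ((rMatrix N q (MvPowerSeries.X 1) (MvPowerSeries.X 0 : MvPowerSeries (Fin 2) ℂ)).map
    (MvPowerSeries.map (algebraMap ℂ A)))

/-- `R^t(1/uv, 1)` with coefficients in `A`. -/
noncomputable def reflRt (N : ℕ) (A : Type*) [Ring A] [Algebra ℂ A] (q : ℂ) :
    Matrix (Fin 2 → Fin N) (Fin 2 → Fin N) (MvPowerSeries (Fin 2) A) :=
  onSlots 0 1 ((partialTranspose (rMatrix N q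
    (MvPowerSeries.X 0 * MvPowerSeries.X 1 : MvPowerSeries (Fin 2) ℂ) 1)).map
      (MvPowerSeries.map (algebraMap ℂ A)))

/-- `R(u/v) S₁(u) R^t(1/uv) S₂(v)`, up to an invertible scalar factor. -/
noncomputable def reflLeft {N : ℕ} (q : ℂ) (S : Matrix (Fin N) (Fin N) (PowerSeries A)) :
    Matrix (Fin 2 → Fin N) (Fin 2 → Fin N) (MvPowerSeries (Fin 2) A) :=
  reflR N A q * onSlot 0 (S.map (inVar 0)) * reflRt N A q * onSlot 1 (S.map (inVar 1))

/-- `S₂(v) R^t(1/uv) S₁(u) R(u/v)`, up to the same invertible scalar factor. -/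
noncomputable def reflRight {N : ℕ} (q : ℂ) (S : Matrix (Fin N) (Fin N) (PowerSeries A)) :
    Matrix (Fin 2 → Fin N) (Fin 2 → Fin N) (MvPowerSeries (Fin 2) A) :=
  onSlot 1 (S.map (inVar 1)) * reflRt N A q * onSlot 0 (S.map (inVar 0)) * reflR N A q

/-- The `q`-reflection relation
`R(u/v) S₁(u) R^t(1/uv) S₂(v) = S₂(v) R^t(1/uv) S₁(u) R(u/v)` for a matrix of series in `u⁻¹`. -/
def ReflectionRelation {N : ℕ} (q : ℂ) (S : Matrix (Fin N) (Fin N) (PowerSeries A)) : Prop :=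
  reflLeft q S = reflRight q S

end Series

/-! ### The twisted q-Yangians -/

/-- The two series `𝔬_N` and `𝔰𝔭_{2n}`; the index is the size `N` of the matrices. -/
inductive ClassicalType : ℕ → Type
  | o (N : ℕ) : ClassicalType N
  | sp (n : ℕ) : ClassicalType (2 * n)

/-- The generators of the twisted q-Yangian: `s_{ij}^{(r)}` and, in the symplectic case, the
inverses of `s_{ii'}^{(0)}`, where `k` stands for the pair of consecutive indices
`i = 2k`, `i' = 2k + 1`. -/
inductive Gen : {N : ℕ} → ClassicalType N → Type
  | s {N : ℕ} {g : ClassicalType N} (i j : Fin N) (r : ℕ) : Gen g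
  | inv {n : ℕ} (k : Fin n) : Gen (ClassicalType.sp n)

/-- The index `i = 2k`, the first one of the `k`-th pair. -/
def fst {n : ℕ} (k : Fin n) : Fin (2 * n) := ⟨2 * k, by omega⟩

/-- The index `i' = 2k + 1`, the second one of the `k`-th pair. -/
def snd {n : ℕ} (k : Fin n) : Fin (2 * n) := ⟨2 * k + 1, by omega⟩

/-- The free generator `s_{ij}^{(r)}`. -/
def freeS {N : ℕ} (g : ClassicalType N) (i j : Fin N) (r : ℕ) : FreeAlgebra ℂ (Gen g) :=
  FreeAlgebra.ι ℂ (Gen.s i j r)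

/-- The matrix `S(u)` over the free algebra, with `s_{ij}(u) = ∑ s_{ij}^{(r)} u^{-r}`. -/
def freeMatrix {N : ℕ} (g : ClassicalType N) :
    Matrix (Fin N) (Fin N) (PowerSeries (FreeAlgebra ℂ (Gen g))) :=
  fun i j => PowerSeries.mk (freeS g i j)

/-- The defining relations of the twisted q-Yangians. -/
inductive Rel (q : ℂ) : {N : ℕ} → (g : ClassicalType N) →
    FreeAlgebra ℂ (Gen g) → FreeAlgebra ℂ (Gen g) → Prop
  /-- All coefficients of the reflection relation. -/
  | reflection {N : ℕ} (g : ClassicalType N) (a b : Fin 2 → Fin N) (d : Fin 2 →₀ ℕ) :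
      Rel q g (MvPowerSeries.coeff d (reflLeft q (freeMatrix g) a b))
        (MvPowerSeries.coeff d (reflRight q (freeMatrix g) a b))
  /-- `s_{ij}^{(0)} = 0` for `i < j`. -/
  | o_upper {N : ℕ} (i j : Fin N) (h : i < j) : Rel q (.o N) (freeS (.o N) i j 0) 0
  /-- `s_{ii}^{(0)} = 1`. -/
  | o_diag {N : ℕ} (i : Fin N) : Rel q (.o N) (freeS (.o N) i i 0) 1
  /-- `s_{ij}^{(0)} = 0` for `i < j` with `j ≠ i'`. -/
  | sp_upper {n : ℕ} (i j : Fin (2 * n)) (h : i < j) (h' : ∀ k, ¬ (i = fst k ∧ j = snd k)) :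
      Rel q (.sp n) (freeS (.sp n) i j 0) 0
  /-- `s_{i'i'}^{(0)} s_{ii}^{(0)} - q² s_{i'i}^{(0)} s_{ii'}^{(0)} = q³`. -/
  | sp_det {n : ℕ} (k : Fin n) :
      Rel q (.sp n)
        (freeS (.sp n) (snd k) (snd k) 0 * freeS (.sp n) (fst k) (fst k) 0
          - q ^ 2 • (freeS (.sp n) (snd k) (fst k) 0 * freeS (.sp n) (fst k) (snd k) 0))
        (algebraMap ℂ _ (q ^ 3))
  | sp_mul_inv {n : ℕ} (k : Fin n) :
      Rel q (.sp n)
        (freeS (.sp n) (fst k) (snd k) 0 * FreeAlgebra.ι ℂ (Gen.inv k)) 1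
  | sp_inv_mul {n : ℕ} (k : Fin n) :
      Rel q (.sp n)
        (FreeAlgebra.ι ℂ (Gen.inv k) * freeS (.sp n) (fst k) (snd k) 0) 1

/-- The twisted q-Yangian `Y_q^tw(𝔬_N)` or `Y_q^tw(𝔰𝔭_{2n})`. -/
abbrev TwistedQYangian (q : ℂ) {N : ℕ} (g : ClassicalType N) : Type := RingQuot (Rel q g)

/-- The matrix `S(u)` over the twisted q-Yangian. -/
noncomputable def genMatrix (q : ℂ) {N : ℕ} (g : ClassicalType N) :
    Matrix (Fin N) (Fin N) (PowerSeries (TwistedQYangian q g)) :=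
  fun i j => PowerSeries.mk fun r => RingQuot.mkAlgHom ℂ (Rel q g) (freeS g i j r)

/-! ### The q-antisymmetrizer -/

section Antisymmetrizer

variable {N m : ℕ}

/-- The q-permutation operator
`P^q = ∑_i E_{ii} ⊗ E_{ii} + q ∑_{i > j} E_{ij} ⊗ E_{ji} + q⁻¹ ∑_{i < j} E_{ij} ⊗ E_{ji}`. -/
noncomputable def qFlip (N : ℕ) (q : ℂ) : Matrix (Fin N × Fin N) (Fin N × Fin N) ℂ :=
  fun a b => if a.1 = b.2 ∧ a.2 = b.1 then
    (if a.2 < a.1 then q else if a.1 < a.2 then q⁻¹ else 1) else 0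

/-- The number of inversions of a sequence of indices. -/
def inversions (a : Fin m → Fin N) : ℕ :=
  (Finset.univ.filter fun p : Fin m × Fin m => p.1 < p.2 ∧ a p.2 < a p.1).card

/-- The operator `P_σ^q`: it sends `e_b` to `q^{inv(a) - inv(b)} e_a` with `a = b ∘ σ⁻¹`.  By
`qPerm_one`, `qPerm_mul` and `qPerm_swap` below, this is the action of the symmetric group on
`(ℂ^N)^{⊗m}` in which the adjacent transposition `(i, i+1)` acts as `P^q_{i,i+1}`. -/
noncomputable def qPerm (N : ℕ) (q : ℂ) (σ : Equiv.Perm (Fin m)) :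
    Matrix (Fin m → Fin N) (Fin m → Fin N) ℂ :=
  fun a b => if a = b ∘ σ.symm then q ^ ((inversions a : ℤ) - inversions b) else 0

theorem qPerm_one (q : ℂ) : qPerm N q (1 : Equiv.Perm (Fin m)) = 1 := by
  ext a b
  by_cases h : a = b
  · subst h
    simp [qPerm, Equiv.Perm.one_def]
  · have h' : ¬ a = b ∘ (Equiv.symm (1 : Equiv.Perm (Fin m))) := fun e => h e
    simp only [qPerm, if_neg h', Matrix.one_apply_ne h]

theorem qPerm_mul {q : ℂ} (hq : q ≠ 0) (σ τ : Equiv.Perm (Fin m)) :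
    qPerm N q (σ * τ) = qPerm N q σ * qPerm N q τ := by
  ext a b
  rw [Matrix.mul_apply, Finset.sum_eq_single (b ∘ τ.symm)]
  · have e : b ∘ (σ * τ).symm = (b ∘ τ.symm) ∘ σ.symm := rfl
    simp only [qPerm, e, if_true]
    split_ifs with h
    · rw [← zpow_add₀ hq]
      congr 1
      ring
    · simp
  · intro c _ hc
    simp [qPerm, hc]
  · simp

theorem inversions_swap (a : Fin m → Fin N) (i j : Fin m) (hij : (j : ℕ) = i + 1) :
    inversions (a ∘ Equiv.swap i j) + (if a j < a i then 1 else 0)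
      = inversions a + (if a i < a j then 1 else 0) := by
  have hlt : i < j := by
    rw [Fin.lt_def]
    omega
  have key : ∀ c : Fin m → Fin N, inversions c
      = (Finset.univ.filter fun p : Fin m × Fin m =>
          p ≠ (i, j) ∧ p.1 < p.2 ∧ c p.2 < c p.1).card + (if c j < c i then 1 else 0) := by
    intro c
    unfold inversions
    rw [← Finset.card_filter_add_card_filter_not (p := fun p : Fin m × Fin m => p ≠ (i, j))]
    congr 1
    · rw [Finset.filter_filter]
      congr 1
      ext p
      simp only [Finset.mem_filter, Finset.mem_univ, true_and]
      tauto
    · split_ifs with h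
      · rw [Finset.card_eq_one]
        refine ⟨(i, j), ?_⟩
        ext p
        simp only [Finset.mem_filter, Finset.mem_univ, true_and, not_not, Finset.mem_singleton]
        constructor
        · exact fun hp => hp.2
        · rintro rfl
          exact ⟨⟨hlt, h⟩, rfl⟩
      · rw [Finset.card_eq_zero, Finset.filter_eq_empty_iff]
        intro p hp
        simp only [Finset.mem_filter, Finset.mem_univ, true_and] at hp
        rintro hn
        rw [not_not] at hn
        subst hn
        exact h hp.2
  have hord : ∀ k l : Fin m, (k, l) ≠ (i, j) → k < l →
      (Equiv.swap i j k, Equiv.swap i j l) ≠ (i, j) ∧ Equiv.swap i j k < Equiv.swap i j l := by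
    intro k l hne hkl
    simp only [Equiv.swap_apply_def, ne_eq, Prod.mk.injEq, not_and, Fin.lt_def, Fin.ext_iff] at *
    split_ifs <;> omega
  rw [key (a ∘ Equiv.swap i j), key a]
  have hc : (Finset.univ.filter fun p : Fin m × Fin m =>
      p ≠ (i, j) ∧ p.1 < p.2 ∧ (a ∘ Equiv.swap i j) p.2 < (a ∘ Equiv.swap i j) p.1).card
      = (Finset.univ.filter fun p : Fin m × Fin m =>
          p ≠ (i, j) ∧ p.1 < p.2 ∧ a p.2 < a p.1).card := by
    refine Finset.card_bij' (fun p _ => (Equiv.swap i j p.1, Equiv.swap i j p.2))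
      (fun p _ => (Equiv.swap i j p.1, Equiv.swap i j p.2)) ?_ ?_ ?_ ?_
    · rintro ⟨k, l⟩ hp
      simp only [Finset.mem_filter, Finset.mem_univ, true_and] at hp ⊢
      have := hord k l hp.1 hp.2.1
      exact ⟨this.1, this.2, hp.2.2⟩
    · rintro ⟨k, l⟩ hp
      simp only [Finset.mem_filter, Finset.mem_univ, true_and] at hp ⊢
      have := hord k l hp.1 hp.2.1
      refine ⟨this.1, this.2, ?_⟩
      simpa using hp.2.2
    · rintro ⟨k, l⟩ _
      simp
    · rintro ⟨k, l⟩ _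
      simp
  rw [hc]
  simp only [Function.comp, Equiv.swap_apply_left, Equiv.swap_apply_right]
  omega

theorem qPerm_swap (q : ℂ) (i j : Fin m) (hij : (j : ℕ) = i + 1) :
    qPerm N q (Equiv.swap i j) = onSlots i j (qFlip N q) := by
  ext a b
  have hne : i ≠ j := fun h => by
    rw [h] at hij
    omega
  have hiff : a = b ∘ Equiv.swap i j ↔
      (∀ k, k ≠ i → k ≠ j → a k = b k) ∧ a i = b j ∧ a j = b i := by
    constructor
    · rintro rfl
      refine ⟨fun k h1 h2 => ?_, ?_, ?_⟩
      · simp [Equiv.swap_apply_of_ne_of_ne h1 h2]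
      · simp
      · simp
    · rintro ⟨h1, h2, h3⟩
      ext k
      by_cases hi : k = i
      · subst hi
        simp [h2]
      by_cases hj : k = j
      · subst hj
        simp [h3]
      simp [Equiv.swap_apply_of_ne_of_ne hi hj, h1 k hi hj]
  have hsymm : ∀ (x : Fin m → Fin N), (x = b ∘ (Equiv.swap i j).symm) = (x = b ∘ Equiv.swap i j) :=
    fun x => by rw [Equiv.symm_swap]
  by_cases h : a = b ∘ Equiv.swap i j
  · obtain ⟨h1, h2, h3⟩ := hiff.1 h
    have hs := inversions_swap b i j hij
    rw [← h] at hs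
    rw [qPerm, if_pos ((hsymm a).mpr h), onSlots, if_pos h1, qFlip, if_pos ⟨h2, h3⟩]
    simp only [h2, h3]
    rcases lt_trichotomy (b i) (b j) with hlt | heq | hgt
    · have : (inversions a : ℤ) - inversions b = 1 := by
        simp only [hlt, hlt.not_gt, if_true, if_false] at hs
        omega
      rw [this, if_pos hlt, zpow_one]
    · have : (inversions a : ℤ) - inversions b = 0 := by
        simp only [heq, lt_irrefl, if_false] at hs
        omega
      rw [this, zpow_zero, heq]
      simp
    · have : (inversions a : ℤ) - inversions b = -1 := by
        simp only [hgt, hgt.not_gt, if_true, if_false] at hs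
        omega
      rw [this, if_neg hgt.not_gt, if_pos hgt, zpow_neg_one]
  · rw [qPerm, if_neg (fun e => h ((hsymm a).mp e))]
    simp only [onSlots, qFlip]
    split_ifs with h1 h2 h3 h4 <;> first | rfl | exact absurd (hiff.2 ⟨h1, h2⟩) h

/-- The q-antisymmetrizer `A_m^q = (1/m!) ∑_σ sgn(σ) P_σ^q`. -/
noncomputable def antisymmetrizer (N m : ℕ) (q : ℂ) :
    Matrix (Fin m → Fin N) (Fin m → Fin N) ℂ :=
  (1 / (m.factorial : ℂ)) •
    ∑ σ : Equiv.Perm (Fin m), ((Equiv.Perm.sign σ : ℤ) : ℂ) • qPerm N q σ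

end Antisymmetrizer

/-! ### Sklyanin minors and determinants -/

section Sklyanin

variable {A : Type*} [Ring A] [Algebra ℂ A] {N : ℕ}

/-- `R̄^t_{ij}(u_i⁻¹ u_j⁻¹)` on `(ℂ^N)^{⊗m}` for `u_i = u q^{-2i}`, `i = 0, …, m - 1`. -/
noncomputable def rBarTOn (N m : ℕ) (A : Type*) [Ring A] [Algebra ℂ A] (q : ℂ) (i j : Fin m) :
    Matrix (Fin m → Fin N) (Fin m → Fin N) (PowerSeries A) :=
  onSlots i j ((rBarT N q (q ^ (2 * ((i : ℕ) + j)) • (PowerSeries.X ^ 2 : PowerSeries ℂ))).map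
    (PowerSeries.map (algebraMap ℂ A)))

/-- `⟨S_1, …, S_m⟩ = S_1(u_1) (R̄^t_{12} ⋯ R̄^t_{1m}) S_2(u_2) (R̄^t_{23} ⋯ R̄^t_{2m}) ⋯ S_m(u_m)`
for `u_i = u q^{-2i}`, the index `i` running from `0` to `m - 1`. -/
noncomputable def bracket (q : ℂ) (m : ℕ) (S : Matrix (Fin N) (Fin N) (PowerSeries A)) :
    Matrix (Fin m → Fin N) (Fin m → Fin N) (PowerSeries A) :=
  ((List.finRange m).map fun i =>
    onSlot i (S.map (dilate (q ^ (-2 * (i : ℤ))))) *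
      (((List.finRange m).filter (i < ·)).map fun j => rBarTOn N m A q i j).prod).prod

/-- The Sklyanin minor `s^{i_1 … i_m}_{j_1 … j_m}(u)`, defined by
`A_m^q ⟨S_1, …, S_m⟩ = (1/m!) ∑ s^{i_1 … i_m}_{j_1 … j_m}(u) ⊗ E_{i_1 j_1} ⊗ ⋯ ⊗ E_{i_m j_m}`. -/
noncomputable def sklyaninMinor (q : ℂ) {m : ℕ} (S : Matrix (Fin N) (Fin N) (PowerSeries A))
    (rows cols : Fin m → Fin N) : PowerSeries A :=
  (m.factorial : ℂ) •
    ((antisymmetrizer N m q).map (algebraMap ℂ (PowerSeries A)) * bracket q m S) rows cols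

/-- The Sklyanin determinant `sdet_q S(u) = s^{1 … N}_{1 … N}(u)`. -/
noncomputable def sdet (q : ℂ) (S : Matrix (Fin N) (Fin N) (PowerSeries A)) : PowerSeries A :=
  sklyaninMinor q S id id

/-- `sdet_q S_I(u) = s^{i_1 … i_k}_{i_1 … i_k}(u)` for `I = {i_1 < ⋯ < i_k}`. -/
noncomputable def sdetSub (q : ℂ) (S : Matrix (Fin N) (Fin N) (PowerSeries A))
    (I : Finset (Fin N)) : PowerSeries A :=
  sklyaninMinor q S (I.orderEmbOfFin rfl) (I.orderEmbOfFin rfl)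

/-- `C = diag((-q)^{(N-1)/2}, (-q)^{(N-3)/2}, …, (-q)^{-(N-1)/2})`, where `r` is a square root of
`-q`. -/
noncomputable def cDiag (N : ℕ) (r : ℂ) : Matrix (Fin N) (Fin N) ℂ :=
  Matrix.diagonal fun i => r ^ ((N : ℤ) - 1 - 2 * (i : ℤ))

/-- `X(u) = C⁻¹ S(q^{-N} u)⁻¹ C`.  `Ring.inverse` is the two-sided inverse in the ring of
`N × N` matrices whenever there is one. -/
noncomputable def xMatrix (q r : ℂ) (S : Matrix (Fin N) (Fin N) (PowerSeries A)) :
    Matrix (Fin N) (Fin N) (PowerSeries A) :=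
  (cDiag N r)⁻¹.map (algebraMap ℂ (PowerSeries A)) *
    Ring.inverse (S.map (dilate (q ^ (-(N : ℤ))))) *
      (cDiag N r).map (algebraMap ℂ (PowerSeries A))

end Sklyanin

end SklyaninJacobi

/-! Three facts carry the identity for minors. The first is fusion. At parameters with ratio `q²`
the R-matrix is a multiple of `1 - P^q`. By the Yang–Baxter equation, its partial transposes and the
reflection relation, this operator on adjacent slots can be moved through `⟨S_1, …, S_m⟩`
(`bracket_passes`). Hence `A_m ⟨S⟩ = A_m ⟨S⟩ A_m` (`antisymmetrizer_mul_bracket_mul`). For `m = N`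
the antisymmetrizer has rank one, so `A_N ⟨S⟩ = sdet_q S · A_N`
(`antisymmetrizer_mul_bracket_apply`).

The second is crossing symmetry. The inverse of `R̄^t(x)` is `R̄^t(q^{-2N} x)` for `q⁻¹`, with its
tensor factors exchanged and conjugated by `C ⊗ C` (`crossing_mul`). Together with `X(u) = C⁻¹
S(q^{-N}u)⁻¹ C`, this makes every factor of a `q`-bracket of `S` invertible by a factor of a
`q⁻¹`-bracket of `X`. The inverse of a product reverses the order of the slots. So the last `k`
slots of `⟨S_1, …, S_N⟩` are inverted, up to conjugation, by the `q⁻¹`-bracket of `X` at `q^{2-N}u`,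
read backwards (`pairProd_dual`).

The third concerns matrix entries. With `m + k = N`, split the bracket as (first `m` slots) · (cross
factors) · (last `k` slots), and cancel the last part in `A_N ⟨S⟩ = sdet_q S · A_N`. Take the
diagonal entry at a sequence listing `I` and then its complement. There the cross factors act as the
identity, because `R̄^t` fixes `e_i ⊗ e_j` for `i ≠ j`. The conjugation by `C` drops out because
`A_N` preserves weights. What remains of `A_N` is `A_m^q` on the first block and, after the
reversal, `A_k^{q⁻¹}` on the second. These give the two minors (`sklyaninMinor_eq_sdet_mul`).

For the reflection relation of `X`, exchange both the slots and the variables in the relation of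
`S`, rescale by `q^N`, and invert. The exchange turns `R` into the R-matrix for `q⁻¹`, and crossing
turns the inverse of `R^t` into `R^t` for `q⁻¹` (`reflectionRelation_xMatrix`). Invertibility of `S`
is read off the constant term. This term is unipotent lower triangular in the orthogonal case. In
the symplectic case it is block triangular with `2 × 2` blocks inverted by a `q`-determinant
(`isUnit_genMatrix`). -/

namespace SklyaninJacobi

/-! ### Embedding operators into larger tensor powers -/

section Embed

variable {N k l n : ℕ} {B : Type*}

/-- The operator on `(ℂ^N)^{⊗n}` acting as `M` on the tensor factors `e 0, e 1, …` and as the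
identity on all other factors. -/
def embed [Zero B] (e : Fin k → Fin n) (M : Matrix (Fin k → Fin N) (Fin k → Fin N) B) :
    Matrix (Fin n → Fin N) (Fin n → Fin N) B :=
  fun a b => if ∀ i, (∀ j, e j ≠ i) → a i = b i then M (a ∘ e) (b ∘ e) else 0

theorem embed_apply [Zero B] (e : Fin k → Fin n) (M : Matrix (Fin k → Fin N) (Fin k → Fin N) B)
    (a b : Fin n → Fin N) : embed e M a b =
      if ∀ i, (∀ j, e j ≠ i) → a i = b i then M (a ∘ e) (b ∘ e) else 0 := rfl

theorem embed_map [Zero B] {B' : Type*} [Zero B'] (e : Fin k → Fin n)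
    (M : Matrix (Fin k → Fin N) (Fin k → Fin N) B) (f : B → B') (hf : f 0 = 0) :
    (embed e M).map f = embed e (M.map f) := by
  ext a b
  simp only [Matrix.map_apply, embed_apply]
  split_ifs <;> simp [hf]

theorem onSlot_map [Zero B] {B' : Type*} [Zero B'] (p : Fin n)
    (M : Matrix (Fin N) (Fin N) B) (f : B → B') (hf : f 0 = 0) :
    (onSlot p M).map f = onSlot p (M.map f) := by
  ext a b
  simp only [Matrix.map_apply, onSlot]
  split_ifs <;> simp [hf]

theorem onSlots_map [Zero B] {B' : Type*} [Zero B'] (p p' : Fin n)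
    (M : Matrix (Fin N × Fin N) (Fin N × Fin N) B) (f : B → B') (hf : f 0 = 0) :
    (onSlots p p' M).map f = onSlots p p' (M.map f) := by
  ext a b
  simp only [Matrix.map_apply, onSlots]
  split_ifs <;> simp [hf]

theorem embed_embed [Zero B] {e : Fin l → Fin n} (he : Function.Injective e)
    (e' : Fin k → Fin l) (M : Matrix (Fin k → Fin N) (Fin k → Fin N) B) :
    embed e (embed e' M) = embed (e ∘ e') M := by
  ext a b
  simp only [embed_apply, Function.comp_apply, ← ite_and, Function.comp_assoc]
  refine if_congr ⟨?_, ?_⟩ rfl rfl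
  · rintro ⟨h1, h2⟩ i hi
    by_cases h : ∀ j, e j ≠ i
    · exact h1 i h
    · push Not at h
      obtain ⟨j, rfl⟩ := h
      exact h2 j fun j' h' => hi j' (by rw [h'])
  · intro h
    exact ⟨fun i hi => h i fun j => hi _, fun i hi => h _ fun j hj => hi j (he hj)⟩

theorem onSlot_eq_embed [Zero B] (p : Fin n) (M : Matrix (Fin N) (Fin N) B) :
    onSlot p M = embed ![p] (M.submatrix (fun a => a 0) (fun a => a 0)) := by
  ext a b
  simp only [onSlot]
  refine if_congr ?_ rfl rfl
  simp [eq_comm]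

theorem onSlots_eq_embed [Zero B] (p p' : Fin n)
    (M : Matrix (Fin N × Fin N) (Fin N × Fin N) B) :
    onSlots p p' M = embed ![p, p'] (M.submatrix (fun a => (a 0, a 1)) (fun a => (a 0, a 1))) := by
  ext a b
  simp only [onSlots]
  refine if_congr ?_ rfl rfl
  simp [Fin.forall_fin_two, eq_comm]

theorem embed_onSlot [Zero B] {e : Fin k → Fin n} (he : Function.Injective e) (p : Fin k)
    (M : Matrix (Fin N) (Fin N) B) : embed e (onSlot p M) = onSlot (e p) M := by
  rw [onSlot_eq_embed, embed_embed he, onSlot_eq_embed]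
  congr 1
  ext i
  fin_cases i
  simp

theorem embed_onSlots [Zero B] {e : Fin k → Fin n} (he : Function.Injective e) (p p' : Fin k)
    (M : Matrix (Fin N × Fin N) (Fin N × Fin N) B) :
    embed e (onSlots p p' M) = onSlots (e p) (e p') M := by
  rw [onSlots_eq_embed, embed_embed he, onSlots_eq_embed]
  congr 1
  ext i
  fin_cases i <;> simp

theorem onSlots_flip [Zero B] (p p' : Fin n) (M : Matrix (Fin N × Fin N) (Fin N × Fin N) B) :
    onSlots p p' M = onSlots p' p (M.submatrix Prod.swap Prod.swap) := by
  ext a b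
  simp only [onSlots, Matrix.submatrix_apply, Prod.swap_prod_mk]
  refine if_congr ⟨?_, ?_⟩ rfl rfl <;> exact fun h k h1 h2 => h k h2 h1

theorem extend_comp_inj {e : Fin k → Fin n} (he : Function.Injective e) (x : Fin k → Fin N)
    (a : Fin n → Fin N) : Function.extend e x a ∘ e = x :=
  funext fun j => he.extend_apply x a j

/-- An intermediate index contributes only if it agrees with `a` off the image of `e`, so it is
determined by its restriction `x` and equals `Function.extend e x a`. -/
theorem embed_mul_apply [NonUnitalNonAssocSemiring B] {e : Fin k → Fin n}
    (he : Function.Injective e) (M : Matrix (Fin k → Fin N) (Fin k → Fin N) B)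
    (Y : Matrix (Fin n → Fin N) (Fin n → Fin N) B) (a b : Fin n → Fin N) :
    (embed e M * Y) a b = ∑ x, M (a ∘ e) x * Y (Function.extend e x a) b := by
  rw [Matrix.mul_apply]
  symm
  refine Finset.sum_of_injOn (fun x => Function.extend e x a) ?_ (fun _ _ => by simp) ?_ ?_
  · intro x _ y _ h
    rw [← extend_comp_inj he x a, ← extend_comp_inj he y a]
    exact congrArg (· ∘ e) h
  · intro c _ hc
    rw [embed_apply, if_neg, zero_mul]
    intro h
    refine hc ⟨c ∘ e, by simp, ?_⟩
    ext i
    by_cases hi : ∃ j, e j = i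
    · obtain ⟨j, rfl⟩ := hi
      simp [he.extend_apply]
    · exact congrArg Fin.val ((Function.extend_apply' _ _ _ hi).trans (h i fun j hj => hi ⟨j, hj⟩))
  · intro x _
    rw [embed_apply, if_pos, extend_comp_inj he]
    intro i hi
    rw [Function.extend_apply' _ _ _ fun ⟨j, hj⟩ => hi j hj]

theorem embed_mul [NonUnitalNonAssocSemiring B] {e : Fin k → Fin n}
    (he : Function.Injective e) (M M' : Matrix (Fin k → Fin N) (Fin k → Fin N) B) :
    embed e (M * M') = embed e M * embed e M' := by
  ext a b
  rw [embed_mul_apply he]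
  simp only [embed_apply, extend_comp_inj he, Matrix.mul_apply]
  have : ∀ x : Fin k → Fin N, (∀ i, (∀ j, e j ≠ i) → Function.extend e x a i = b i) ↔
      ∀ i, (∀ j, e j ≠ i) → a i = b i := by
    intro x
    refine forall_congr' fun i => forall_congr' fun hi => ?_
    rw [Function.extend_apply' _ _ _ fun ⟨j, hj⟩ => hi j hj]
  simp only [this]
  split_ifs <;> simp

theorem embed_one [Zero B] [One B] {e : Fin k → Fin n} :
    embed e (1 : Matrix (Fin k → Fin N) (Fin k → Fin N) B) = 1 := by
  ext a b
  simp only [embed_apply, Matrix.one_apply, ← ite_and]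
  refine if_congr ⟨?_, ?_⟩ rfl rfl
  · rintro ⟨h1, h2⟩
    ext i
    by_cases hi : ∃ j, e j = i
    · obtain ⟨j, rfl⟩ := hi
      exact congrArg Fin.val (congrFun h2 j)
    · rw [h1 i fun j hj => hi ⟨j, hj⟩]
  · rintro rfl
    simp

/-- With disjoint slots a single intermediate index survives: `b` on the image of `e`, `a`
elsewhere. The resulting formula is symmetric up to the order of two scalars, which is how
`commute_embed` works over a noncommutative `B`. -/
theorem embed_mul_embed_apply [NonUnitalNonAssocSemiring B] {e : Fin k → Fin n}
    {e' : Fin l → Fin n} (he : Function.Injective e) (h : ∀ i j, e i ≠ e' j)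
    (M : Matrix (Fin k → Fin N) (Fin k → Fin N) B) (M' : Matrix (Fin l → Fin N) (Fin l → Fin N) B)
    (a b : Fin n → Fin N) :
    (embed e M * embed e' M') a b =
      if ∀ i, (∀ j, e j ≠ i) → (∀ j, e' j ≠ i) → a i = b i
        then M (a ∘ e) (b ∘ e) * M' (a ∘ e') (b ∘ e') else 0 := by
  rw [embed_mul_apply he, Finset.sum_eq_single (b ∘ e)]
  · have hc : Function.extend e (b ∘ e) a ∘ e' = a ∘ e' := by
      ext j
      simp only [Function.comp_apply]
      rw [Function.extend_apply' _ _ _ fun ⟨i, hi⟩ => h i j hi]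
    simp only [embed_apply, mul_ite, mul_zero, hc]
    refine if_congr ⟨?_, ?_⟩ rfl rfl
    · intro h1 i hi hi'
      rw [← h1 i hi', Function.extend_apply' _ _ _ fun ⟨j, hj⟩ => hi j hj]
    · intro h1 i hi'
      by_cases hi : ∃ j, e j = i
      · obtain ⟨j, rfl⟩ := hi
        simp [he.extend_apply]
      · rw [Function.extend_apply' _ _ _ hi, h1 i (fun j hj => hi ⟨j, hj⟩) hi']
  · intro x _ hx
    rw [embed_apply, if_neg, mul_zero]
    intro h1
    refine hx (funext fun j => ?_)
    rw [Function.comp_apply, ← h1 (e j) fun i hi => h j i hi.symm, he.extend_apply]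
  · simp

theorem commute_embed [NonUnitalNonAssocSemiring B] {e : Fin k → Fin n}
    {e' : Fin l → Fin n} (he : Function.Injective e) (he' : Function.Injective e')
    (h : ∀ i j, e i ≠ e' j)
    {M : Matrix (Fin k → Fin N) (Fin k → Fin N) B} {M' : Matrix (Fin l → Fin N) (Fin l → Fin N) B}
    (hM : ∀ a b c d, Commute (M a b) (M' c d)) : Commute (embed e M) (embed e' M') := by
  ext a b
  rw [embed_mul_embed_apply he h, embed_mul_embed_apply he' fun i j => (h j i).symm,
    (hM _ _ _ _).eq]
  refine if_congr ⟨?_, ?_⟩ rfl rfl <;> exact fun h i h1 h2 => h i h2 h1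

theorem injective_single (p : Fin n) : Function.Injective ![p] :=
  Function.injective_of_subsingleton _

theorem injective_pair {p p' : Fin n} (h : p ≠ p') : Function.Injective ![p, p'] := by
  intro i j hij
  fin_cases i <;> fin_cases j <;> simp_all [eq_comm]

theorem injective_triple {i j k : Fin n} (hij : i ≠ j) (hik : i ≠ k) (hjk : j ≠ k) :
    Function.Injective ![i, j, k] := by
  intro x y hxy
  fin_cases x <;> fin_cases y <;> simp_all [eq_comm]

theorem commute_onSlot_onSlots [NonUnitalNonAssocSemiring B] {i j k : Fin n}
    (hij : i ≠ j) (hik : i ≠ k) (hjk : j ≠ k) {M : Matrix (Fin N) (Fin N) B}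
    {M' : Matrix (Fin N × Fin N) (Fin N × Fin N) B} (hM : ∀ a b c d, Commute (M a b) (M' c d)) :
    Commute (onSlot i M) (onSlots j k M') := by
  rw [onSlot_eq_embed, onSlots_eq_embed]
  refine commute_embed (injective_single i) (injective_pair hjk) ?_ fun _ _ _ _ => hM _ _ _ _
  simp [Fin.forall_fin_two, hij, hik]

theorem commute_onSlots_onSlots [NonUnitalNonAssocSemiring B] {i j k l : Fin n}
    (hij : i ≠ j) (hik : i ≠ k) (hil : i ≠ l) (hjk : j ≠ k) (hjl : j ≠ l) (hkl : k ≠ l)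
    {M M' : Matrix (Fin N × Fin N) (Fin N × Fin N) B} (hM : ∀ a b c d, Commute (M a b) (M' c d)) :
    Commute (onSlots i j M) (onSlots k l M') := by
  rw [onSlots_eq_embed, onSlots_eq_embed]
  refine commute_embed (injective_pair hij) (injective_pair hkl) ?_ fun _ _ _ _ => hM _ _ _ _
  simp [Fin.forall_fin_two, *]

theorem onSlot_mul [Semiring B] (p : Fin n) (M M' : Matrix (Fin N) (Fin N) B) :
    onSlot p (M * M') = onSlot p M * onSlot p M' := by
  rw [onSlot_eq_embed, onSlot_eq_embed, onSlot_eq_embed, ← embed_mul (injective_single p)]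
  congr 1
  ext a b
  rw [Matrix.submatrix_apply, Matrix.mul_apply, Matrix.mul_apply]
  exact (Equiv.sum_comp (Equiv.funUnique (Fin 1) (Fin N)) fun x => M (a 0) x * M' x (b 0)).symm

theorem onSlot_one [Semiring B] (p : Fin n) :
    onSlot p (1 : Matrix (Fin N) (Fin N) B) = 1 := by
  rw [onSlot_eq_embed, ← embed_one (e := ![p])]
  congr 1
  ext a b
  simp [Matrix.one_apply, funext_iff]

theorem onSlots_mul [Semiring B] {p p' : Fin n} (h : p ≠ p')
    (M M' : Matrix (Fin N × Fin N) (Fin N × Fin N) B) :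
    onSlots p p' (M * M') = onSlots p p' M * onSlots p p' M' := by
  rw [onSlots_eq_embed, onSlots_eq_embed, onSlots_eq_embed, ← embed_mul (injective_pair h)]
  congr 1
  ext a b
  rw [Matrix.submatrix_apply, Matrix.mul_apply, Matrix.mul_apply]
  exact (Equiv.sum_comp (finTwoArrowEquiv (Fin N)) fun x => M (a 0, a 1) x * M' x (b 0, b 1)).symm

theorem onSlots_one [Semiring B] (p p' : Fin n) :
    onSlots p p' (1 : Matrix (Fin N × Fin N) (Fin N × Fin N) B) = 1 := by
  rw [onSlots_eq_embed, ← embed_one (e := ![p, p'])]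
  congr 1
  ext a b
  simp [Matrix.one_apply, funext_iff, Fin.forall_fin_two]

theorem onSlots_smul [MulZeroClass B] (p p' : Fin n) (c : B)
    (M : Matrix (Fin N × Fin N) (Fin N × Fin N) B) :
    onSlots p p' (c • M) = c • onSlots p p' M := by
  ext a b
  simp only [onSlots, Matrix.smul_apply, smul_eq_mul]
  split_ifs <;> simp

end Embed

/-! ### Ordered products with pairwise factors -/

section PairProduct

variable {ι M : Type*} [Ring M]

/-- The product `s_{i_1} (ρ_{i_1 i_2} ⋯ ρ_{i_1 i_m}) s_{i_2} (ρ_{i_2 i_3} ⋯) ⋯ s_{i_m}`. -/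
def pairProd (s : ι → M) (ρ : ι → ι → M) : List ι → M
  | [] => 1
  | i :: l => s i * (l.map (ρ i)).prod * pairProd s ρ l

/-- The product of all `ρ_{ij}` with `i` in the first and `j` in the second list. -/
def crossProd (ρ : ι → ι → M) (l₁ l₂ : List ι) : M :=
  (l₁.map fun i => (l₂.map (ρ i)).prod).prod

theorem commute_list_map_prod {κ : Type*} {x : M} {l : List κ} {f : κ → M}
    (h : ∀ i ∈ l, Commute x (f i)) : Commute x (l.map f).prod :=
  Commute.list_prod_right _ _ fun y hy => by
    obtain ⟨i, hi, rfl⟩ := List.mem_map.1 hy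
    exact h i hi

theorem prod_filter_eq_pairProd [LinearOrder ι] (s : ι → M) (ρ : ι → ι → M) {l : List ι}
    (hl : l.Pairwise (· < ·)) :
    (l.map fun i => s i * ((l.filter (i < ·)).map (ρ i)).prod).prod = pairProd s ρ l := by
  induction l with
  | nil => rfl
  | cons i l ih =>
    rw [List.pairwise_cons] at hl
    rw [List.map_cons, List.prod_cons, pairProd, ← ih hl.2]
    congr 1
    · congr 3
      rw [List.filter_cons_of_neg (by simp), List.filter_eq_self.2]
      simpa using hl.1
    · congr 1
      refine List.map_congr_left fun j hj => ?_
      rw [List.filter_cons_of_neg (by simpa using (hl.1 j hj).le)]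

theorem pairProd_map {κ : Type*} (f : κ → ι) (s : ι → M) (ρ : ι → ι → M) (l : List κ) :
    pairProd s ρ (l.map f) = pairProd (s ∘ f) (fun i j => ρ (f i) (f j)) l := by
  induction l with
  | nil => rfl
  | cons i l ih => simp [pairProd, ih, Function.comp_def]

theorem map_pairProd {M' : Type*} [Ring M'] (F : M →+* M') (s : ι → M) (ρ : ι → ι → M)
    (l : List ι) : F (pairProd s ρ l) = pairProd (fun i => F (s i)) (fun i j => F (ρ i j)) l := by
  induction l with
  | nil => simp [pairProd]
  | cons i l ih => simp [pairProd, ih, map_list_prod, Function.comp_def]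

theorem pairProd_congr {s s' : ι → M} {ρ ρ' : ι → ι → M} {l : List ι} (hl : l.Nodup)
    (hs : ∀ i, s i = s' i) (hρ : ∀ i j, i ≠ j → ρ i j = ρ' i j) :
    pairProd s ρ l = pairProd s' ρ' l := by
  induction l with
  | nil => rfl
  | cons i l ih =>
    rw [List.nodup_cons] at hl
    rw [pairProd, pairProd, ih hl.2, hs, List.map_congr_left fun j hj => hρ i j ?_]
    rintro rfl
    exact hl.1 hj

/-- Factors with disjoint indices commute. -/
structure DisjointCommute (s : ι → M) (ρ : ι → ι → M) : Prop where
  single : ∀ i j k, i ≠ j → i ≠ k → j ≠ k → Commute (s i) (ρ j k)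
  pair : ∀ i j k l, i ≠ j → i ≠ k → i ≠ l → j ≠ k → j ≠ l → k ≠ l → Commute (ρ i j) (ρ k l)

theorem commute_pairProd {x : M} {s : ι → M} {ρ : ι → ι → M} {l : List ι} (hl : l.Nodup)
    (hs : ∀ i ∈ l, Commute x (s i)) (hρ : ∀ i ∈ l, ∀ j ∈ l, i ≠ j → Commute x (ρ i j)) :
    Commute x (pairProd s ρ l) := by
  induction l with
  | nil => exact Commute.one_right x
  | cons i l ih =>
    rw [List.nodup_cons] at hl
    refine ((hs i (by simp)).mul_right (commute_list_map_prod fun j hj => ?_)).mul_right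
      (ih hl.2 (fun j hj => hs j (by simp [hj]))
        fun j hj k hk => hρ j (by simp [hj]) k (by simp [hk]))
    exact hρ i (by simp) j (by simp [hj]) fun h => hl.1 (h ▸ hj)

/-- The factors pairing `i` with the second list involve no index of the remaining first list except
`i` itself, which no longer occurs. They therefore commute past the pair product of that list and
collect in the middle. -/
theorem pairProd_append {s : ι → M} {ρ : ι → ι → M} (h : DisjointCommute s ρ) (l₁ l₂ : List ι)
    (hl : (l₁ ++ l₂).Nodup) :
    pairProd s ρ (l₁ ++ l₂) = pairProd s ρ l₁ * crossProd ρ l₁ l₂ * pairProd s ρ l₂ := by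
  induction l₁ with
  | nil => simp [pairProd, crossProd]
  | cons i l ih =>
    rw [List.cons_append, List.nodup_cons, List.mem_append, not_or] at hl
    obtain ⟨⟨hil, hil₂⟩, hl⟩ := hl
    have hd := (List.nodup_append.1 hl).2.2
    have hc : Commute (l₂.map (ρ i)).prod (pairProd s ρ l) := by
      refine (Commute.symm ?_)
      refine commute_list_map_prod fun j hj => Commute.symm ?_
      have hij : i ≠ j := fun e => hil₂ (e ▸ hj)
      refine commute_pairProd (List.nodup_append.1 hl).1 (fun k hk => ?_) fun k hk k' hk' hkk => ?_
      · exact (h.single k i j (fun e => hil (e ▸ hk)) (hd k hk j hj) hij).symm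
      · exact h.pair i j k k' hij (fun e => hil (e ▸ hk)) (fun e => hil (e ▸ hk'))
          (hd k hk j hj).symm (hd k' hk' j hj).symm hkk
    rw [List.cons_append, pairProd, ih hl, pairProd, List.map_append, List.prod_append]
    simp only [crossProd, List.map_cons, List.prod_cons]
    simp only [mul_assoc]
    congr 2
    rw [← mul_assoc, hc.eq]
    simp only [mul_assoc]

theorem list_prod_mul_reverse_prod {κ : Type*} {f g : κ → M} {l : List κ}
    (h : ∀ i ∈ l, f i * g i = 1) :
    (l.map f).prod * (l.reverse.map g).prod = 1 := by
  induction l with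
  | nil => simp
  | cons i l ih =>
    have := ih fun j hj => h j (by simp [hj])
    rw [List.reverse_cons, List.map_append, List.prod_append, List.map_cons, List.prod_cons,
      mul_assoc (f i), ← mul_assoc (l.map f).prod, this, one_mul]
    simpa using h i (by simp)

/-- Telescoping from the inside out: once the inner lists cancel, the row of factors `ρ i j` meets
the column of their inverses `ρ' j i` in opposite order, and finally `s i` meets `s' i`. -/
theorem pairProd_mul_reverse {s s' : ι → M} {ρ ρ' : ι → ι → M} (h : DisjointCommute s' ρ')
    {l : List ι} (hl : l.Nodup) (hs : ∀ i, s i * s' i = 1)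
    (hρ : ∀ i j, i ≠ j → ρ i j * ρ' j i = 1) :
    pairProd s ρ l * pairProd s' ρ' l.reverse = 1 := by
  induction l with
  | nil => simp [pairProd]
  | cons i l ih =>
    have hl' : (l.reverse ++ [i]).Nodup := by
      rw [← List.reverse_cons]
      exact List.nodup_reverse.2 hl
    rw [List.nodup_cons] at hl
    rw [List.reverse_cons, pairProd_append h _ _ hl', pairProd]
    have h1 : (l.map (ρ i)).prod * crossProd ρ' l.reverse [i] = 1 := by
      simp only [crossProd, List.map_cons, List.map_nil, List.prod_cons, List.prod_nil, mul_one]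
      exact list_prod_mul_reverse_prod fun j hj => hρ i j fun e => hl.1 (e ▸ hj)
    have h2 : pairProd s' ρ' [i] = s' i := by simp [pairProd]
    calc _ = s i * ((l.map (ρ i)).prod * (pairProd s ρ l * pairProd s' ρ' l.reverse)
            * crossProd ρ' l.reverse [i]) * pairProd s' ρ' [i] := by simp only [mul_assoc]
      _ = 1 := by rw [ih hl.2, mul_one, h1, mul_one, h2, hs]

/-- `p` can be moved through `x` from left to right. -/
def Passes (p x : M) : Prop := ∃ y, p * x = y * p

theorem Commute.passes {p x : M} (h : Commute p x) : Passes p x := ⟨x, h⟩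

theorem Passes.mul {p x y : M} (hx : Passes p x) (hy : Passes p y) : Passes p (x * y) := by
  obtain ⟨x', hx⟩ := hx
  obtain ⟨y', hy⟩ := hy
  exact ⟨x' * y', by rw [← mul_assoc, hx, mul_assoc, hy, mul_assoc]⟩

theorem Passes.list_prod {κ : Type*} {p : M} {l : List κ} {f : κ → M}
    (h : ∀ i ∈ l, Passes p (f i)) : Passes p (l.map f).prod := by
  induction l with
  | nil => exact Commute.passes (Commute.one_right p)
  | cons i l ih =>
    rw [List.map_cons, List.prod_cons]
    exact (h i (by simp)).mul (ih fun j hj => h j (by simp [hj]))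

theorem list_prod_mul_list_prod {κ : Type*} {f g : κ → M} {l : List κ} (hl : l.Nodup)
    (h : ∀ i ∈ l, ∀ j ∈ l, i ≠ j → Commute (f i) (g j)) :
    (l.map f).prod * (l.map g).prod = (l.map fun i => f i * g i).prod := by
  induction l with
  | nil => simp
  | cons i l ih =>
    rw [List.nodup_cons] at hl
    simp only [List.map_cons, List.prod_cons]
    rw [← ih hl.2 fun j hj k hk => h j (by simp [hj]) k (by simp [hk])]
    have hc : Commute (g i) (l.map f).prod := commute_list_map_prod fun j hj =>
      (h j (by simp [hj]) i (by simp) fun e => hl.1 (e ▸ hj)).symm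
    simp only [mul_assoc]
    rw [← mul_assoc (g i), hc.eq, mul_assoc]

/-- The exchange relations of `p` with the factors of a pair product, at the adjacent indices
`i`, `j`. -/
structure Exchange (p : M) (i j : ι) (s : ι → M) (ρ : ι → ι → M) : Prop where
  single : ∀ k, k ≠ i → k ≠ j → Commute p (s k)
  pair : ∀ k l, k ≠ i → k ≠ j → l ≠ i → l ≠ j → k ≠ l → Commute p (ρ k l)
  left : ∀ k, k ≠ i → k ≠ j → Passes p (ρ k i * ρ k j)
  right : ∀ k, k ≠ i → k ≠ j → Passes p (ρ i k * ρ j k)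
  core : Passes p (s i * ρ i j * s j)

/-- Since `i` and `j` are adjacent in the list, disjoint commutation regroups all factors touching
them into `s i * ρ i j * s j` and the pairs `ρ i k * ρ j k`, `ρ k i * ρ k j`. Each of these has its
own exchange relation with `p`; all other factors commute with `p`. -/
theorem Exchange.passes {p : M} {i j : ι} {s : ι → M} {ρ : ι → ι → M} (hp : Exchange p i j s ρ)
    (h : DisjointCommute s ρ) (hij : i ≠ j) (l₁ l₂ : List ι) (hl : (l₁ ++ i :: j :: l₂).Nodup) :
    Passes p (pairProd s ρ (l₁ ++ i :: j :: l₂)) := by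
  induction l₁ with
  | nil =>
    simp only [List.nil_append, List.nodup_cons, List.mem_cons, not_or] at hl
    obtain ⟨⟨-, hi⟩, hj, hl⟩ := hl
    have hi' : ∀ k ∈ l₂, k ≠ i := fun k hk e => hi (e ▸ hk)
    have hj' : ∀ k ∈ l₂, k ≠ j := fun k hk e => hj (e ▸ hk)
    have hc : Commute (s j) (l₂.map (ρ i)).prod := commute_list_map_prod fun k hk =>
      h.single j i k hij.symm (hj' k hk).symm (hi' k hk).symm
    have e : pairProd s ρ (i :: j :: l₂) =
        (s i * ρ i j * s j) * (l₂.map fun k => ρ i k * ρ j k).prod * pairProd s ρ l₂ := by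
      rw [← list_prod_mul_list_prod hl]
      · simp only [pairProd, List.map_cons, List.prod_cons, mul_assoc]
        rw [← mul_assoc (s j) (l₂.map (ρ i)).prod, hc.eq]
        simp only [mul_assoc]
      · intro k hk k' hk' hkk
        exact h.pair i k j k' (hi' k hk).symm hij (hi' k' hk').symm (hj' k hk) hkk
          (hj' k' hk').symm
    rw [List.nil_append, e]
    refine (hp.core.mul (Passes.list_prod fun k hk => hp.right k (hi' k hk) (hj' k hk))).mul
      (Commute.passes (commute_pairProd hl (fun k hk => hp.single k (hi' k hk) (hj' k hk)) ?_))
    exact fun k hk k' hk' hkk => hp.pair k k' (hi' k hk) (hj' k hk) (hi' k' hk') (hj' k' hk') hkk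
  | cons k l ih =>
    rw [List.cons_append, List.nodup_cons] at hl
    obtain ⟨hk, hl⟩ := hl
    simp only [List.mem_append, List.mem_cons, not_or] at hk
    obtain ⟨hkl, hki, hkj, hkl₂⟩ := hk
    have hd := (List.nodup_append.1 hl).2.2
    have hl₂ := (List.nodup_append.1 hl).2.1
    simp only [List.nodup_cons, List.mem_cons, not_or] at hl₂
    rw [List.cons_append, pairProd]
    refine ((Commute.passes (hp.single k hki hkj)).mul ?_).mul (ih hl)
    have e : ((l ++ i :: j :: l₂).map (ρ k)).prod =
        (l.map (ρ k)).prod * (ρ k i * ρ k j) * (l₂.map (ρ k)).prod := by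
      simp [mul_assoc]
    rw [e]
    refine ((Passes.list_prod fun m hm => Commute.passes ?_).mul (hp.left k hki hkj)).mul
      (Passes.list_prod fun m hm => Commute.passes ?_)
    · exact hp.pair k m hki hkj (hd m hm i (by simp)) (hd m hm j (by simp))
        fun e => hkl (e ▸ hm)
    · exact hp.pair k m hki hkj (fun e => hl₂.1.2 (e ▸ hm)) (fun e => hl₂.2.1 (e ▸ hm))
        fun e => hkl₂ (e ▸ hm)

end PairProduct

end SklyaninJacobi

namespace SklyaninJacobi

/-! ### Identities for the R-matrix -/

section RMatrix

variable {N n : ℕ} {B : Type*} [CommRing B] [Algebra ℂ B]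

/-- The coefficient of `E_{ii} ⊗ E_{jj}` in `R(x, y)`. -/
noncomputable def rDiag (q : ℂ) (x y : B) (i j : Fin N) : B :=
  if i = j then q⁻¹ • x - q • y else x - y

/-- The coefficient of `E_{ij} ⊗ E_{ji}`, `i ≠ j`, in `R(x, y)`. -/
noncomputable def rOff (q : ℂ) (x y : B) (i j : Fin N) : B :=
  if j < i then (q⁻¹ - q) • x else if i < j then (q⁻¹ - q) • y else 0

/-- The two indicators overlap when `i = j`. There `rOff` vanishes, so the sum is still correct and
no case distinction remains in later computations. -/
theorem rMatrix_eq (q : ℂ) (x y : B) (i j k l : Fin N) :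
    rMatrix N q x y (i, j) (k, l) =
      (if i = k ∧ j = l then rDiag q x y i j else 0)
        + (if i = l ∧ j = k then rOff q x y i j else 0) := by
  simp only [rMatrix, rDiag, rOff, Prod.mk.injEq]
  rcases lt_trichotomy i j with h | h | h
  · by_cases h1 : i = k ∧ j = l
    · obtain ⟨rfl, rfl⟩ := h1
      simp [h.ne]
    · simp [h1, h.not_gt, h]
  · subst h
    simp +contextual [and_comm]
  · by_cases h1 : i = k ∧ j = l
    · obtain ⟨rfl, rfl⟩ := h1
      simp [h.ne']
    · simp [h1, h]

theorem sum_rMatrix_mul (q : ℂ) (x y : B) (i j : Fin N) (F : Fin N × Fin N → B) :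
    ∑ c, rMatrix N q x y (i, j) c * F c = rDiag q x y i j * F (i, j) + rOff q x y i j * F (j, i) := by
  rw [Fintype.sum_prod_type]
  simp only [rMatrix_eq, add_mul, Finset.sum_add_distrib, ite_mul, zero_mul, ite_and]
  simp

/-- Transposing both tensor factors and exchanging them preserves `R`. This is the symmetry that
yields the second partially transposed Yang–Baxter equation. -/
theorem rMatrix_transpose (q : ℂ) (x y : B) (i j k l : Fin N) :
    rMatrix N q x y (i, j) (k, l) = rMatrix N q x y (l, k) (j, i) := by
  rw [rMatrix_eq, rMatrix_eq]
  by_cases h1 : i = k ∧ j = l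
  · obtain ⟨rfl, rfl⟩ := h1
    by_cases h : i = j <;> simp [rDiag, rOff, h, eq_comm]
  · by_cases h2 : i = l ∧ j = k
    · obtain ⟨rfl, rfl⟩ := h2
      by_cases h : i = j <;> simp [h, eq_comm]
    · rw [if_neg h1, if_neg h2, if_neg, if_neg] <;> tauto

/-- Exchanging the tensor factors turns `i < j` into `i > j`, so the roles of `x` and `y` off the
diagonal are interchanged. The passage from `q` to `q⁻¹` then changes only the overall sign. This is
where the `q⁻¹`-reflection relation comes from. -/
theorem rMatrix_inv_flip (q : ℂ) (x y : B) (i j k l : Fin N) :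
    rMatrix N q⁻¹ x y (j, i) (l, k) = - rMatrix N q y x (i, j) (k, l) := by
  rw [rMatrix_eq, rMatrix_eq]
  by_cases h1 : i = k ∧ j = l
  · obtain ⟨rfl, rfl⟩ := h1
    rcases lt_trichotomy i j with h | h | h
    · simp [rDiag, h.ne, h.ne']
    · subst h; simp [rDiag, rOff]
    · simp [rDiag, h.ne, h.ne']
  · rw [if_neg h1, if_neg (by tauto)]
    by_cases h2 : i = l ∧ j = k
    · obtain ⟨rfl, rfl⟩ := h2
      rcases lt_trichotomy i j with h | h | h
      · simp [rOff, h, h.not_gt, sub_smul]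
      · subst h; simp [rOff]
      · simp [rOff, h, h.not_gt, sub_smul]
    · rw [if_neg (by tauto), if_neg (by tauto)]
      simp

theorem rMatrix_smul (q : ℂ) (c x y : B) :
    rMatrix N q (c * x) (c * y) = c • rMatrix N q x y := by
  ext ⟨i, j⟩ ⟨k, l⟩
  rw [Matrix.smul_apply, rMatrix_eq, rMatrix_eq]
  simp only [rDiag, rOff, smul_eq_mul, ← mul_smul_comm]
  split_ifs <;> ring

theorem rMatrix_map {B' : Type*} [CommRing B'] [Algebra ℂ B'] (f : B →ₐ[ℂ] B') (q : ℂ) (x y : B) :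
    (rMatrix N q x y).map f = rMatrix N q (f x) (f y) := by
  ext ⟨i, j⟩ ⟨k, l⟩
  simp only [Matrix.map_apply, rMatrix_eq, rDiag, rOff, map_add]
  split_ifs <;> simp

/-- The fusion point: at ratio `q²` the R-matrix degenerates to a multiple of `1 - P^q`. -/
theorem rMatrix_sq_one {q : ℂ} (hq : q ≠ 0) :
    rMatrix N q (algebraMap ℂ B (q ^ 2)) 1 =
      algebraMap ℂ B (q ^ 2 - 1) • (1 - qFlip N q).map (algebraMap ℂ B) := by
  ext ⟨i, j⟩ ⟨k, l⟩
  rw [rMatrix_eq]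
  simp only [Matrix.smul_apply, Matrix.map_apply, Matrix.sub_apply, Matrix.one_apply, qFlip,
    Prod.mk.injEq, smul_eq_mul, ← map_mul, rDiag, rOff, Algebra.smul_def]
  rw [← map_one (algebraMap ℂ B)]
  simp only [← map_mul, ← map_sub]
  rw [← map_zero (algebraMap ℂ B)]
  simp only [← apply_ite (algebraMap ℂ B), ← map_add]
  congr 1
  by_cases h1 : i = k ∧ j = l
  · obtain ⟨rfl, rfl⟩ := h1
    by_cases h : i = j
    · subst h
      simp
      field_simp
      ring
    · simp [h]
  · by_cases h2 : i = l ∧ j = k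
    · obtain ⟨rfl, rfl⟩ := h2
      rcases lt_trichotomy i j with h | h | h
      · simp [h.ne, h, h.not_gt]
        field_simp
        ring
      · simp [h] at h1
      · simp [h.ne', h]
        field_simp
        ring
    · simp [h1, h2]

/-- The Yang–Baxter equation evaluated in a row `(i, j, k)`. `R` only permutes basis indices, with
coefficients depending on their relative order, so the claim reduces to polynomial identities in
`q`, `q⁻¹`, one for each order type of `i, j, k`. The extra `w` makes the equation homogeneous, with
parameter ratios `x/y`, `xw/z`, `yw/z`. -/
theorem yangBaxter_apply {q : ℂ} (hq : q ≠ 0) (x y z w : B) (i j k : Fin N)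
    (F : Fin N → Fin N → Fin N → B) :
    rDiag q x y i j * (rDiag q (x * w) z i k * (rDiag q (y * w) z j k * F i j k
          + rOff q (y * w) z j k * F i k j)
        + rOff q (x * w) z i k * (rDiag q (y * w) z j i * F k j i
          + rOff q (y * w) z j i * F k i j))
      + rOff q x y i j * (rDiag q (x * w) z j k * (rDiag q (y * w) z i k * F j i k
          + rOff q (y * w) z i k * F j k i)
        + rOff q (x * w) z j k * (rDiag q (y * w) z i j * F k i j
          + rOff q (y * w) z i j * F k j i)) =
    rDiag q (y * w) z j k * (rDiag q (x * w) z i k * (rDiag q x y i j * F i j k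
          + rOff q x y i j * F j i k)
        + rOff q (x * w) z i k * (rDiag q x y k j * F k j i
          + rOff q x y k j * F j k i))
      + rOff q (y * w) z j k * (rDiag q (x * w) z i j * (rDiag q x y i k * F i k j
          + rOff q x y i k * F k i j)
        + rOff q (x * w) z i j * (rDiag q x y j k * F j k i
          + rOff q x y j k * F k j i)) := by
  have h : algebraMap ℂ B q⁻¹ * algebraMap ℂ B q = 1 := by
    rw [← map_mul, inv_mul_cancel₀ hq, map_one]
  -- The images of `q⁻¹` and `q` become variables `p`, `s` with `p * s = 1`, the only relation that
  -- the identities need.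
  simp only [rDiag, rOff, Algebra.smul_def, map_sub]
  generalize algebraMap ℂ B q⁻¹ = p at h ⊢
  generalize algebraMap ℂ B q = s at h ⊢
  rcases lt_trichotomy i j with h1 | h1 | h1 <;> rcases lt_trichotomy j k with h2 | h2 | h2 <;>
    rcases lt_trichotomy i k with h3 | h3 | h3 <;>
    first
      | (exfalso; omega)
      | (try subst h1
         try subst h2
         try subst h3
         simp only [*, lt_irrefl, lt_asymm, ne_of_lt, ne_of_gt, if_true, if_false]
         first
           | ring1
           | grind)

end RMatrix

end SklyaninJacobi

namespace SklyaninJacobi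

/-! ### Matrix entries of products on three tensor factors. -/

section ThreeSlots

variable {N n : ℕ} {B : Type*}

theorem onSlots_mul_apply [Semiring B] {p p' : Fin n} (h : p ≠ p')
    (M : Matrix (Fin N × Fin N) (Fin N × Fin N) B)
    (Y : Matrix (Fin n → Fin N) (Fin n → Fin N) B) (a b : Fin n → Fin N) :
    (onSlots p p' M * Y) a b =
      ∑ c : Fin N × Fin N, M (a p, a p') c *
        Y (Function.update (Function.update a p c.1) p' c.2) b := by
  rw [onSlots_eq_embed, embed_mul_apply (injective_pair h)]
  rw [← Equiv.sum_comp (finTwoArrowEquiv (Fin N))]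
  refine Finset.sum_congr rfl fun x _ => ?_
  have e : Function.extend ![p, p'] x a =
      Function.update (Function.update a p (x 0)) p' (x 1) := by
    ext i
    congr 1
    by_cases h1 : i = p'
    · subst h1
      simpa using (injective_pair h).extend_apply x a 1
    · rw [Function.update_of_ne h1]
      by_cases h2 : i = p
      · subst h2
        simpa using (injective_pair h).extend_apply x a 0
      · rw [Function.update_of_ne h2, Function.extend_apply']
        rintro ⟨j, hj⟩
        fin_cases j
        · exact h2 hj.symm
        · exact h1 hj.symm
  rw [e]
  rfl

theorem update_triple_zero_one {α : Type*} (i j k x y : α) :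
    Function.update (Function.update ![i, j, k] 0 x) 1 y = ![x, y, k] := by
  ext m; fin_cases m <;> rfl

theorem update_triple_zero_two {α : Type*} (i j k x y : α) :
    Function.update (Function.update ![i, j, k] 0 x) 2 y = ![x, j, y] := by
  ext m; fin_cases m <;> rfl

theorem update_triple_one_two {α : Type*} (i j k x y : α) :
    Function.update (Function.update ![i, j, k] 1 x) 2 y = ![i, x, y] := by
  ext m; fin_cases m <;> rfl

variable (M M' M'' : Matrix (Fin N × Fin N) (Fin N × Fin N) B) (a b c d e f : Fin N)

theorem onSlots_zero_one_apply [Zero B] : (onSlots 0 1 M : Matrix (Fin 3 → _) _ B)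
    ![a, b, c] ![d, e, f] = if c = f then M (a, b) (d, e) else 0 := by
  simp [onSlots, Fin.forall_fin_succ]

theorem onSlots_zero_two_apply [Zero B] : (onSlots 0 2 M : Matrix (Fin 3 → _) _ B)
    ![a, b, c] ![d, e, f] = if b = e then M (a, c) (d, f) else 0 := by
  simp [onSlots, Fin.forall_fin_succ]

theorem onSlots_one_two_apply [Zero B] : (onSlots 1 2 M : Matrix (Fin 3 → _) _ B)
    ![a, b, c] ![d, e, f] = if a = d then M (b, c) (e, f) else 0 := by
  simp [onSlots, Fin.forall_fin_succ]

variable [Semiring B]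

theorem threeSlots_apply_01_02_12 :
    (onSlots 0 1 M * (onSlots 0 2 M' * onSlots 1 2 M'') : Matrix (Fin 3 → _) _ B)
      ![a, b, c] ![d, e, f] =
      ∑ g, ∑ h, ∑ k, M (a, b) (g, h) * (M' (g, c) (d, k) * M'' (h, k) (e, f)) := by
  rw [onSlots_mul_apply (by decide), Fintype.sum_prod_type]
  refine Finset.sum_congr rfl fun g _ => Finset.sum_congr rfl fun h _ => ?_
  rw [update_triple_zero_one, onSlots_mul_apply (by decide), Fintype.sum_prod_type,
    Finset.sum_eq_single d]
  · simp [update_triple_zero_two, onSlots_one_two_apply, Finset.mul_sum]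
  · intro x _ hx
    simp [update_triple_zero_two, onSlots_one_two_apply, hx]
  · simp

theorem threeSlots_apply_12_02_01 :
    (onSlots 1 2 M * (onSlots 0 2 M' * onSlots 0 1 M'') : Matrix (Fin 3 → _) _ B)
      ![a, b, c] ![d, e, f] =
      ∑ h, ∑ k, ∑ g, M (b, c) (h, k) * (M' (a, k) (g, f) * M'' (g, h) (d, e)) := by
  rw [onSlots_mul_apply (by decide), Fintype.sum_prod_type]
  refine Finset.sum_congr rfl fun g _ => Finset.sum_congr rfl fun h _ => ?_
  rw [update_triple_one_two, onSlots_mul_apply (by decide), Fintype.sum_prod_type,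
    Finset.mul_sum]
  refine Finset.sum_congr rfl fun x _ => ?_
  rw [Finset.sum_eq_single f]
  · simp [update_triple_zero_two, onSlots_zero_one_apply]
  · intro x _ hx
    simp [update_triple_zero_two, onSlots_zero_one_apply, hx]
  · simp

theorem threeSlots_apply_12_01_02 :
    (onSlots 1 2 M * (onSlots 0 1 M' * onSlots 0 2 M'') : Matrix (Fin 3 → _) _ B)
      ![a, b, c] ![d, e, f] =
      ∑ h, ∑ k, ∑ g, M (b, c) (h, k) * (M' (a, h) (g, e) * M'' (g, k) (d, f)) := by
  rw [onSlots_mul_apply (by decide), Fintype.sum_prod_type]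
  refine Finset.sum_congr rfl fun g _ => Finset.sum_congr rfl fun h _ => ?_
  rw [update_triple_one_two, onSlots_mul_apply (by decide), Fintype.sum_prod_type,
    Finset.mul_sum]
  refine Finset.sum_congr rfl fun x _ => ?_
  rw [Finset.sum_eq_single e]
  · simp [update_triple_zero_one, onSlots_zero_two_apply]
  · intro x _ hx
    simp [update_triple_zero_one, onSlots_zero_two_apply, hx]
  · simp

theorem threeSlots_apply_02_01_12 :
    (onSlots 0 2 M * (onSlots 0 1 M' * onSlots 1 2 M'') : Matrix (Fin 3 → _) _ B)
      ![a, b, c] ![d, e, f] =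
      ∑ g, ∑ k, ∑ h, M (a, c) (g, k) * (M' (g, b) (d, h) * M'' (h, k) (e, f)) := by
  rw [onSlots_mul_apply (by decide), Fintype.sum_prod_type]
  refine Finset.sum_congr rfl fun g _ => Finset.sum_congr rfl fun h _ => ?_
  rw [update_triple_zero_two, onSlots_mul_apply (by decide), Fintype.sum_prod_type,
    Finset.sum_eq_single d]
  · simp [update_triple_zero_one, onSlots_one_two_apply, Finset.mul_sum]
  · intro x _ hx
    simp [update_triple_zero_one, onSlots_one_two_apply, hx]
  · simp

end ThreeSlots

/-! ### The Yang–Baxter equation and its partial transposes. -/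

section YangBaxter

variable {N n : ℕ} {B : Type*} [CommRing B] [Algebra ℂ B]

theorem onSlots_rMatrix_mul_apply {p p' : Fin n} (h : p ≠ p') (q : ℂ) (x y : B)
    (Y : Matrix (Fin n → Fin N) (Fin n → Fin N) B) (a b : Fin n → Fin N) :
    (onSlots p p' (rMatrix N q x y) * Y) a b =
      rDiag q x y (a p) (a p') * Y (Function.update (Function.update a p (a p)) p' (a p')) b
        + rOff q x y (a p) (a p') *
          Y (Function.update (Function.update a p (a p')) p' (a p)) b := by
  rw [onSlots_mul_apply h]
  exact sum_rMatrix_mul q x y (a p) (a p')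
    fun c => Y (Function.update (Function.update a p c.1) p' c.2) b

theorem yangBaxter {q : ℂ} (hq : q ≠ 0) (x y z w : B) :
    (onSlots 0 1 (rMatrix N q x y) * (onSlots 0 2 (rMatrix N q (x * w) z)
        * onSlots 1 2 (rMatrix N q (y * w) z)) : Matrix (Fin 3 → _) _ B) =
      onSlots 1 2 (rMatrix N q (y * w) z) * (onSlots 0 2 (rMatrix N q (x * w) z)
        * onSlots 0 1 (rMatrix N q x y)) := by
  -- An arbitrary right factor `Y` lets each `R` be peeled off as a left multiplication, which
  -- produces exactly the function `F` of `yangBaxter_apply`.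
  suffices h : ∀ Y : Matrix (Fin 3 → Fin N) (Fin 3 → Fin N) B,
      onSlots 0 1 (rMatrix N q x y) * (onSlots 0 2 (rMatrix N q (x * w) z)
        * (onSlots 1 2 (rMatrix N q (y * w) z) * Y)) =
      onSlots 1 2 (rMatrix N q (y * w) z) * (onSlots 0 2 (rMatrix N q (x * w) z)
        * (onSlots 0 1 (rMatrix N q x y) * Y)) by
    simpa only [mul_one] using h 1
  intro Y
  ext a b
  have ha : a = ![a 0, a 1, a 2] := by
    ext i; fin_cases i <;> rfl
  generalize a 0 = i, a 1 = j, a 2 = k at ha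
  subst ha
  simp only [onSlots_rMatrix_mul_apply (show (0 : Fin 3) ≠ 1 by decide),
    onSlots_rMatrix_mul_apply (show (0 : Fin 3) ≠ 2 by decide),
    onSlots_rMatrix_mul_apply (show (1 : Fin 3) ≠ 2 by decide), update_triple_zero_one,
    update_triple_zero_two, update_triple_one_two]
  simp only [Matrix.cons_val]
  have := yangBaxter_apply hq x y z w i j k fun i j k => Y ![i, j, k] b
  exact this

theorem yangBaxter_transpose_right {q : ℂ} (hq : q ≠ 0) (x y z w : B) :
    (onSlots 0 1 (rMatrix N q x y) * (onSlots 0 2 (partialTranspose (rMatrix N q (y * w) z))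
        * onSlots 1 2 (partialTranspose (rMatrix N q (x * w) z))) : Matrix (Fin 3 → _) _ B) =
      onSlots 1 2 (partialTranspose (rMatrix N q (x * w) z))
        * (onSlots 0 2 (partialTranspose (rMatrix N q (y * w) z))
        * onSlots 0 1 (rMatrix N q x y)) := by
  ext s t
  have hs : s = ![s 0, s 1, s 2] := by
    ext i; fin_cases i <;> rfl
  have ht : t = ![t 0, t 1, t 2] := by
    ext i; fin_cases i <;> rfl
  generalize s 0 = a, s 1 = b, s 2 = c at hs
  generalize t 0 = d, t 1 = e, t 2 = f at ht
  subst hs ht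
  rw [threeSlots_apply_01_02_12, threeSlots_apply_12_02_01]
  -- The first two slots are transposed and exchanged. This turns the factors with slot 2 into
  -- partial transposes, while `R` on slots 0, 1 returns to itself by `rMatrix_transpose`.
  have key := congrFun (congrFun (yangBaxter (N := N) hq x y z w) ![e, d, c]) ![b, a, f]
  rw [threeSlots_apply_01_02_12, threeSlots_apply_12_02_01] at key
  simp only [partialTranspose]
  calc _ = ∑ g, ∑ k, ∑ h, rMatrix N q (y * w) z (d, c) (g, k) *
        (rMatrix N q (x * w) z (e, k) (h, f) * rMatrix N q x y (h, g) (b, a)) := by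
        refine Finset.sum_congr rfl fun g _ => ?_
        rw [Finset.sum_comm]
        refine Finset.sum_congr rfl fun k _ => Finset.sum_congr rfl fun h _ => ?_
        rw [rMatrix_transpose q x y a b]
        ring
    _ = ∑ h, ∑ g, ∑ k, rMatrix N q x y (e, d) (h, g) *
        (rMatrix N q (x * w) z (h, c) (b, k) * rMatrix N q (y * w) z (g, k) (a, f)) := by
        exact key.symm
    _ = _ := by
        refine Finset.sum_congr rfl fun h _ => ?_
        rw [Finset.sum_comm]
        refine Finset.sum_congr rfl fun k _ => Finset.sum_congr rfl fun g _ => ?_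
        rw [rMatrix_transpose q x y e d]
        ring

theorem yangBaxter_transpose_left {q : ℂ} (hq : q ≠ 0) (x y z w : B) :
    (onSlots 1 2 (rMatrix N q (y * w) z) * (onSlots 0 1 (partialTranspose (rMatrix N q x y))
        * onSlots 0 2 (partialTranspose (rMatrix N q (x * w) z))) : Matrix (Fin 3 → _) _ B) =
      onSlots 0 2 (partialTranspose (rMatrix N q (x * w) z))
        * (onSlots 0 1 (partialTranspose (rMatrix N q x y))
        * onSlots 1 2 (rMatrix N q (y * w) z)) := by
  ext s t
  have hs : s = ![s 0, s 1, s 2] := by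
    ext i; fin_cases i <;> rfl
  have ht : t = ![t 0, t 1, t 2] := by
    ext i; fin_cases i <;> rfl
  generalize s 0 = a, s 1 = b, s 2 = c at hs
  generalize t 0 = d, t 1 = e, t 2 = f at ht
  subst hs ht
  rw [threeSlots_apply_12_01_02, threeSlots_apply_02_01_12]
  -- Only slot 0 is transposed. This reverses the order of the two factors acting on it and leaves
  -- the factor on slots 1, 2 unchanged.
  have key := congrFun (congrFun (yangBaxter (N := N) hq x y z w) ![d, b, c]) ![a, e, f]
  rw [threeSlots_apply_01_02_12, threeSlots_apply_12_02_01] at key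
  simp only [partialTranspose]
  calc _ = ∑ h, ∑ k, ∑ g, rMatrix N q (y * w) z (b, c) (h, k) *
        (rMatrix N q (x * w) z (d, k) (g, f) * rMatrix N q x y (g, h) (a, e)) := by
        refine Finset.sum_congr rfl fun h _ => Finset.sum_congr rfl fun k _ =>
          Finset.sum_congr rfl fun g _ => ?_
        ring
    _ = ∑ g, ∑ h, ∑ k, rMatrix N q x y (d, b) (g, h) *
        (rMatrix N q (x * w) z (g, c) (a, k) * rMatrix N q (y * w) z (h, k) (e, f)) := by
        exact key.symm
    _ = _ := by
        refine Finset.sum_congr rfl fun g _ => ?_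
        rw [Finset.sum_comm]
        refine Finset.sum_congr rfl fun k _ => Finset.sum_congr rfl fun h _ => ?_
        ring

end YangBaxter

end SklyaninJacobi

namespace SklyaninJacobi

/-! ### Crossing symmetry of the R-matrix -/

section Crossing

/-- Closed form of the partial sums behind crossing symmetry, with `p = q⁻¹` and `s = q`. For `k, l
< n` the boundary term is `(p - s) * (y * s - x * s * p ^ (2 * n))`, and it vanishes when `y = p ^
(2 * n) * x`. This is the origin of the shift by `q^{-2N}`. -/
theorem sum_range_crossing {B : Type*} [CommRing B] (p s x y : B) (h : p * s = 1) (k l n : ℕ) :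
    ∑ c ∈ Finset.range n, (if c = k then p * x - s else if k < c then (p - s) * x else p - s)
        * p ^ (2 * c) * (if l = c then s * y - p else if c < l then (s - p) * y else s - p) =
      (p - s) * (y * s - (if n ≤ k then 1 else x) * (if n ≤ l then y else 1) * (s * p ^ (2 * n)))
        + if k = l ∧ k < n then (x - 1) * (y - 1) * p ^ (2 * k) else 0 := by
  induction n with
  | zero => simp
  | succ n ih =>
    rw [Finset.sum_range_succ, ih]
    have e : p ^ (2 * (n + 1)) = p ^ (2 * n) * p ^ 2 := by ring
    rw [e]
    rcases lt_trichotomy n k with h1 | h1 | h1 <;> rcases lt_trichotomy n l with h2 | h2 | h2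
    all_goals
      try subst h1
      try subst h2
      generalize hP : p ^ (2 * _) = P
      simp (disch := omega) only [if_pos, if_neg]
      clear e ih
      grind

variable {N : ℕ} {B : Type*} [CommRing B] [Algebra ℂ B]

/-- `R^t` is diagonal on `e_k ⊗ e_b` with `k ≠ b`, where the two factors contribute `x - 1` and `y -
1`. It mixes only the vectors `e_c ⊗ e_c`, and there the product is the sum evaluated in
`sum_range_crossing`. The role of `C ⊗ C` is to supply the weights `q^{-2c}` in that sum. -/
theorem crossing_mul {q : ℂ} (hq : q ≠ 0) {r : ℂ} (hr : r ^ 2 = -q) (x y : B)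
    (hy : y = (q⁻¹ ^ (2 * N)) • x) :
    partialTranspose (rMatrix N q x 1) * Matrix.diagonal (fun a : Fin N × Fin N =>
        algebraMap ℂ B (cDiag N r a.1 a.1 * cDiag N r a.2 a.2)) *
      (partialTranspose (rMatrix N q⁻¹ y 1)).submatrix Prod.swap Prod.swap =
    ((x - 1) * (y - 1)) • Matrix.diagonal (fun a : Fin N × Fin N =>
        algebraMap ℂ B (cDiag N r a.1 a.1 * cDiag N r a.2 a.2)) := by
  have hr0 : r ≠ 0 := by
    rintro rfl
    apply hq
    simpa [eq_comm] using hr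
  have h : algebraMap ℂ B q⁻¹ * algebraMap ℂ B q = 1 := by
    rw [← map_mul, inv_mul_cancel₀ hq, map_one]
  ext ⟨k, b⟩ ⟨s, t⟩
  rw [Matrix.mul_apply, Fintype.sum_prod_type]
  simp only [Matrix.mul_diagonal, Matrix.smul_apply, Matrix.submatrix_apply, Prod.swap_prod_mk,
    partialTranspose, cDiag, Matrix.diagonal_apply_eq]
  simp only [rMatrix_eq]
  by_cases hkb : k = b
  · subst hkb
    have e1 : ∀ c : Fin N, ∑ l : Fin N,
        ((if c = k ∧ k = l then rDiag q x 1 c k else 0)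
          + (if c = l ∧ k = k then rOff q x 1 c k else 0))
        * algebraMap ℂ B (r ^ ((N : ℤ) - 1 - 2 * (c : ℤ)) * r ^ ((N : ℤ) - 1 - 2 * (l : ℤ)))
        * ((if t = l ∧ c = s then rDiag q⁻¹ y 1 t c else 0)
          + (if t = s ∧ c = l then rOff q⁻¹ y 1 t c else 0)) =
        if t = s then algebraMap ℂ B ((-q) ^ ((N : ℤ) - 1)) *
          ((if (c : ℕ) = k then algebraMap ℂ B q⁻¹ * x - algebraMap ℂ B q
            else if (k : ℕ) < c then (algebraMap ℂ B q⁻¹ - algebraMap ℂ B q) * x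
            else algebraMap ℂ B q⁻¹ - algebraMap ℂ B q)
          * algebraMap ℂ B q⁻¹ ^ (2 * (c : ℕ))
          * (if (s : ℕ) = c then algebraMap ℂ B q * y - algebraMap ℂ B q⁻¹
            else if (c : ℕ) < s then (algebraMap ℂ B q - algebraMap ℂ B q⁻¹) * y
            else algebraMap ℂ B q - algebraMap ℂ B q⁻¹)) else 0 := by
      intro c
      rw [Finset.sum_eq_single c]
      · have e2 : algebraMap ℂ B (r ^ ((N : ℤ) - 1 - 2 * (c : ℤ)) * r ^ ((N : ℤ) - 1 - 2 * (c : ℤ)))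
            = algebraMap ℂ B ((-q) ^ ((N : ℤ) - 1)) * algebraMap ℂ B q⁻¹ ^ (2 * (c : ℕ)) := by
          rw [← map_pow, ← map_mul, ← hr, ← mul_zpow, ← pow_two, zpow_sub₀ (pow_ne_zero 2 hr0)]
          rw [mul_comm 2 (c : ℤ), zpow_mul', zpow_natCast, div_eq_mul_inv]
          congr 2
          rw [hr, zpow_ofNat, neg_sq, inv_pow, pow_mul]
        have e3 : (if c = k ∧ k = c then rDiag q x 1 c k else 0)
            + (if c = c ∧ k = k then rOff q x 1 c k else 0) =
            (if (c : ℕ) = k then algebraMap ℂ B q⁻¹ * x - algebraMap ℂ B q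
            else if (k : ℕ) < c then (algebraMap ℂ B q⁻¹ - algebraMap ℂ B q) * x
            else algebraMap ℂ B q⁻¹ - algebraMap ℂ B q) := by
          rcases lt_trichotomy c k with h | h | h
          · simp [rOff, h, h.not_gt, h.ne, Fin.val_inj, Algebra.smul_def]
          · subst h
            simp [rDiag, rOff, Algebra.smul_def]
          · simp [rOff, h, h.ne', Fin.val_inj, Algebra.smul_def]
        have e4 : (if t = c ∧ c = s then rDiag q⁻¹ y 1 t c else 0)
            + (if t = s ∧ c = c then rOff q⁻¹ y 1 t c else 0) =
            if t = s then (if (s : ℕ) = c then algebraMap ℂ B q * y - algebraMap ℂ B q⁻¹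
            else if (c : ℕ) < s then (algebraMap ℂ B q - algebraMap ℂ B q⁻¹) * y
            else algebraMap ℂ B q - algebraMap ℂ B q⁻¹) else 0 := by
          by_cases hts : t = s
          · subst hts
            rcases lt_trichotomy c t with h | h | h
            · simp [rOff, h, h.ne', h.ne, Fin.val_inj, Algebra.smul_def]
            · subst h
              simp [rDiag, rOff, Algebra.smul_def]
            · simp [rOff, h, h.not_gt, h.ne', h.ne, Fin.val_inj, Algebra.smul_def]
          · rw [if_neg (by rintro ⟨rfl, rfl⟩; exact hts rfl)]
            simp [hts]
        rw [e2, e3, e4]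
        split_ifs <;> ring
      · intro l _ hl
        rw [if_neg (by rintro ⟨h1, h2⟩; exact hl (by rw [h1, h2])),
          if_neg (by rintro ⟨h1, h2⟩; exact hl h1.symm)]
        simp
      · simp
    rw [Finset.sum_congr rfl fun c _ => e1 c]
    by_cases hts : t = s
    · subst hts
      simp only [if_true]
      rw [← Finset.mul_sum, Fin.sum_univ_eq_sum_range (fun c : ℕ =>
        (if c = k then algebraMap ℂ B q⁻¹ * x - algebraMap ℂ B q
            else if (k : ℕ) < c then (algebraMap ℂ B q⁻¹ - algebraMap ℂ B q) * x
            else algebraMap ℂ B q⁻¹ - algebraMap ℂ B q)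
          * algebraMap ℂ B q⁻¹ ^ (2 * c)
          * (if (t : ℕ) = c then algebraMap ℂ B q * y - algebraMap ℂ B q⁻¹
            else if c < t then (algebraMap ℂ B q - algebraMap ℂ B q⁻¹) * y
            else algebraMap ℂ B q - algebraMap ℂ B q⁻¹)), sum_range_crossing _ _ _ _ h]
      rw [if_neg k.isLt.not_ge, if_neg t.isLt.not_ge]
      have e5 : x * 1 * (algebraMap ℂ B q * algebraMap ℂ B q⁻¹ ^ (2 * N)) =
          y * algebraMap ℂ B q := by
        rw [hy, Algebra.smul_def, map_pow]
        ring
      rw [e5, sub_self, mul_zero, zero_add]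
      by_cases hkt : k = t
      · subst hkt
        rw [if_pos ⟨rfl, k.isLt⟩, Matrix.diagonal_apply_eq]
        have e2 : algebraMap ℂ B (r ^ ((N : ℤ) - 1 - 2 * (k : ℤ)) * r ^ ((N : ℤ) - 1 - 2 * (k : ℤ)))
            = algebraMap ℂ B ((-q) ^ ((N : ℤ) - 1)) * algebraMap ℂ B q⁻¹ ^ (2 * (k : ℕ)) := by
          rw [← map_pow, ← map_mul, ← hr, ← mul_zpow, ← pow_two, zpow_sub₀ (pow_ne_zero 2 hr0)]
          rw [mul_comm 2 (k : ℤ), zpow_mul', zpow_natCast, div_eq_mul_inv]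
          congr 2
          rw [hr, zpow_ofNat, neg_sq, inv_pow, pow_mul]
        rw [e2, smul_eq_mul]
        ring
      · rw [if_neg (by rw [Fin.val_inj]; tauto), Matrix.diagonal_apply_ne _ (by simp [hkt])]
        simp
    · rw [Matrix.diagonal_apply_ne _ (by simp; rintro rfl h; exact hts h.symm)]
      simp [hts]
  · rw [Finset.sum_eq_single k, Finset.sum_eq_single b]
    · simp only [and_true, if_true]
      rw [if_neg (show ¬(k = b ∧ b = k) by tauto)]
      by_cases hst : t = b ∧ k = s
      · obtain ⟨rfl, rfl⟩ := hst
        simp [rDiag, hkb, Ne.symm hkb]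
        ring
      · rw [if_neg hst, if_neg (by tauto), Matrix.diagonal_apply_ne _ (by simp; tauto)]
        simp
    · intro l _ hl
      rw [if_neg (by tauto), if_neg (by tauto)]
      simp
    · simp
    · intro c _ hc
      refine Finset.sum_eq_zero fun l _ => ?_
      rw [if_neg (by tauto)]
      by_cases h1 : c = l ∧ b = k
      · exact absurd h1.2.symm hkb
      · rw [if_neg h1]
        simp
    · simp

end Crossing

end SklyaninJacobi

namespace SklyaninJacobi

/-! ### Homomorphisms between rings of series -/

section InVar

variable {A : Type*} [Ring A]

theorem coeff_inVar (k : Fin 2) (f : PowerSeries A) (d : Fin 2 →₀ ℕ) :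
    MvPowerSeries.coeff d (inVar k f) =
      if d = Finsupp.single k (d k) then PowerSeries.coeff (d k) f else 0 := rfl

theorem inVar_map {A' : Type*} [Ring A'] (φ : A →+* A') (k : Fin 2)
    (f : PowerSeries A) :
    inVar k (PowerSeries.map φ f) = MvPowerSeries.map φ (inVar k f) := by
  ext d
  rw [coeff_inVar, MvPowerSeries.coeff_map, coeff_inVar]
  split_ifs <;> simp

end InVar

section SeriesHom

variable {A : Type*} [Ring A] [Algebra ℂ A]

theorem commute_mvPowerSeries_map {σ : Type*} (k : MvPowerSeries σ ℂ)
    (f : MvPowerSeries σ A) : Commute (MvPowerSeries.map (algebraMap ℂ A) k) f := by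
  classical
  ext d
  rw [MvPowerSeries.coeff_mul, MvPowerSeries.coeff_mul]
  conv_lhs => rw [← Finset.HasAntidiagonal.map_swap_antidiagonal, Finset.sum_map]
  refine Finset.sum_congr rfl fun p _ => ?_
  simp [Algebra.commutes]

theorem commute_powerSeries_map (k : PowerSeries ℂ) (f : PowerSeries A) :
    Commute (PowerSeries.map (algebraMap ℂ A) k) f :=
  commute_mvPowerSeries_map k f

/-- The embedding of scalar series as an algebra homomorphism. -/
noncomputable def scalarHom (σ A : Type*) [Ring A] [Algebra ℂ A] :
    MvPowerSeries σ ℂ →ₐ[ℂ] MvPowerSeries σ A :=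
  { MvPowerSeries.map (algebraMap ℂ A) with
    commutes' := fun c => by
      classical
      ext d
      simp [MvPowerSeries.algebraMap_apply, MvPowerSeries.coeff_C] }

/-- The homomorphism `f(u) ↦ f(c⁻¹ u)`. -/
noncomputable def scaleHom (A : Type*) [Ring A] [Algebra ℂ A] (c : ℂ) :
    PowerSeries A →ₐ[ℂ] PowerSeries A :=
  AlgHom.ofLinearMap
    { toFun := fun f => PowerSeries.mk fun n => c ^ n • PowerSeries.coeff n f
      map_add' := fun f g => by ext n; simp
      map_smul' := fun a f => by
        ext n
        simp [smul_comm a] }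
    (by
      ext n
      simp only [LinearMap.coe_mk, AddHom.coe_mk, PowerSeries.coeff_mk, PowerSeries.coeff_one]
      split_ifs with h <;> simp [h])
    (fun f g => by
      ext n
      simp only [LinearMap.coe_mk, AddHom.coe_mk, PowerSeries.coeff_mk, PowerSeries.coeff_mul,
        Finset.smul_sum]
      refine Finset.sum_congr rfl fun p hp => ?_
      rw [← Finset.HasAntidiagonal.mem_antidiagonal.1 hp, pow_add, smul_mul_smul_comm])

theorem coeff_scaleHom (c : ℂ) (f : PowerSeries A) (n : ℕ) :
    PowerSeries.coeff n (scaleHom A c f) = c ^ n • PowerSeries.coeff n f := by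
  simp [scaleHom]

theorem dilate_eq (c : ℂ) : (dilate c : PowerSeries A → PowerSeries A) = scaleHom A c⁻¹ := by
  ext f n
  simp [coeff_scaleHom, dilate]

theorem scaleHom_scaleHom (c c' : ℂ) (f : PowerSeries A) :
    scaleHom A c (scaleHom A c' f) = scaleHom A (c * c') f := by
  ext n
  simp [coeff_scaleHom, mul_pow, mul_smul]

theorem scaleHom_X (c : ℂ) : scaleHom A c PowerSeries.X = c • PowerSeries.X := by
  ext n
  rw [coeff_scaleHom, PowerSeries.coeff_smul, PowerSeries.coeff_X]
  split_ifs with h <;> simp [h]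

theorem scaleHom_map (c : ℂ) (f : PowerSeries ℂ) :
    scaleHom A c (PowerSeries.map (algebraMap ℂ A) f) =
      PowerSeries.map (algebraMap ℂ A) (scaleHom ℂ c f) := by
  ext n
  simp [coeff_scaleHom, Algebra.smul_def]

/-- `inVar` as a homomorphism. -/
noncomputable def inVarHom (A : Type*) [Ring A] [Algebra ℂ A] (k : Fin 2) :
    PowerSeries A →ₐ[ℂ] MvPowerSeries (Fin 2) A :=
  AlgHom.ofLinearMap
    { toFun := inVar k
      map_add' := fun f g => by
        ext d
        change inVar k (f + g) d = inVar k f d + inVar k g d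
        simp only [inVar]
        split_ifs <;> simp
      map_smul' := fun a f => by
        ext d
        change inVar k (a • f) d = a • inVar k f d
        simp only [inVar]
        split_ifs <;> simp }
    (by
      ext d
      change inVar k 1 d = _
      rw [inVar, MvPowerSeries.coeff_one, PowerSeries.coeff_one]
      by_cases hd : d = 0
      · simp [hd]
      · rw [if_neg hd]
        split_ifs with h1 h2
        · rw [h2, Finsupp.single_zero] at h1
          exact absurd h1 hd
        · rfl
        · rfl)
    (fun f g => by
      ext d
      rw [MvPowerSeries.coeff_mul]
      change inVar k (f * g) d = ∑ p ∈ Finset.HasAntidiagonal.antidiagonal d, inVar k f p.1 * inVar k g p.2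
      simp only [inVar]
      split_ifs with h
      · rw [h, Finsupp.antidiagonal_single, Finset.sum_map, PowerSeries.coeff_mul]
        simp
      · symm
        refine Finset.sum_eq_zero fun p hp => ?_
        split_ifs with h1 h2
        · exfalso
          apply h
          rw [← Finset.HasAntidiagonal.mem_antidiagonal.1 hp]
          conv_lhs => rw [h1, h2]
          simp
        all_goals simp)

theorem coe_inVarHom (k : Fin 2) : (inVarHom A k : PowerSeries A → _) = inVar k := rfl

/-- The exponents `(d_0, d_1)` exchanged. -/
def swapExp : (Fin 2 →₀ ℕ) ≃+ (Fin 2 →₀ ℕ) := Finsupp.domCongr (Equiv.swap 0 1)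

theorem swapExp_apply (d : Fin 2 →₀ ℕ) (i : Fin 2) : swapExp d i = d (Equiv.swap 0 1 i) := by
  simp [swapExp, Finsupp.domCongr_apply]

theorem swapExp_single (i : Fin 2) (n : ℕ) :
    swapExp (Finsupp.single i n) = Finsupp.single (Equiv.swap 0 1 i) n := by
  simp [swapExp, Finsupp.domCongr_apply]

theorem swapExp_swapExp (d : Fin 2 →₀ ℕ) : swapExp (swapExp d) = d := by
  ext i
  simp [swapExp_apply]

/-- The homomorphism `f(u, v) ↦ f(c⁻¹ v, c⁻¹ u)`. -/
noncomputable def swapScaleHom (A : Type*) [Ring A] [Algebra ℂ A] (c : ℂ) :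
    MvPowerSeries (Fin 2) A →ₐ[ℂ] MvPowerSeries (Fin 2) A :=
  AlgHom.ofLinearMap
    { toFun := fun f d => c ^ (d 0 + d 1) • MvPowerSeries.coeff (swapExp d) f
      map_add' := fun f g => by
        funext d
        exact (congrArg _ (map_add _ _ _)).trans (smul_add _ _ _)
      map_smul' := fun a f => by
        funext d
        exact smul_comm (c ^ (d 0 + d 1)) a (MvPowerSeries.coeff (swapExp d) f) }
    (by
      ext d
      change c ^ (d 0 + d 1) • MvPowerSeries.coeff (swapExp d) (1 : MvPowerSeries (Fin 2) A) = _
      rw [MvPowerSeries.coeff_one, MvPowerSeries.coeff_one]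
      by_cases h : d = 0
      · simp [h]
      · rw [if_neg h, if_neg (by simpa using h), smul_zero])
    (fun f g => by
      ext d
      rw [MvPowerSeries.coeff_mul]
      change c ^ (d 0 + d 1) • MvPowerSeries.coeff (swapExp d) (f * g) =
        ∑ p ∈ Finset.HasAntidiagonal.antidiagonal d, (c ^ (p.1 0 + p.1 1) • MvPowerSeries.coeff (swapExp p.1) f)
          * (c ^ (p.2 0 + p.2 1) • MvPowerSeries.coeff (swapExp p.2) g)
      rw [MvPowerSeries.coeff_mul, Finset.smul_sum]
      refine (Finset.sum_nbij' (fun p => (swapExp p.1, swapExp p.2))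
        (fun p => (swapExp p.1, swapExp p.2)) ?_ ?_ ?_ ?_ ?_).symm
      · rintro p hp
        rw [Finset.HasAntidiagonal.mem_antidiagonal] at hp ⊢
        rw [← hp, map_add]
      · rintro p hp
        rw [Finset.HasAntidiagonal.mem_antidiagonal] at hp ⊢
        rw [← map_add, hp, swapExp_swapExp]
      · intro p _
        simp [swapExp_swapExp]
      · intro p _
        simp [swapExp_swapExp]
      · intro p hp
        rw [smul_mul_smul_comm, ← pow_add, ← Finset.HasAntidiagonal.mem_antidiagonal.1 hp, Finsupp.add_apply,
          Finsupp.add_apply]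
        congr 2
        ring)

theorem coeff_swapScaleHom (c : ℂ) (f : MvPowerSeries (Fin 2) A) (d : Fin 2 →₀ ℕ) :
    MvPowerSeries.coeff d (swapScaleHom A c f) =
      c ^ (d 0 + d 1) • MvPowerSeries.coeff (swapExp d) f := rfl

theorem swapScaleHom_inVar (c : ℂ) (k : Fin 2) (f : PowerSeries A) :
    swapScaleHom A c (inVar k f) = inVar (Equiv.swap 0 1 k) (scaleHom A c f) := by
  ext d
  rw [coeff_swapScaleHom, coeff_inVar, coeff_inVar, coeff_scaleHom, swapExp_apply]
  have h : swapExp d = Finsupp.single k (d (Equiv.swap 0 1 k)) ↔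
      d = Finsupp.single (Equiv.swap 0 1 k) (d (Equiv.swap 0 1 k)) := by
    rw [← swapExp_single, ← swapExp.injective.eq_iff, swapExp_swapExp]
  by_cases hd : d = Finsupp.single (Equiv.swap 0 1 k) (d (Equiv.swap 0 1 k))
  · rw [if_pos (h.2 hd), if_pos hd]
    congr 2
    rw [hd]
    revert k
    simp [Fin.forall_fin_two]
  · rw [if_neg (mt h.1 hd), if_neg hd, smul_zero]

theorem swapScaleHom_map (c : ℂ) (f : MvPowerSeries (Fin 2) ℂ) :
    swapScaleHom A c (MvPowerSeries.map (algebraMap ℂ A) f) =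
      MvPowerSeries.map (algebraMap ℂ A) (swapScaleHom ℂ c f) := by
  ext d
  simp [coeff_swapScaleHom, Algebra.smul_def]

theorem swapScaleHom_X (c : ℂ) (k : Fin 2) :
    swapScaleHom A c (MvPowerSeries.X k) = c • MvPowerSeries.X (Equiv.swap 0 1 k) := by
  ext d
  change _ = c • MvPowerSeries.coeff d (MvPowerSeries.X (Equiv.swap 0 1 k) : MvPowerSeries (Fin 2) A)
  rw [coeff_swapScaleHom, MvPowerSeries.coeff_X, MvPowerSeries.coeff_X]
  have h : swapExp d = Finsupp.single k 1 ↔ d = Finsupp.single (Equiv.swap 0 1 k) 1 := by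
    rw [← swapExp_single]
    exact ⟨fun h => by rw [← h, swapExp_swapExp], fun h => by rw [h, swapExp_swapExp]⟩
  by_cases hd : d = Finsupp.single (Equiv.swap 0 1 k) 1
  · rw [if_pos (h.2 hd), if_pos hd, hd]
    fin_cases k <;> simp
  · rw [if_neg (mt h.1 hd), if_neg hd, smul_zero, smul_zero]

/-- The homomorphism `f(u, v) ↦ f(u / c_0, u / c_1)`. -/
noncomputable def evalVars (A : Type*) [Ring A] [Algebra ℂ A] (c : Fin 2 → ℂ) :
    MvPowerSeries (Fin 2) A →ₐ[ℂ] PowerSeries A :=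
  AlgHom.ofLinearMap
    -- Substituting multiples of one variable is legitimate for arbitrary series, because only
    -- finitely many exponents have total degree `n`.
    { toFun := fun f => PowerSeries.mk fun n =>
        ∑ d ∈ Finset.finsuppAntidiag Finset.univ n, (∏ i, c i ^ d i) • MvPowerSeries.coeff d f
      map_add' := fun f g => by ext n; simp [Finset.sum_add_distrib]
      map_smul' := fun a f => by
        ext n
        simp [Finset.smul_sum, smul_comm a] }
    (by
      ext n
      simp only [LinearMap.coe_mk, AddHom.coe_mk, PowerSeries.coeff_mk, PowerSeries.coeff_one,
        MvPowerSeries.coeff_one]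
      split_ifs with h
      · subst h
        simp
      · refine Finset.sum_eq_zero fun d hd => ?_
        rw [if_neg, smul_zero]
        rintro rfl
        rw [Finset.mem_finsuppAntidiag] at hd
        exact h (by simpa using hd.1.symm))
    (fun f g => by
      ext n
      simp only [LinearMap.coe_mk, AddHom.coe_mk, PowerSeries.coeff_mk, PowerSeries.coeff_mul,
        MvPowerSeries.coeff_mul, Finset.smul_sum, Finset.sum_mul_sum]
      simp_rw [← Finset.sum_product']
      rw [Finset.sum_sigma', Finset.sum_sigma']
      refine Finset.sum_nbij' (fun p => ⟨(∑ i, p.2.1 i, ∑ i, p.2.2 i), p.2⟩)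
        (fun p => ⟨p.2.1 + p.2.2, p.2⟩) ?_ ?_ ?_ ?_ ?_
      · rintro ⟨d, e⟩ h
        simp only [Finset.mem_sigma, Finset.mem_finsuppAntidiag, Finset.HasAntidiagonal.mem_antidiagonal,
          Finset.mem_product, Finset.subset_univ, and_true] at h ⊢
        rw [← h.1, ← h.2, ← Finset.sum_add_distrib]
        simp
      · rintro ⟨st, e⟩ h
        simp only [Finset.mem_sigma, Finset.mem_finsuppAntidiag, Finset.HasAntidiagonal.mem_antidiagonal,
          Finset.mem_product, Finset.subset_univ, and_true] at h ⊢
        rw [← h.1, ← h.2.1, ← h.2.2, ← Finset.sum_add_distrib]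
        simp
      · rintro ⟨d, e⟩ h
        simp only [Finset.mem_sigma, Finset.HasAntidiagonal.mem_antidiagonal] at h
        rw [h.2]
      · rintro ⟨⟨s, t⟩, e⟩ h
        simp only [Finset.mem_sigma, Finset.mem_finsuppAntidiag, Finset.mem_product] at h
        rw [h.2.1.1, h.2.2.1]
      · rintro ⟨d, e⟩ h
        simp only [Finset.mem_sigma, Finset.HasAntidiagonal.mem_antidiagonal] at h
        rw [smul_mul_smul_comm, ← h.2, ← Finset.prod_mul_distrib]
        simp [pow_add])

theorem coeff_evalVars (c : Fin 2 → ℂ) (f : MvPowerSeries (Fin 2) A) (n : ℕ) :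
    PowerSeries.coeff n (evalVars A c f) =
      ∑ d ∈ Finset.finsuppAntidiag Finset.univ n, (∏ i, c i ^ d i) • MvPowerSeries.coeff d f := by
  simp [evalVars]

theorem evalVars_map (c : Fin 2 → ℂ) (f : MvPowerSeries (Fin 2) ℂ) :
    evalVars A c (MvPowerSeries.map (algebraMap ℂ A) f) =
      PowerSeries.map (algebraMap ℂ A) (evalVars ℂ c f) := by
  ext n
  simp [coeff_evalVars, Algebra.smul_def]

theorem evalVars_inVar (c : Fin 2 → ℂ) (k : Fin 2) (f : PowerSeries A) :
    evalVars A c (inVar k f) = scaleHom A (c k) f := by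
  ext n
  rw [coeff_evalVars, coeff_scaleHom, Finset.sum_eq_single (Finsupp.single k n)]
  · rw [coeff_inVar, if_pos (by simp), Finset.prod_eq_single k]
    · simp
    · intro i _ hi
      simp [Finsupp.single_eq_of_ne hi]
    · simp
  · intro d hd hdk
    rw [coeff_inVar, if_neg, smul_zero]
    intro h
    rw [Finset.mem_finsuppAntidiag] at hd
    apply hdk
    rw [h, ← hd.1]
    conv_rhs => rw [h]
    congr 1
    rw [Finset.sum_eq_single k]
    · simp
    · intro i _ hi
      simp [Finsupp.single_eq_of_ne hi]
    · simp
  · simp [Finset.mem_finsuppAntidiag, Finsupp.single_apply]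

theorem evalVars_X (c : Fin 2 → ℂ) (k : Fin 2) :
    evalVars A c (MvPowerSeries.X k) = c k • PowerSeries.X := by
  have h : (MvPowerSeries.X k : MvPowerSeries (Fin 2) A) = inVar k PowerSeries.X := by
    ext d
    rw [coeff_inVar, MvPowerSeries.coeff_X, PowerSeries.coeff_X]
    by_cases hd : d = Finsupp.single k 1
    · simp [hd]
    · rw [if_neg hd]
      split_ifs with h1 h2
      · rw [h2] at h1
        exact absurd h1 hd
      all_goals rfl
  rw [h, evalVars_inVar, scaleHom_X]

theorem map_smul_algebraMap (c : ℂ) (f : PowerSeries ℂ) :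
    PowerSeries.map (algebraMap ℂ A) (c • f) = c • PowerSeries.map (algebraMap ℂ A) f :=
  map_smul (scalarHom Unit A) c f

end SeriesHom

end SklyaninJacobi

namespace SklyaninJacobi

/-! ### Properties of the q-antisymmetrizer -/

section Inversions

variable {N m k : ℕ}

theorem inversions_eq_sum (a : Fin m → Fin N) :
    inversions a = ∑ i, ∑ j, if i < j ∧ a j < a i then 1 else 0 := by
  rw [inversions, Finset.card_filter, Fintype.sum_prod_type]

/-- The number of pairs of an entry of `f` and a smaller entry of `g`. -/
def crossInversions (f : Fin m → Fin N) (g : Fin k → Fin N) : ℕ :=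
  ∑ i, ∑ j, if g j < f i then 1 else 0

/-- Cross inversions depend only on the multisets of entries, so they cancel in the exponents of `q`
when permutations act inside the two blocks. -/
theorem crossInversions_comp (f : Fin m → Fin N) (g : Fin k → Fin N) (σ : Equiv.Perm (Fin m))
    (τ : Equiv.Perm (Fin k)) : crossInversions (f ∘ σ) (g ∘ τ) = crossInversions f g := by
  simp only [crossInversions, Function.comp_apply]
  rw [Equiv.sum_comp σ fun i => ∑ j, if g (τ j) < f i then 1 else 0]
  exact Finset.sum_congr rfl fun i _ => Equiv.sum_comp τ fun j => if g j < f i then 1 else 0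

theorem inversions_append (f : Fin m → Fin N) (g : Fin k → Fin N) :
    inversions (Fin.append f g) = inversions f + inversions g + crossInversions f g := by
  simp only [inversions_eq_sum, Fin.sum_univ_add, Fin.append_left, Fin.append_right,
    crossInversions, Finset.sum_add_distrib]
  have h1 : ∀ (i : Fin m) (j : Fin k), Fin.castAdd k i < Fin.natAdd m j := fun i j => by
    rw [Fin.lt_def, Fin.val_castAdd, Fin.val_natAdd]
    omega
  have h2 : ∀ (i : Fin m) (j : Fin k), ¬ Fin.natAdd m j < Fin.castAdd k i := fun i j =>
    (h1 i j).not_gt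
  have h3 : ∀ i j : Fin m, Fin.castAdd k i < Fin.castAdd k j ↔ i < j := fun i j => Iff.rfl
  have h4 : ∀ i j : Fin k, Fin.natAdd m i < Fin.natAdd m j ↔ i < j := fun i j => by
    rw [Fin.lt_def, Fin.val_natAdd, Fin.val_natAdd, Fin.lt_def]
    omega
  simp only [h1, h2, h3, h4, true_and, false_and, if_false, Finset.sum_const_zero]
  ring

/-- A pair of positions with distinct values is an inversion of exactly one of a sequence and its
reversal. The sum counts all such pairs, which is invariant under permutation. Reversal thus negates
differences of inversion numbers and exchanges `q` with `q⁻¹`. -/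
theorem inversions_add_inversions_rev (a : Fin m → Fin N) (σ : Equiv.Perm (Fin m)) :
    inversions (a ∘ σ) + inversions ((a ∘ σ) ∘ Fin.rev) =
      inversions a + inversions (a ∘ Fin.rev) := by
  have key : ∀ b : Fin m → Fin N, inversions b + inversions (b ∘ Fin.rev) =
      ∑ i, ∑ j, if b j < b i then 1 else 0 := by
    intro b
    have h : inversions (b ∘ Fin.rev) = ∑ i, ∑ j, if j < i ∧ b j < b i then 1 else 0 := by
      rw [inversions_eq_sum]
      rw [← Equiv.sum_comp Fin.revPerm]
      refine Finset.sum_congr rfl fun i _ => ?_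
      rw [← Equiv.sum_comp Fin.revPerm]
      refine Finset.sum_congr rfl fun j _ => ?_
      simp
    rw [h, inversions_eq_sum, ← Finset.sum_add_distrib]
    refine Finset.sum_congr rfl fun i _ => ?_
    rw [← Finset.sum_add_distrib]
    refine Finset.sum_congr rfl fun j _ => ?_
    rcases lt_trichotomy i j with h | h | h
    · simp [h, h.not_gt]
    · simp [h]
    · simp [h, h.not_gt]
  rw [key, key]
  exact (crossInversions_comp a a σ σ)

end Inversions

section AntisymmetrizerLemmas

variable {N m k : ℕ} {q : ℂ}

theorem antisymmetrizer_mul_qPerm (hq : q ≠ 0) (τ : Equiv.Perm (Fin m)) :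
    antisymmetrizer N m q * qPerm N q τ =
      ((Equiv.Perm.sign τ : ℤ) : ℂ) • antisymmetrizer N m q := by
  rw [antisymmetrizer, Matrix.smul_mul, smul_comm, Finset.sum_mul]
  congr 1
  rw [Finset.smul_sum]
  rw [← Equiv.sum_comp (Equiv.mulRight τ)
    fun σ => ((Equiv.Perm.sign τ : ℤ) : ℂ) • ((Equiv.Perm.sign σ : ℤ) : ℂ) • qPerm N q σ]
  refine Finset.sum_congr rfl fun σ _ => ?_
  rw [Matrix.smul_mul, ← qPerm_mul hq, Equiv.coe_mulRight, smul_smul]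
  congr 1
  rw [Equiv.Perm.sign_mul, ← Int.cast_mul, ← Units.val_mul]
  rcases Int.units_eq_one_or (Equiv.Perm.sign τ) with h | h <;>
    simp [h]

theorem factorial_mul_antisymmetrizer_apply (a b : Fin m → Fin N) :
    (m.factorial : ℂ) * antisymmetrizer N m q b a = ∑ σ : Equiv.Perm (Fin m),
      ((Equiv.Perm.sign σ : ℤ) : ℂ) *
        if b = a ∘ σ.symm then q ^ ((inversions b : ℤ) - inversions a) else 0 := by
  have h : (m.factorial : ℂ) ≠ 0 := by exact_mod_cast m.factorial_ne_zero
  simp only [antisymmetrizer, Matrix.smul_apply, Matrix.sum_apply, smul_eq_mul]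
  rw [← mul_assoc, mul_one_div_cancel h, one_mul]
  rfl

theorem antisymmetrizer_apply_comp (hq : q ≠ 0) (a b : Fin m → Fin N) (τ : Equiv.Perm (Fin m)) :
    antisymmetrizer N m q b (a ∘ τ.symm) * q ^ ((inversions (a ∘ τ.symm) : ℤ) - inversions a) =
      ((Equiv.Perm.sign τ : ℤ) : ℂ) * antisymmetrizer N m q b a := by
  have h := congrFun (congrFun (antisymmetrizer_mul_qPerm (N := N) hq τ) b) a
  rw [Matrix.mul_apply, Finset.sum_eq_single (a ∘ τ.symm)] at h
  · rw [Matrix.smul_apply, smul_eq_mul] at h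
    rw [← h, qPerm, if_pos rfl]
  · intro c _ hc
    rw [qPerm, if_neg hc, mul_zero]
  · simp

/-- A sequence with a repeated entry is fixed by a transposition, so the matrix entry equals its own
negative. -/
theorem antisymmetrizer_apply_of_not_injective (hq : q ≠ 0) {a : Fin m → Fin N}
    (ha : ¬ Function.Injective a) (b : Fin m → Fin N) : antisymmetrizer N m q b a = 0 := by
  simp only [Function.Injective, not_forall] at ha
  obtain ⟨i, j, hij, hne⟩ := ha
  have h := antisymmetrizer_apply_comp hq a b (Equiv.swap i j)
  have e : a ∘ (Equiv.swap i j).symm = a := by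
    ext l
    rw [Equiv.symm_swap, Function.comp_apply, Equiv.swap_apply_def]
    split_ifs with h1 h2 <;> simp_all
  rw [e, sub_self, zpow_zero, mul_one, Equiv.Perm.sign_swap hne] at h
  simp only [Units.val_neg, Units.val_one, Int.cast_neg, Int.cast_one, neg_mul, one_mul] at h
  exact self_eq_neg.1 h

theorem factorial_mul_antisymmetrizer_self {a : Fin m → Fin N} (ha : Function.Injective a) :
    (m.factorial : ℂ) * antisymmetrizer N m q a a = 1 := by
  rw [factorial_mul_antisymmetrizer_apply, Finset.sum_eq_single 1]
  · simp [Equiv.Perm.one_def]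
  · intro σ _ hσ
    rw [if_neg, mul_zero]
    intro h
    apply hσ
    ext i
    have := ha (congrFun h (σ i))
    simp only [Equiv.symm_apply_apply] at this
    rw [this, Equiv.Perm.one_apply]
  · simp

theorem exists_perm_of_antisymmetrizer_ne_zero {a b : Fin m → Fin N}
    (h : antisymmetrizer N m q b a ≠ 0) : ∃ σ : Equiv.Perm (Fin m), b = a ∘ σ := by
  by_contra! hc
  apply h
  have := factorial_mul_antisymmetrizer_apply (q := q) a b
  rw [Finset.sum_eq_zero, mul_eq_zero] at this
  · exact this.resolve_left (by exact_mod_cast m.factorial_ne_zero)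
  · intro σ _
    rw [if_neg (hc σ.symm), mul_zero]

/-- An injective sequence of length `N` is a permutation of `id`. Every nonzero column is therefore
a scalar multiple of the column at `id`, the scalar being read off in the row `id`. -/
theorem antisymmetrizer_rank_one (hq : q ≠ 0) (a b : Fin N → Fin N) :
    antisymmetrizer N N q b a =
      (N.factorial : ℂ) * antisymmetrizer N N q b id * antisymmetrizer N N q id a := by
  by_cases ha : Function.Injective a
  · let α : Equiv.Perm (Fin N) := Equiv.ofBijective a (Finite.injective_iff_bijective.1 ha)
    have e : (id : Fin N → Fin N) ∘ (α⁻¹ : Equiv.Perm (Fin N)).symm = a := by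
      ext i; rfl
    have h1 := antisymmetrizer_apply_comp hq id b α⁻¹
    have h2 := antisymmetrizer_apply_comp hq id id α⁻¹
    rw [e] at h1 h2
    have h3 := factorial_mul_antisymmetrizer_self (q := q) (Function.injective_id (α := Fin N))
    have h4 : q ^ ((inversions a : ℤ) - inversions (id : Fin N → Fin N)) ≠ 0 := zpow_ne_zero _ hq
    apply mul_right_cancel₀ h4
    linear_combination h1 - (N.factorial : ℂ) * antisymmetrizer N N q b id * h2
      - ((Equiv.Perm.sign α⁻¹ : ℤ) : ℂ) * antisymmetrizer N N q b id * h3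
  · rw [antisymmetrizer_apply_of_not_injective hq ha,
      antisymmetrizer_apply_of_not_injective hq ha, mul_zero]

/-- The permutation of `Fin (m + k)` acting by `σ` on the first `m` and by `τ` on the last `k`
elements. -/
def blockPerm (σ : Equiv.Perm (Fin m)) (τ : Equiv.Perm (Fin k)) : Equiv.Perm (Fin (m + k)) :=
  finSumFinEquiv.permCongr (Equiv.Perm.sumCongr σ τ)

theorem append_comp_blockPerm {α : Type*} (f : Fin m → α) (g : Fin k → α)
    (σ : Equiv.Perm (Fin m)) (τ : Equiv.Perm (Fin k)) :
    Fin.append f g ∘ blockPerm σ τ = Fin.append (f ∘ σ) (g ∘ τ) := by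
  ext i
  refine Fin.addCases (fun i => ?_) (fun i => ?_) i <;> simp [blockPerm, Equiv.permCongr_apply]

theorem blockPerm_symm (σ : Equiv.Perm (Fin m)) (τ : Equiv.Perm (Fin k)) :
    (blockPerm σ τ).symm = blockPerm σ.symm τ.symm := by
  ext i
  refine Fin.addCases (fun i => ?_) (fun i => ?_) i <;> simp [blockPerm, Equiv.permCongr_def]

theorem sign_blockPerm (σ : Equiv.Perm (Fin m)) (τ : Equiv.Perm (Fin k)) :
    Equiv.Perm.sign (blockPerm σ τ) = Equiv.Perm.sign σ * Equiv.Perm.sign τ := by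
  rw [blockPerm, Equiv.Perm.sign_permCongr, Equiv.Perm.sign_sumCongr]

theorem exists_blockPerm {σ : Equiv.Perm (Fin (m + k))}
    (h : ∀ i : Fin m, ∃ j : Fin m, σ (Fin.castAdd k i) = Fin.castAdd k j) :
    ∃ α β, σ = blockPerm α β := by
  have := Equiv.Perm.mem_sumCongrHom_range_of_perm_mapsTo_inl
    (σ := finSumFinEquiv.symm.permCongr σ) (by
      rintro _ ⟨i, rfl⟩
      obtain ⟨j, hj⟩ := h i
      exact ⟨j, by simp [Equiv.permCongr_apply, hj]⟩)
  obtain ⟨⟨α, β⟩, hαβ⟩ := this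
  refine ⟨α, β, ?_⟩
  have e : Equiv.Perm.sumCongr α β = finSumFinEquiv.symm.permCongr σ := hαβ
  rw [blockPerm, e]
  ext i
  simp [Equiv.permCongr_def]

/-- If one half of the column sequence agrees with the row sequence, injectivity forces every
contributing permutation to preserve the two blocks. Signs multiply, and the cross inversions on
both sides coincide, so the power of `q` factors as well. -/
theorem antisymmetrizer_append (hq : q ≠ 0) {f J : Fin m → Fin N} {g K : Fin k → Fin N}
    (hfg : Function.Injective (Fin.append f g)) (hJK : J = f ∨ K = g) :
    ((m + k).factorial : ℂ) * antisymmetrizer N (m + k) q (Fin.append f g) (Fin.append J K) =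
      ((m.factorial : ℂ) * antisymmetrizer N m q f J)
        * ((k.factorial : ℂ) * antisymmetrizer N k q g K) := by
  rw [factorial_mul_antisymmetrizer_apply, factorial_mul_antisymmetrizer_apply,
    factorial_mul_antisymmetrizer_apply, Finset.sum_mul_sum]
  rw [← Fintype.sum_prod_type']
  symm
  refine Finset.sum_of_injOn (fun p => blockPerm p.1 p.2) ?_ (fun _ _ => by simp) ?_ ?_
  · rintro ⟨α, β⟩ - ⟨α', β'⟩ - h
    have h1 := congrArg (fun σ : Equiv.Perm (Fin (m + k)) =>
      (Fin.append Sum.inl Sum.inr : _ → Fin m ⊕ Fin k) ∘ σ) h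
    simp only [append_comp_blockPerm] at h1
    ext i
    · have := congrFun h1 (Fin.castAdd k i)
      simp at this
      simp [this]
    · have := congrFun h1 (Fin.natAdd m i)
      simp at this
      simp [this]
  · intro σ _ hσ
    rw [if_neg, mul_zero]
    intro h
    apply hσ
    have h' : ∀ i, Fin.append f g (σ i) = Fin.append J K i := fun i => by
      rw [h]; simp
    have : ∃ α β, σ = blockPerm α β := by
      rcases hJK with rfl | rfl
      · refine exists_blockPerm fun i => ⟨i, hfg ?_⟩
        rw [h']
        simp
      · refine exists_blockPerm fun i => ?_
        -- Here the last `k` positions are fixed pointwise, hence the first `m` are mapped among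
        -- themselves.
        have hfix : ∀ j : Fin k, σ (Fin.natAdd m j) = Fin.natAdd m j := fun j => hfg (by
          rw [h']
          simp)
        induction hx : σ (Fin.castAdd k i) using Fin.addCases with
        | left j => exact ⟨j, rfl⟩
        | right j =>
          exfalso
          rw [← hfix j] at hx
          have := congrArg Fin.val (σ.injective hx)
          simp at this
          omega
    obtain ⟨α, β, rfl⟩ := this
    exact ⟨(α, β), by simp, rfl⟩
  · rintro ⟨α, β⟩ -
    simp only
    rw [sign_blockPerm, blockPerm_symm, append_comp_blockPerm]
    have hiff : Fin.append f g = Fin.append (J ∘ α.symm) (K ∘ β.symm) ↔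
        f = J ∘ α.symm ∧ g = K ∘ β.symm := by
      constructor
      · intro h
        constructor
        · ext i
          simpa using congrArg Fin.val (congrFun h (Fin.castAdd k i))
        · ext i
          simpa using congrArg Fin.val (congrFun h (Fin.natAdd m i))
      · rintro ⟨h1, h2⟩
        rw [← h1, ← h2]
    by_cases h : f = J ∘ α.symm ∧ g = K ∘ β.symm
    · rw [if_pos (hiff.2 h), if_pos h.1, if_pos h.2, inversions_append, inversions_append]
      have hc : crossInversions f g = crossInversions J K := by
        rw [h.1, h.2, crossInversions_comp]
      rw [hc]
      have hz : ((inversions f + inversions g + crossInversions J K : ℕ) : ℤ)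
          - ((inversions J + inversions K + crossInversions J K : ℕ) : ℤ) =
          ((inversions f : ℤ) - inversions J) + ((inversions g : ℤ) - inversions K) := by
        push_cast
        ring
      rw [hz, zpow_add₀ hq]
      push_cast
      ring
    · rw [if_neg (mt hiff.1 h), mul_zero]
      by_cases h1 : f = J ∘ α.symm
      · rw [if_neg fun h2 => h ⟨h1, h2⟩, mul_zero, mul_zero]
      · rw [if_neg h1, mul_zero, zero_mul]

theorem antisymmetrizer_inv_rev (a b : Fin m → Fin N) :
    antisymmetrizer N m q⁻¹ (b ∘ Fin.rev) (a ∘ Fin.rev) = antisymmetrizer N m q b a := by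
  have h : (m.factorial : ℂ) ≠ 0 := by exact_mod_cast m.factorial_ne_zero
  apply mul_left_cancel₀ h
  rw [factorial_mul_antisymmetrizer_apply, factorial_mul_antisymmetrizer_apply]
  -- Conjugation by the reversal matches the two sums: it preserves signs, and
  -- `inversions_add_inversions_rev` negates the exponent of `q`.
  rw [← Equiv.sum_comp (MulAut.conj (Fin.revPerm : Equiv.Perm (Fin m))).toEquiv]
  refine Finset.sum_congr rfl fun σ _ => ?_
  have e : (MulAut.conj (Fin.revPerm : Equiv.Perm (Fin m))).toEquiv σ
      = Fin.revPerm * σ * Fin.revPerm⁻¹ := rfl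
  have hrev : ∀ i : Fin m, ((Fin.revPerm⁻¹ : Equiv.Perm (Fin m)).symm i).rev = i := fun i =>
    Fin.rev_rev i
  rw [e, Equiv.Perm.sign_mul, Equiv.Perm.sign_mul, Equiv.Perm.sign_inv, mul_comm, mul_comm
    (Equiv.Perm.sign Fin.revPerm), mul_assoc (Equiv.Perm.sign σ), Int.units_mul_self, mul_one,
    mul_comm]
  congr 1
  have hiff : b ∘ Fin.rev = (a ∘ Fin.rev) ∘ (Fin.revPerm * σ * Fin.revPerm⁻¹).symm ↔
      b = a ∘ σ.symm := by
    constructor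
    · intro h
      ext i
      have := congrFun h (Fin.rev i)
      simp [Equiv.Perm.mul_def] at this
      rw [this, hrev]
      rfl
    · rintro rfl
      ext i
      simp [Equiv.Perm.mul_def, hrev]
  by_cases hb : b = a ∘ σ.symm
  · rw [if_pos (hiff.2 hb), if_pos hb, inv_zpow', hb]
    congr 1
    have := inversions_add_inversions_rev a σ.symm
    omega
  · rw [if_neg (mt hiff.1 hb), if_neg hb]

/-- Adjacent transpositions generate the symmetric group, so `Y` transforms by the sign character
under right multiplication, and averaging against signs returns `Y`. -/
theorem mul_antisymmetrizer_of_swap {L : Type*} [Ring L] [Algebra ℂ L] (hq : q ≠ 0)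
    {Y : Matrix (Fin m → Fin N) (Fin m → Fin N) L}
    (hY : ∀ i j : Fin m, (j : ℕ) = i + 1 →
      Y * (qPerm N q (Equiv.swap i j)).map (algebraMap ℂ L) = -Y) :
    Y * (antisymmetrizer N m q).map (algebraMap ℂ L) = Y := by
  have key : ∀ σ : Equiv.Perm (Fin m),
      Y * (qPerm N q σ).map (algebraMap ℂ L) = ((Equiv.Perm.sign σ : ℤ) : ℂ) • Y := by
    have hone : Y * (qPerm N q (1 : Equiv.Perm (Fin m))).map (algebraMap ℂ L) =
        ((Equiv.Perm.sign (1 : Equiv.Perm (Fin m)) : ℤ) : ℂ) • Y := by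
      rw [qPerm_one, Matrix.map_one _ (map_zero _) (map_one _)]
      simp
    cases m with
    | zero =>
      intro σ
      rw [Subsingleton.elim σ 1]
      exact hone
    | succ n =>
      intro σ
      have hσ : σ ∈ Submonoid.closure
          (Set.range fun i : Fin n => Equiv.swap i.castSucc i.succ) := by
        rw [Equiv.Perm.mclosure_swap_castSucc_succ]
        trivial
      induction hσ using Submonoid.closure_induction with
      | mem σ h =>
        obtain ⟨i, rfl⟩ := h
        rw [hY _ _ (by simp), Equiv.Perm.sign_swap (Fin.castSucc_lt_succ).ne]
        simp
      | one => exact hone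
      | mul σ τ _ _ h1 h2 =>
        rw [qPerm_mul hq, Matrix.map_mul, ← mul_assoc, h1, Matrix.smul_mul, h2, smul_smul,
          Equiv.Perm.sign_mul, Units.val_mul, Int.cast_mul]
  have e : (antisymmetrizer N m q).map (algebraMap ℂ L) = (1 / (m.factorial : ℂ)) •
      ∑ σ : Equiv.Perm (Fin m), ((Equiv.Perm.sign σ : ℤ) : ℂ) •
        (qPerm N q σ).map (algebraMap ℂ L) := by
    ext a b
    simp only [antisymmetrizer, Matrix.map_apply, Matrix.smul_apply, Matrix.sum_apply,
      smul_eq_mul, map_mul, map_sum]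
    simp only [Algebra.smul_def]
  rw [e, Matrix.mul_smul, Finset.mul_sum]
  have h : (m.factorial : ℂ) ≠ 0 := by exact_mod_cast m.factorial_ne_zero
  have h1 : ∀ σ : Equiv.Perm (Fin m), Y * (((Equiv.Perm.sign σ : ℤ) : ℂ) •
      (qPerm N q σ).map (algebraMap ℂ L)) = Y := by
    intro σ
    rw [Matrix.mul_smul, key, smul_smul, ← Int.cast_mul, ← Units.val_mul, Int.units_mul_self]
    simp
  rw [Finset.sum_congr rfl fun σ _ => h1 σ, Finset.sum_const, Finset.card_univ,
    Fintype.card_perm, Fintype.card_fin, ← Nat.cast_smul_eq_nsmul ℂ, smul_smul,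
    one_div_mul_cancel h, one_smul]

end AntisymmetrizerLemmas

end SklyaninJacobi

namespace SklyaninJacobi

/-! ### The bracket and the q-antisymmetrizer -/

section BracketScalar

variable {N : ℕ} {q : ℂ}

theorem partialTranspose_smul {B : Type*} [MulZeroClass B] (c : B)
    (M : Matrix (Fin N × Fin N) (Fin N × Fin N) B) :
    partialTranspose (c • M) = c • partialTranspose M := rfl

/-- The R-matrix `R(q², 1)`, a multiple of `1 - P^q`. -/
noncomputable def rSpecial (N : ℕ) (q : ℂ) :
    Matrix (Fin N × Fin N) (Fin N × Fin N) (PowerSeries ℂ) :=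
  rMatrix N q (algebraMap ℂ (PowerSeries ℂ) (q ^ 2)) 1

theorem rSpecial_mul_rBarT_left (hq : q ≠ 0) (x : PowerSeries ℂ) :
    (onSlots 1 2 (rSpecial N q) * (onSlots 0 1 (rBarT N q x) * onSlots 0 2 (rBarT N q (q ^ 2 • x)))
      : Matrix (Fin 3 → _) _ _) =
    (onSlots 0 2 (rBarT N q (q ^ 2 • x)) * onSlots 0 1 (rBarT N q x)) *
      onSlots 1 2 (rSpecial N q) := by
  -- With second parameter `q²`, the factor on slots 1, 2 is `R(q², 1)`, and `R(q² x, q²)` is `q²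
  -- R(x, 1)` by homogeneity. The common factor `q²` is then cancelled.
  have h := yangBaxter_transpose_left (N := N) hq (q ^ 2 • x)
    (algebraMap ℂ (PowerSeries ℂ) (q ^ 2)) 1 1
  have e : rMatrix N q (q ^ 2 • x) (algebraMap ℂ (PowerSeries ℂ) (q ^ 2)) =
      algebraMap ℂ (PowerSeries ℂ) (q ^ 2) • rMatrix N q x 1 := by
    rw [← rMatrix_smul, mul_one, Algebra.smul_def]
  have hu : IsUnit (algebraMap ℂ (PowerSeries ℂ) (q ^ 2)) :=
    (IsUnit.mk0 _ (pow_ne_zero 2 hq)).map _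
  rw [e, mul_one, mul_one] at h
  simp only [partialTranspose_smul, onSlots_smul, Matrix.mul_smul, Matrix.smul_mul] at h
  have h' := hu.smul_left_cancel.1 h
  simp only [rBarT, onSlots_smul, Matrix.mul_smul, Matrix.smul_mul, rSpecial, mul_assoc, h']
  rw [smul_comm]

theorem rSpecial_mul_rBarT_right (hq : q ≠ 0) (x : PowerSeries ℂ) :
    (onSlots 0 1 (rSpecial N q) * (onSlots 0 2 (rBarT N q x) * onSlots 1 2 (rBarT N q (q ^ 2 • x)))
      : Matrix (Fin 3 → _) _ _) =
    (onSlots 1 2 (rBarT N q (q ^ 2 • x)) * onSlots 0 2 (rBarT N q x)) *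
      onSlots 0 1 (rSpecial N q) := by
  have h := yangBaxter_transpose_right (N := N) hq (algebraMap ℂ (PowerSeries ℂ) (q ^ 2)) 1 1 x
  rw [one_mul, ← Algebra.smul_def] at h
  simp only [rBarT, onSlots_smul, Matrix.mul_smul, Matrix.smul_mul, rSpecial, mul_assoc, h]
  rw [smul_comm]

end BracketScalar

theorem X_mul_left_injective {A : Type*} [Ring A] {f g : PowerSeries A} (h : PowerSeries.X * f = PowerSeries.X * g) :
    f = g := by
  ext n
  simpa [PowerSeries.coeff_succ_X_mul] using congrArg (PowerSeries.coeff (n + 1)) h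

section Bracket

variable {A : Type*} [Ring A] [Algebra ℂ A] {N m : ℕ} {q : ℂ}

/-- The scalar matrix `M` with entries in `A⟦u⁻¹⟧`. -/
noncomputable def scalarMatrix {ι : Type*} (A : Type*) [Ring A] [Algebra ℂ A]
    (M : Matrix ι ι (PowerSeries ℂ)) : Matrix ι ι (PowerSeries A) :=
  M.map (PowerSeries.map (algebraMap ℂ A))

theorem scalarMatrix_mul {ι : Type*} [Fintype ι] (M M' : Matrix ι ι (PowerSeries ℂ)) :
    scalarMatrix A (M * M') = scalarMatrix A M * scalarMatrix A M' :=
  Matrix.map_mul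

theorem scalarMatrix_onSlots (i j : Fin m) (M : Matrix (Fin N × Fin N) _ (PowerSeries ℂ)) :
    scalarMatrix A (onSlots i j M) = onSlots i j (scalarMatrix A M) :=
  onSlots_map _ _ _ _ (map_zero _)

theorem commute_scalarMatrix {ι κ : Type*} (M : Matrix ι ι (PowerSeries ℂ)) (a b : ι)
    (M' : Matrix κ κ (PowerSeries A)) (c d : κ) : Commute (scalarMatrix A M a b) (M' c d) :=
  commute_powerSeries_map _ _

theorem rBarTOn_eq (i j : Fin m) : rBarTOn N m A q i j = onSlots i j (scalarMatrix A
    (rBarT N q (q ^ (2 * ((i : ℕ) + j)) • (PowerSeries.X ^ 2 : PowerSeries ℂ)))) := rfl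

/-- The factors `S_i(u_i)` of the bracket. -/
noncomputable def bracketFactor (q : ℂ) (m : ℕ) (S : Matrix (Fin N) (Fin N) (PowerSeries A))
    (i : Fin m) : Matrix (Fin m → Fin N) (Fin m → Fin N) (PowerSeries A) :=
  onSlot i (S.map (dilate (q ^ (-2 * (i : ℤ)))))

theorem bracket_eq_pairProd (S : Matrix (Fin N) (Fin N) (PowerSeries A)) :
    bracket q m S = pairProd (bracketFactor q m S) (rBarTOn N m A q) (List.finRange m) :=
  prod_filter_eq_pairProd _ _ (List.pairwise_lt_finRange m)

theorem disjointCommute_onSlot_onSlots (S : Fin m → Matrix (Fin N) (Fin N) (PowerSeries A))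
    (T : Fin m → Fin m → Matrix (Fin N × Fin N) (Fin N × Fin N) (PowerSeries ℂ)) :
    DisjointCommute (fun i => onSlot i (S i)) (fun i j => onSlots i j (scalarMatrix A (T i j))) where
  single _ _ _ hij hik hjk := commute_onSlot_onSlots hij hik hjk fun _ _ _ _ =>
    (commute_scalarMatrix _ _ _ _ _ _).symm
  pair _ _ _ _ h1 h2 h3 h4 h5 h6 := commute_onSlots_onSlots h1 h2 h3 h4 h5 h6 fun _ _ _ _ =>
    commute_scalarMatrix _ _ _ _ _ _

theorem map_evalVars_map (c : Fin 2 → ℂ) {ι : Type*} (M : Matrix ι ι (MvPowerSeries (Fin 2) ℂ)) :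
    (M.map (MvPowerSeries.map (algebraMap ℂ A))).map (evalVars A c) =
      scalarMatrix A (M.map (evalVars ℂ c)) := by
  ext a b
  exact congrArg _ (evalVars_map c (M a b))

theorem map_evalVars_inVar (c : Fin 2 → ℂ) (k : Fin 2)
    (S : Matrix (Fin N) (Fin N) (PowerSeries A)) :
    (S.map (inVar k)).map (evalVars A c) = S.map (scaleHom A (c k)) := by
  ext a b
  exact congrArg _ (evalVars_inVar c k (S a b))

theorem evalVars_reflR (c : Fin 2 → ℂ) :
    (reflR N A q).map (evalVars A c) = onSlots 0 1 (scalarMatrix A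
      (rMatrix N q (c 1 • PowerSeries.X) (c 0 • PowerSeries.X))) := by
  rw [reflR, onSlots_map _ _ _ _ (map_zero _), map_evalVars_map, rMatrix_map, evalVars_X,
    evalVars_X]

theorem evalVars_reflRt (c : Fin 2 → ℂ) :
    (reflRt N A q).map (evalVars A c) = onSlots 0 1 (scalarMatrix A
      (partialTranspose (rMatrix N q ((c 0 * c 1) • PowerSeries.X ^ 2) 1))) := by
  have h : ∀ M : Matrix (Fin N × Fin N) (Fin N × Fin N) (MvPowerSeries (Fin 2) ℂ),
    (partialTranspose M).map (evalVars ℂ c) = partialTranspose (M.map (evalVars ℂ c)) :=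
      fun _ => rfl
  rw [reflRt, onSlots_map _ _ _ _ (map_zero _), map_evalVars_map, h, rMatrix_map, map_mul,
    evalVars_X, evalVars_X, map_one, smul_mul_smul_comm, pow_two]

/-- Specialising both variables to multiples of one variable turns `R(v⁻¹, u⁻¹)` into `u⁻¹` times a
constant matrix. The factor `u⁻¹` is not invertible among power series, but it can be cancelled. -/
theorem evalVars_reflection {S : Matrix (Fin N) (Fin N) (PowerSeries A)}
    (hS : ReflectionRelation q S) (c : Fin 2 → ℂ) :
    (onSlots 0 1 (scalarMatrix A
        (rMatrix N q (algebraMap ℂ _ (c 1)) (algebraMap ℂ _ (c 0)))) : Matrix (Fin 2 → _) _ _)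
      * onSlot 0 (S.map (scaleHom A (c 0))) * onSlots 0 1 (scalarMatrix A
        (partialTranspose (rMatrix N q ((c 0 * c 1) • PowerSeries.X ^ 2) 1)))
      * onSlot 1 (S.map (scaleHom A (c 1))) =
    onSlot 1 (S.map (scaleHom A (c 1))) * onSlots 0 1 (scalarMatrix A
        (partialTranspose (rMatrix N q ((c 0 * c 1) • PowerSeries.X ^ 2) 1)))
      * onSlot 0 (S.map (scaleHom A (c 0))) * onSlots 0 1 (scalarMatrix A
        (rMatrix N q (algebraMap ℂ _ (c 1)) (algebraMap ℂ _ (c 0)))) := by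
  have h := congrArg (fun M => (evalVars A c).toRingHom.mapMatrix M) hS
  simp only [reflLeft, reflRight, map_mul] at h
  simp only [RingHom.mapMatrix_apply, AlgHom.toRingHom_eq_coe, RingHom.coe_coe] at h
  simp only [evalVars_reflR, evalVars_reflRt] at h
  simp only [onSlot_map _ _ _ (map_zero (evalVars A c)), map_evalVars_inVar] at h
  have e : rMatrix N q (c 1 • PowerSeries.X) (c 0 • PowerSeries.X : PowerSeries ℂ) =
      (PowerSeries.X : PowerSeries ℂ) •
        rMatrix N q (algebraMap ℂ _ (c 1)) (algebraMap ℂ _ (c 0)) := by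
    rw [← rMatrix_smul, Algebra.smul_def, Algebra.smul_def, mul_comm, mul_comm PowerSeries.X]
    rw [mul_comm PowerSeries.X]
  have e' : ∀ M : Matrix (Fin N × Fin N) (Fin N × Fin N) (PowerSeries ℂ),
      (onSlots 0 1 (scalarMatrix A ((PowerSeries.X : PowerSeries ℂ) • M)) :
        Matrix (Fin 2 → Fin N) _ (PowerSeries A)) =
      (PowerSeries.X : PowerSeries A) • onSlots 0 1 (scalarMatrix A M) := by
    intro M
    rw [← onSlots_smul]
    congr 1
    ext1 a b
    simp [scalarMatrix]
  have e'' : ∀ M M' : Matrix (Fin 2 → Fin N) (Fin 2 → Fin N) (PowerSeries A),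
      M * ((PowerSeries.X : PowerSeries A) • M') = (PowerSeries.X : PowerSeries A) • (M * M') := by
    intro M M'
    ext1 a b
    simp only [Matrix.mul_apply, Matrix.smul_apply, smul_eq_mul, Finset.mul_sum, ← mul_assoc]
    refine Finset.sum_congr rfl fun c _ => ?_
    rw [(PowerSeries.commute_X (M a c)).eq]
  rw [e, e', e''] at h
  simp only [Matrix.smul_mul] at h
  ext1 a b
  exact X_mul_left_injective (congrFun (congrFun h a) b)

end Bracket

end SklyaninJacobi

namespace SklyaninJacobi

/-! ### Absorbing the q-antisymmetrizer into the bracket. -/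

section BracketExchange

variable {A : Type*} [Ring A] [Algebra ℂ A] {N m : ℕ} {q : ℂ}

theorem embed_triple_onSlots {B : Type*} [Zero B] {i j k : Fin m} (hij : i ≠ j) (hik : i ≠ k)
    (hjk : j ≠ k) (a b : Fin 3) (M : Matrix (Fin N × Fin N) (Fin N × Fin N) B) :
    embed ![i, j, k] (onSlots a b M) = onSlots (![i, j, k] a) (![i, j, k] b) M :=
  embed_onSlots (injective_triple hij hik hjk) a b M

theorem dilate_eq_scaleHom_pow (i : ℕ) :
    (dilate (q ^ (-2 * (i : ℤ))) : PowerSeries A → _) = scaleHom A (q ^ (2 * i)) := by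
  rw [dilate_eq, ← zpow_neg]
  congr 2
  rw [← zpow_natCast]
  congr 1
  push_cast
  ring

theorem bracket_exchange (hq : q ≠ 0) {S : Matrix (Fin N) (Fin N) (PowerSeries A)}
    (hS : ReflectionRelation q S) {i j : Fin m} (hij : (j : ℕ) = i + 1) :
    Exchange (onSlots i j (scalarMatrix A (rSpecial N q))) i j (bracketFactor q m S)
      (rBarTOn N m A q) where
  single k hki hkj := by
    have hne : i ≠ j := fun h => by rw [h] at hij; omega
    exact (commute_onSlot_onSlots hki hkj hne fun _ _ _ _ =>
      (commute_scalarMatrix _ _ _ _ _ _).symm).symm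
  pair k l hki hkj hli hlj hkl := by
    have hne : i ≠ j := fun h => by rw [h] at hij; omega
    exact commute_onSlots_onSlots hne hki.symm hli.symm hkj.symm hlj.symm hkl
      fun _ _ _ _ => commute_scalarMatrix _ _ _ _ _ _
  left k hki hkj := by
    have hne : i ≠ j := fun h => by rw [h] at hij; omega
    have h := congrArg (fun M => embed ![k, i, j] (scalarMatrix A M))
      (rSpecial_mul_rBarT_left (N := N) hq (q ^ (2 * ((k : ℕ) + i)) • PowerSeries.X ^ 2))
    simp only [scalarMatrix_mul, embed_mul (injective_triple hki hkj hne), scalarMatrix_onSlots,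
      embed_triple_onSlots hki hkj hne] at h
    simp only [Matrix.cons_val, smul_smul, ← pow_add] at h
    have e : 2 + 2 * ((k : ℕ) + i) = 2 * (k + j) := by omega
    rw [e] at h
    exact ⟨_, h⟩
  right k hki hkj := by
    have hne : i ≠ j := fun h => by rw [h] at hij; omega
    have h := congrArg (fun M => embed ![i, j, k] (scalarMatrix A M))
      (rSpecial_mul_rBarT_right (N := N) hq (q ^ (2 * ((i : ℕ) + k)) • PowerSeries.X ^ 2))
    simp only [scalarMatrix_mul, embed_mul (injective_triple hne hki.symm hkj.symm),
      scalarMatrix_onSlots, embed_triple_onSlots hne hki.symm hkj.symm] at h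
    simp only [Matrix.cons_val, smul_smul, ← pow_add] at h
    have e : 2 + 2 * ((i : ℕ) + k) = 2 * (j + k) := by omega
    rw [e] at h
    exact ⟨_, h⟩
  core := by
    have hne : i ≠ j := fun h => by rw [h] at hij; omega
    -- The parameters are chosen so that the inverse variables at adjacent slots have ratio `q²`.
    -- The R-matrix in the reflection relation is then proportional to `rSpecial`.
    have h := evalVars_reflection hS ![q ^ (2 * (i : ℕ)), q ^ (2 * (j : ℕ))]
    simp only [Matrix.cons_val] at h
    have e : rMatrix N q (algebraMap ℂ (PowerSeries ℂ) (q ^ (2 * (j : ℕ))))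
        (algebraMap ℂ _ (q ^ (2 * (i : ℕ)))) =
        algebraMap ℂ (PowerSeries ℂ) (q ^ (2 * (i : ℕ))) • rSpecial N q := by
      rw [rSpecial, ← rMatrix_smul, mul_one, ← map_mul, ← pow_add, hij]
      congr 3
    have e' : ∀ (c : ℂ) (M : Matrix (Fin N × Fin N) (Fin N × Fin N) (PowerSeries ℂ)),
        (onSlots 0 1 (scalarMatrix A (algebraMap ℂ (PowerSeries ℂ) c • M)) :
          Matrix (Fin 2 → Fin N) _ (PowerSeries A)) = c • onSlots 0 1 (scalarMatrix A M) := by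
      intro c M
      ext1 a b
      simp only [onSlots, scalarMatrix, Matrix.map_apply, Matrix.smul_apply]
      split_ifs
      · rw [← map_smul_algebraMap, smul_eq_mul, ← Algebra.smul_def]
      · simp
    rw [e, e'] at h
    simp only [Matrix.smul_mul, Matrix.mul_smul] at h
    have hu : q ^ (2 * (i : ℕ)) ≠ 0 := pow_ne_zero _ hq
    have h2 := (IsUnit.mk0 _ hu).smul_left_cancel.1 h
    have h3 := congrArg (embed ![i, j]) h2
    simp only [embed_mul (injective_pair hne), embed_onSlot (injective_pair hne),
      embed_onSlots (injective_pair hne)] at h3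
    simp only [Matrix.cons_val, ← pow_add] at h3
    have e3 : 2 * (i : ℕ) + 2 * j = 2 * (i + j) := by ring
    rw [e3, ← dilate_eq_scaleHom_pow, ← dilate_eq_scaleHom_pow] at h3
    set c : PowerSeries ℂ :=
      (q ^ (2 * ((i : ℕ) + j)) • (PowerSeries.X ^ 2 : PowerSeries ℂ) - 1)⁻¹ with hc
    set v : PowerSeries A := PowerSeries.map (algebraMap ℂ A) c with hv
    have e4 : rBarTOn N m A q i j = v • onSlots i j (scalarMatrix A
        (partialTranspose (rMatrix N q
          (q ^ (2 * ((i : ℕ) + j)) • (PowerSeries.X ^ 2 : PowerSeries ℂ)) 1))) := by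
      rw [rBarTOn_eq, ← onSlots_smul]
      congr 1
      ext1 a b
      simp [scalarMatrix, rBarT, ← hc, hv]
    -- The normalising factor of `R̄^t` is a series with scalar coefficients, hence central, and may
    -- be moved through the noncommuting entries.
    have e5 : ∀ M M' : Matrix (Fin m → Fin N) (Fin m → Fin N) (PowerSeries A),
        M * (v • M') = v • (M * M') := by
      intro M M'
      ext1 a b
      simp only [Matrix.mul_apply, Matrix.smul_apply, smul_eq_mul, Finset.mul_sum, ← mul_assoc]
      refine Finset.sum_congr rfl fun d _ => ?_
      rw [(commute_powerSeries_map c (M a d)).eq]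
    refine ⟨v • (bracketFactor q m S j * onSlots i j (scalarMatrix A
        (partialTranspose (rMatrix N q
          (q ^ (2 * ((i : ℕ) + j)) • (PowerSeries.X ^ 2 : PowerSeries ℂ)) 1)))
          * bracketFactor q m S i), ?_⟩
    rw [e4, e5]
    simp only [Matrix.smul_mul, e5]
    congr 1
    simp only [← mul_assoc]
    exact h3

theorem finRange_split {i j : Fin m} (hij : (j : ℕ) = i + 1) :
    ∃ l₁ l₂, List.finRange m = l₁ ++ i :: j :: l₂ := by
  have hi : (i : ℕ) < (List.finRange m).length := by simp
  have hj : (i : ℕ) + 1 < (List.finRange m).length := by simp [← hij]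
  refine ⟨(List.finRange m).take i, (List.finRange m).drop (i + 2), ?_⟩
  conv_lhs => rw [← List.take_append_drop i (List.finRange m)]
  rw [List.drop_eq_getElem_cons hi, List.drop_eq_getElem_cons hj]
  congr 3
  · simp
  · simp [← hij]

theorem bracket_passes (hq : q ≠ 0) {S : Matrix (Fin N) (Fin N) (PowerSeries A)}
    (hS : ReflectionRelation q S) {i j : Fin m} (hij : (j : ℕ) = i + 1) :
    Passes (onSlots i j (scalarMatrix A (rSpecial N q))) (bracket q m S) := by
  obtain ⟨l₁, l₂, hl⟩ := finRange_split hij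
  have hne : i ≠ j := fun h => by rw [h] at hij; omega
  rw [bracket_eq_pairProd, hl]
  refine (bracket_exchange hq hS hij).passes (disjointCommute_onSlot_onSlots _ _) hne l₁ l₂ ?_
  rw [← hl]
  exact List.nodup_finRange m

/-- The q-antisymmetrizer with entries in `A⟦u⁻¹⟧`. -/
noncomputable def seriesAntisymmetrizer (N m : ℕ) (A : Type*) [Ring A] [Algebra ℂ A] (q : ℂ) :
    Matrix (Fin m → Fin N) (Fin m → Fin N) (PowerSeries A) :=
  (antisymmetrizer N m q).map (algebraMap ℂ (PowerSeries A))

theorem onSlots_rSpecial (hq : q ≠ 0) {i j : Fin m} (hij : (j : ℕ) = i + 1) :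
    onSlots i j (scalarMatrix A (rSpecial N q)) =
      (q ^ 2 - 1) • (1 - (qPerm N q (Equiv.swap i j)).map (algebraMap ℂ (PowerSeries A))) := by
  rw [qPerm_swap q i j hij, rSpecial, rMatrix_sq_one hq]
  have h1 : (1 : Matrix (Fin m → Fin N) (Fin m → Fin N) (PowerSeries A)) =
      onSlots i j ((1 : Matrix (Fin N × Fin N) _ ℂ).map (algebraMap ℂ (PowerSeries A))) := by
    rw [Matrix.map_one _ (map_zero _) (map_one _), onSlots_one]
  rw [onSlots_map _ _ _ _ (map_zero _), h1]
  ext1 a b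
  have halg : ∀ c : ℂ, PowerSeries.map (algebraMap ℂ A) (algebraMap ℂ (PowerSeries ℂ) c) =
      algebraMap ℂ (PowerSeries A) c := (scalarHom Unit A).commutes
  simp only [onSlots, scalarMatrix, Matrix.map_apply, Matrix.smul_apply, Matrix.sub_apply,
    smul_eq_mul, map_mul, halg]
  split_ifs
  · rw [Algebra.smul_def, map_sub, map_sub (algebraMap ℂ (PowerSeries A))]
  · simp

/-- From `A (1 - P) = 2 A` it follows that `2 A ⟨S⟩ = A (1 - P) ⟨S⟩ = A Y (1 - P)`, and `(1 - P) P =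
-(1 - P)`. So right multiplication by each adjacent `P` acts on `A ⟨S⟩` as `-1`. The condition `q² ≠
1` permits division by the fusion constant. -/
theorem antisymmetrizer_mul_bracket_mul (hq : q ≠ 0) (hq2 : q ^ 2 ≠ 1)
    {S : Matrix (Fin N) (Fin N) (PowerSeries A)} (hS : ReflectionRelation q S) :
    seriesAntisymmetrizer N m A q * bracket q m S * seriesAntisymmetrizer N m A q =
      seriesAntisymmetrizer N m A q * bracket q m S := by
  refine mul_antisymmetrizer_of_swap hq fun i j hij => ?_
  have hne : i ≠ j := fun h => by rw [h] at hij; omega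
  obtain ⟨Y, hY⟩ := bracket_passes (m := m) hq hS hij
  rw [onSlots_rSpecial hq hij, Matrix.smul_mul, Matrix.mul_smul] at hY
  replace hY := (IsUnit.mk0 _ (sub_ne_zero.2 hq2)).smul_left_cancel.1 hY
  set P := (qPerm N q (Equiv.swap i j)).map (algebraMap ℂ (PowerSeries A)) with hP
  have hPP : P * P = 1 := by
    rw [hP, ← Matrix.map_mul, ← qPerm_mul hq, Equiv.swap_mul_self, qPerm_one,
      Matrix.map_one _ (map_zero _) (map_one _)]
  have hAP : seriesAntisymmetrizer N m A q * P = - seriesAntisymmetrizer N m A q := by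
    rw [seriesAntisymmetrizer, hP, ← Matrix.map_mul, antisymmetrizer_mul_qPerm hq,
      Equiv.Perm.sign_swap hne]
    ext1 a b
    simp
  set Z := seriesAntisymmetrizer N m A q
  set W := bracket q m S
  have h1 : (2 : ℂ) • (Z * W) = Z * Y * (1 - P) := by
    rw [mul_assoc, ← hY, ← mul_assoc, mul_sub, hAP, mul_one, sub_neg_eq_add, add_mul, two_smul]
  have h2 : (1 - P) * P = -(1 - P) := by
    rw [sub_mul, hPP, one_mul, neg_sub]
  have h3 : (2 : ℂ) • (Z * W * P) = (2 : ℂ) • (-(Z * W)) := by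
    rw [← Matrix.smul_mul, h1, mul_assoc, h2, mul_neg, ← h1, smul_neg]
  exact (IsUnit.mk0 (2 : ℂ) two_ne_zero).smul_left_cancel.1 h3

theorem sklyaninMinor_eq (S : Matrix (Fin N) (Fin N) (PowerSeries A)) (f g : Fin m → Fin N) :
    sklyaninMinor q S f g =
      (m.factorial : ℂ) • (seriesAntisymmetrizer N m A q * bracket q m S) f g := rfl

/-- `A ⟨S⟩ = A ⟨S⟩ A` has the rank-one `A_N` on both sides, which leaves a single series as
coefficient; it is identified in the row and column `id`. -/
theorem antisymmetrizer_mul_bracket_apply (hq : q ≠ 0) (hq2 : q ^ 2 ≠ 1)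
    {S : Matrix (Fin N) (Fin N) (PowerSeries A)} (hS : ReflectionRelation q S)
    (a b : Fin N → Fin N) :
    (seriesAntisymmetrizer N N A q * bracket q N S) b a =
      sdet q S * seriesAntisymmetrizer N N A q b a := by
  rw [sdet, sklyaninMinor_eq, ← antisymmetrizer_mul_bracket_mul hq hq2 hS]
  simp only [Matrix.mul_apply, seriesAntisymmetrizer, Matrix.map_apply, Finset.sum_mul,
    Finset.smul_sum]
  refine Finset.sum_congr rfl fun d _ => Finset.sum_congr rfl fun c _ => ?_
  rw [antisymmetrizer_rank_one hq c b, antisymmetrizer_rank_one hq a d,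
    antisymmetrizer_rank_one hq a b]
  have hL : ∀ (x : PowerSeries A) (c : ℂ), algebraMap ℂ (PowerSeries A) c * x = c • x :=
    fun x c => (Algebra.smul_def c x).symm
  have hR : ∀ (x : PowerSeries A) (c : ℂ), x * algebraMap ℂ (PowerSeries A) c = c • x :=
    fun x c => by rw [← Algebra.commutes, hL]
  simp only [hL, hR, smul_smul]
  congr 1
  ring

end BracketExchange

end SklyaninJacobi

namespace SklyaninJacobi

/-! ### Conjugation by diagonal matrices -/

section Twist

variable {B : Type*} [Ring B] [Algebra ℂ B] {N n k : ℕ}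

/-- The eigenvalue of `C ⊗ ⋯ ⊗ C` on a basis vector for `C = diag(c)`. -/
noncomputable def weight (c : Fin N → ℂ) (a : Fin n → Fin N) : ℂ := ∏ i, c (a i)

theorem weight_ne_zero {c : Fin N → ℂ} (hc : ∀ i, c i ≠ 0) (a : Fin n → Fin N) :
    weight c a ≠ 0 := Finset.prod_ne_zero_iff.2 fun _ _ => hc _

theorem weight_comp_perm (c : Fin N → ℂ) (a : Fin n → Fin N) (σ : Equiv.Perm (Fin n)) :
    weight c (a ∘ σ) = weight c a :=
  Equiv.prod_comp σ fun i => c (a i)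

theorem weight_div_of_eq_off {c : Fin N → ℂ} (hc : ∀ i, c i ≠ 0) {e : Fin k → Fin n}
    (he : Function.Injective e) {a b : Fin n → Fin N} (h : ∀ i, (∀ j, e j ≠ i) → a i = b i) :
    weight c a / weight c b = weight c (a ∘ e) / weight c (b ∘ e) := by
  simp only [weight, ← Finset.prod_div_distrib]
  symm
  refine Finset.prod_of_injOn e he.injOn (fun _ _ => by simp) ?_ fun _ _ => rfl
  intro i _ hi
  rw [h i fun j hj => hi ⟨j, by simp, hj⟩, div_self (hc _)]

/-- Conjugation by `C ⊗ ⋯ ⊗ C` for `C = diag(c)`. -/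
noncomputable def twistHom {c : Fin N → ℂ} (hc : ∀ i, c i ≠ 0) :
    Matrix (Fin n → Fin N) (Fin n → Fin N) B →+* Matrix (Fin n → Fin N) (Fin n → Fin N) B where
  toFun M := Matrix.of fun a b => (weight c a / weight c b) • M a b
  map_one' := by
    ext1 a b
    by_cases h : a = b
    · subst h
      simp [div_self (weight_ne_zero hc a)]
    · simp [h]
  map_mul' M M' := by
    ext1 a b
    simp only [Matrix.mul_apply, Matrix.of_apply, Finset.smul_sum, smul_mul_smul_comm]
    refine Finset.sum_congr rfl fun d _ => ?_
    rw [div_mul_div_cancel₀ (weight_ne_zero hc d)]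
  map_zero' := by
    ext1 a b
    simp
  map_add' M M' := by
    ext1 a b
    simp

theorem twistHom_apply {c : Fin N → ℂ} (hc : ∀ i, c i ≠ 0)
    (M : Matrix (Fin n → Fin N) (Fin n → Fin N) B) (a b : Fin n → Fin N) :
    twistHom hc M a b = (weight c a / weight c b) • M a b := rfl

theorem twistHom_embed {c : Fin N → ℂ} (hc : ∀ i, c i ≠ 0) {e : Fin k → Fin n}
    (he : Function.Injective e) (M : Matrix (Fin k → Fin N) (Fin k → Fin N) B) :
    twistHom hc (embed e M) = embed e (twistHom hc M) := by
  ext1 a b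
  simp only [twistHom_apply, embed_apply]
  split_ifs with h
  · rw [weight_div_of_eq_off hc he h]
  · rw [smul_zero]

theorem twistHom_onSlot {c : Fin N → ℂ} (hc : ∀ i, c i ≠ 0) (p : Fin n)
    (M : Matrix (Fin N) (Fin N) B) :
    twistHom hc (onSlot p M) = onSlot p (Matrix.of fun a b => (c a / c b) • M a b) := by
  rw [onSlot_eq_embed, twistHom_embed hc (injective_single p), onSlot_eq_embed]
  congr 1
  ext1 a b
  simp [twistHom_apply, weight]

theorem twistHom_onSlots {c : Fin N → ℂ} (hc : ∀ i, c i ≠ 0) {p p' : Fin n} (h : p ≠ p')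
    (M : Matrix (Fin N × Fin N) (Fin N × Fin N) B) :
    twistHom hc (onSlots p p' M) = onSlots p p'
      (Matrix.of fun a b => ((c a.1 * c a.2) / (c b.1 * c b.2)) • M a b) := by
  rw [onSlots_eq_embed, twistHom_embed hc (injective_pair h), onSlots_eq_embed]
  congr 1
  ext1 a b
  simp [twistHom_apply, weight, Fin.prod_univ_two]

/-- `embed` as a homomorphism. -/
def embedHom {e : Fin k → Fin n} (he : Function.Injective e) :
    Matrix (Fin k → Fin N) (Fin k → Fin N) B →+* Matrix (Fin n → Fin N) (Fin n → Fin N) B where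
  toFun := embed e
  map_one' := embed_one
  map_mul' := embed_mul he
  map_zero' := by
    ext1 a b
    simp [embed_apply]
  map_add' M M' := by
    ext1 a b
    simp only [embed_apply, Matrix.add_apply]
    split_ifs <;> simp

end Twist

/-! ### Crossing symmetry in conjugated form. -/

section Crossing

variable {N : ℕ} {q : ℂ}

theorem cDiag_ne_zero {r : ℂ} (hr : r ≠ 0) (i : Fin N) : cDiag N r i i ≠ 0 := by
  rw [cDiag, Matrix.diagonal_apply_eq]
  exact zpow_ne_zero _ hr

theorem crossing_mul_twist {B : Type*} [CommRing B] [Algebra ℂ B] (hq : q ≠ 0) {r : ℂ}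
    (hr : r ^ 2 = -q) (x y : B) (hy : y = (q⁻¹ ^ (2 * N)) • x) :
    partialTranspose (rMatrix N q x 1) * (Matrix.of fun a b : Fin N × Fin N =>
      ((cDiag N r a.2 a.2 * cDiag N r a.1 a.1) / (cDiag N r b.2 b.2 * cDiag N r b.1 b.1)) •
        partialTranspose (rMatrix N q⁻¹ y 1) a.swap b.swap) = ((x - 1) * (y - 1)) • 1 := by
  have hr0 : r ≠ 0 := by
    rintro rfl
    apply hq
    simpa [eq_comm] using hr
  have e : (Matrix.of fun a b : Fin N × Fin N =>
      ((cDiag N r a.2 a.2 * cDiag N r a.1 a.1) / (cDiag N r b.2 b.2 * cDiag N r b.1 b.1)) •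
        partialTranspose (rMatrix N q⁻¹ y 1) a.swap b.swap) =
      Matrix.diagonal (fun a : Fin N × Fin N =>
        algebraMap ℂ B (cDiag N r a.1 a.1 * cDiag N r a.2 a.2)) *
      (partialTranspose (rMatrix N q⁻¹ y 1)).submatrix Prod.swap Prod.swap *
      Matrix.diagonal (fun a : Fin N × Fin N =>
        algebraMap ℂ B (cDiag N r a.1 a.1 * cDiag N r a.2 a.2)⁻¹) := by
    ext1 a b
    rw [Matrix.mul_diagonal, Matrix.diagonal_mul, Matrix.of_apply, Algebra.smul_def,
      div_eq_mul_inv, map_mul, mul_comm (cDiag N r a.2 a.2), mul_comm (cDiag N r b.2 b.2),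
      Matrix.submatrix_apply]
    ring
  rw [e, ← mul_assoc, ← mul_assoc, crossing_mul hq hr x y hy, Matrix.smul_mul,
    Matrix.diagonal_mul_diagonal, ← Matrix.diagonal_one]
  congr 2
  ext1 a
  rw [← map_mul, mul_inv_cancel₀ (mul_ne_zero (cDiag_ne_zero hr0 _) (cDiag_ne_zero hr0 _)),
    map_one]

/-- The normalisation by `(x - 1)⁻¹` and `(y - 1)⁻¹` removes exactly the scalar in crossing
symmetry; both factors are invertible since `x` and `y` have no constant term. -/
theorem rBarT_mul_twist (hq : q ≠ 0) {r : ℂ} (hr : r ^ 2 = -q) (x : PowerSeries ℂ)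
    (hx : PowerSeries.constantCoeff x = 0) :
    rBarT N q x * (Matrix.of fun a b : Fin N × Fin N =>
      ((cDiag N r a.2 a.2 * cDiag N r a.1 a.1) / (cDiag N r b.2 b.2 * cDiag N r b.1 b.1)) •
        rBarT N q⁻¹ ((q⁻¹ ^ (2 * N)) • x) a.swap b.swap) = 1 := by
  have key := crossing_mul_twist (N := N) hq hr x _ rfl
  set y := (q⁻¹ ^ (2 * N)) • x with hy
  have hu : (x - 1)⁻¹ * (x - 1) = 1 := PowerSeries.inv_mul_cancel _ (by simp [hx])
  have hv : (y - 1)⁻¹ * (y - 1) = 1 := PowerSeries.inv_mul_cancel _ (by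
    rw [hy, Algebra.smul_def]
    simp [hx])
  have e : (Matrix.of fun a b : Fin N × Fin N =>
      ((cDiag N r a.2 a.2 * cDiag N r a.1 a.1) / (cDiag N r b.2 b.2 * cDiag N r b.1 b.1)) •
        rBarT N q⁻¹ y a.swap b.swap) = (y - 1)⁻¹ • (Matrix.of fun a b : Fin N × Fin N =>
      ((cDiag N r a.2 a.2 * cDiag N r a.1 a.1) / (cDiag N r b.2 b.2 * cDiag N r b.1 b.1)) •
        partialTranspose (rMatrix N q⁻¹ y 1) a.swap b.swap) := by
    ext1 a b
    simp only [Matrix.of_apply, rBarT, Matrix.smul_apply, partialTranspose]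
    rw [smul_comm]
  rw [e, rBarT, Matrix.smul_mul, Matrix.mul_smul, key, smul_smul, smul_smul]
  have h1 : (x - 1)⁻¹ * (y - 1)⁻¹ * ((x - 1) * (y - 1)) = 1 := by
    linear_combination (y - 1)⁻¹ * (y - 1) * hu + hv
  rw [h1, one_smul]

end Crossing

/-! ### Conjugates of `X(u)` as inverses of shifts of `S(u)`. -/

section Inverse

variable {A : Type*} [Ring A] [Algebra ℂ A] {N : ℕ} {q r : ℂ}

theorem xMatrix_apply (hr : r ≠ 0) (S : Matrix (Fin N) (Fin N) (PowerSeries A)) (a b : Fin N) :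
    xMatrix q r S a b = ((cDiag N r b b) / (cDiag N r a a)) •
      Ring.inverse (S.map (dilate (q ^ (-(N : ℤ))))) a b := by
  have h : (cDiag N r)⁻¹ = Matrix.diagonal fun i => (cDiag N r i i)⁻¹ := by
    refine Matrix.inv_eq_right_inv ?_
    have e : cDiag N r = Matrix.diagonal fun i => cDiag N r i i := by
      simp [cDiag]
    conv_lhs => rw [e, Matrix.diagonal_mul_diagonal]
    rw [← Matrix.diagonal_one]
    congr 1
    ext1 i
    rw [Matrix.diagonal_apply_eq]
    exact mul_inv_cancel₀ (cDiag_ne_zero hr i)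
  have e : (cDiag N r).map (algebraMap ℂ (PowerSeries A)) =
      Matrix.diagonal fun i => algebraMap ℂ (PowerSeries A) (cDiag N r i i) := by
    rw [← Matrix.diagonal_map (map_zero _)]
    simp [cDiag]
  rw [xMatrix, h, Matrix.diagonal_map (map_zero _), e, Matrix.mul_diagonal, Matrix.diagonal_mul,
    ← Algebra.commutes, ← mul_assoc, ← map_mul, ← Algebra.smul_def, div_eq_mul_inv]

theorem dilate_zpow (c : ℂ) (n : ℤ) :
    (dilate (c ^ n) : PowerSeries A → _) = scaleHom A (c ^ (-n)) := by
  rw [dilate_eq, zpow_neg]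

theorem map_scaleHom_mul_twist_xMatrix (hq : q ≠ 0) (hr : r ≠ 0)
    {S : Matrix (Fin N) (Fin N) (PowerSeries A)} (hS : IsUnit (S.map (dilate (q ^ (-(N : ℤ))))))
    (n : ℤ) :
    S.map (scaleHom A (q ^ n)) * (Matrix.of fun a b =>
      (cDiag N r a a / cDiag N r b b) • (xMatrix q r S).map (scaleHom A (q ^ (n - N))) a b) = 1 := by
  have h := congrArg (scaleHom A (q ^ (n - N))).toRingHom.mapMatrix
    (Ring.mul_inverse_cancel _ hS)
  rw [map_mul, map_one] at h
  rw [← h]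
  congr 1
  · ext1 a b
    simp only [RingHom.mapMatrix_apply, Matrix.map_apply, dilate_zpow, neg_neg]
    change _ = scaleHom A _ (scaleHom A _ _)
    rw [scaleHom_scaleHom, ← zpow_add₀ hq, sub_add_cancel]
  · ext1 a b
    rw [Matrix.of_apply, Matrix.map_apply, xMatrix_apply hr, map_smul, smul_smul,
      div_mul_div_cancel₀ (cDiag_ne_zero hr b), div_self (cDiag_ne_zero hr a), one_smul]
    rfl

end Inverse

/-! ### Operators on basis vectors indexed by concatenated sequences. -/

section Jacobi

variable {A : Type*} [Ring A] [Algebra ℂ A] {q r : ℂ} {m k N : ℕ}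

theorem finRange_add (m k : ℕ) : List.finRange (m + k) =
    (List.finRange m).map (Fin.castAdd k) ++ (List.finRange k).map (Fin.natAdd m) := by
  refine List.ext_getElem (by simp) fun i h1 h2 => ?_
  rw [List.getElem_append]
  split_ifs with h
  · ext
    simp
  · ext
    simp at h ⊢
    omega

theorem mul_embed_apply {n : ℕ} {B : Type*} [Semiring B] {e : Fin k → Fin n}
    (he : Function.Injective e) (Y : Matrix (Fin n → Fin N) (Fin n → Fin N) B)
    (M : Matrix (Fin k → Fin N) (Fin k → Fin N) B) (a b : Fin n → Fin N) :
    (Y * embed e M) a b = ∑ x, Y a (Function.extend e x b) * M x (b ∘ e) := by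
  rw [Matrix.mul_apply]
  symm
  refine Finset.sum_of_injOn (fun x => Function.extend e x b) ?_ (fun _ _ => by simp) ?_ ?_
  · intro x _ y _ h
    rw [← extend_comp_inj he x b, ← extend_comp_inj he y b]
    exact congrArg (· ∘ e) h
  · intro c _ hc
    rw [embed_apply, if_neg, mul_zero]
    intro h
    refine hc ⟨c ∘ e, by simp, ?_⟩
    ext i
    by_cases hi : ∃ j, e j = i
    · obtain ⟨j, rfl⟩ := hi
      simp [he.extend_apply]
    · exact congrArg Fin.val ((Function.extend_apply' _ _ _ hi).trans
        (h i fun j hj => hi ⟨j, hj⟩).symm)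
  · intro x _
    rw [embed_apply, if_pos, extend_comp_inj he]
    intro i hi
    rw [Function.extend_apply' _ _ _ fun ⟨j, hj⟩ => hi j hj]

/-- The matrix `M` fixes the basis vector `e_t`. -/
def FixesVector {ι B : Type*} [DecidableEq ι] [Zero B] [One B] (M : Matrix ι ι B) (t : ι) : Prop :=
  ∀ a, M a t = if a = t then 1 else 0

theorem FixesVector.mul_apply {ι B : Type*} [DecidableEq ι] [Fintype ι] [Semiring B]
    {M : Matrix ι ι B} {t : ι} (h : FixesVector M t) (Y : Matrix ι ι B) (a : ι) :
    (Y * M) a t = Y a t := by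
  rw [Matrix.mul_apply, Finset.sum_eq_single t]
  · rw [h, if_pos rfl, mul_one]
  · intro c _ hc
    rw [h, if_neg hc, mul_zero]
  · simp

theorem FixesVector.list_prod {ι κ B : Type*} [DecidableEq ι] [Fintype ι] [Semiring B]
    {t : ι} {l : List κ} {F : κ → Matrix ι ι B} (h : ∀ i ∈ l, FixesVector (F i) t) :
    FixesVector (l.map F).prod t := by
  induction l with
  | nil =>
    intro a
    simp [Matrix.one_apply]
  | cons i l ih =>
    intro a
    rw [List.map_cons, List.prod_cons, (ih fun j hj => h j (by simp [hj])).mul_apply]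
    exact h i (by simp) a

/-- On `e_a ⊗ e_b` with `a ≠ b` the matrix `R^t(x, 1)` acts by `x - 1`, which the normalisation
turns into `1`. -/
theorem rBarTOn_fixesVector {i j : Fin m} {t : Fin m → Fin N} (ht : t i ≠ t j) :
    FixesVector (rBarTOn N m A q i j) t := by
  intro a
  have hij : i ≠ j := fun h => ht (by rw [h])
  rw [rBarTOn_eq]
  set x : PowerSeries ℂ := q ^ (2 * ((i : ℕ) + j)) • (PowerSeries.X ^ 2 : PowerSeries ℂ) with hx
  have hu : (x - 1)⁻¹ * (x - 1) = 1 := PowerSeries.inv_mul_cancel _ (by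
    rw [hx, Algebra.smul_def]
    simp)
  simp only [onSlots, scalarMatrix, Matrix.map_apply, rBarT, Matrix.smul_apply, partialTranspose,
    rMatrix_eq]
  by_cases h : a = t
  · subst h
    simp [rDiag, ht, hu]
  · simp only [if_neg h, ht, false_and, if_false, add_zero]
    split_ifs with h1 h2
    · refine absurd ?_ h
      ext l
      by_cases hl : l = i
      · subst hl
        rw [h2.1]
      · by_cases hl' : l = j
        · subst hl'
          rw [h2.2]
        · rw [h1 l hl hl']
    · simp
    · rfl

theorem extend_castAdd {α : Type*} (f J : Fin m → α) (g : Fin k → α) :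
    Function.extend (Fin.castAdd k) J (Fin.append f g) = Fin.append J g := by
  ext i
  refine Fin.addCases (fun i => ?_) (fun i => ?_) i
  · rw [(Fin.castAdd_injective m k).extend_apply, Fin.append_left]
  · rw [Function.extend_apply', Fin.append_right, Fin.append_right]
    rintro ⟨j, hj⟩
    have := congrArg Fin.val hj
    simp at this
    omega

theorem natAdd_rev_injective : Function.Injective fun i : Fin k => Fin.natAdd m i.rev :=
  (Fin.natAdd_injective k m).comp Fin.rev_injective

theorem extend_natAdd_rev {α : Type*} (f : Fin m → α) (g K : Fin k → α) :
    Function.extend (fun i : Fin k => Fin.natAdd m i.rev) K (Fin.append f g) =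
      Fin.append f (K ∘ Fin.rev) := by
  ext i
  refine Fin.addCases (fun i => ?_) (fun i => ?_) i
  · rw [Function.extend_apply', Fin.append_left, Fin.append_left]
    rintro ⟨j, hj⟩
    have := congrArg Fin.val hj
    simp at this
    omega
  · have := (natAdd_rev_injective (m := m)).extend_apply K (Fin.append f g) i.rev
    simp only [Fin.rev_rev] at this
    rw [this, Fin.append_right]
    rfl

end Jacobi

end SklyaninJacobi

namespace SklyaninJacobi

/-! ### The identity for complementary minors. -/

section JacobiIdentity

variable {A : Type*} [Ring A] [Algebra ℂ A] {q r : ℂ} {m k N : ℕ}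

theorem DisjointCommute.map {ι M M' : Type*} [Ring M] [Ring M'] (F : M →+* M') {s : ι → M}
    {ρ : ι → ι → M} (h : DisjointCommute s ρ) :
    DisjointCommute (fun i => F (s i)) (fun i j => F (ρ i j)) where
  single i j k h1 h2 h3 := (h.single i j k h1 h2 h3).map F
  pair i j k l h1 h2 h3 h4 h5 h6 := (h.pair i j k l h1 h2 h3 h4 h5 h6).map F

/-- The factors of the bracket of `X(u)`, in the slots in which they are inverse to the factors of
the bracket of `S(u)` up to conjugation. -/
noncomputable def dualFactor (q : ℂ) (X : Matrix (Fin N) (Fin N) (PowerSeries A)) (i : Fin N) :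
    Matrix (Fin N → Fin N) (Fin N → Fin N) (PowerSeries A) :=
  onSlot i (X.map (scaleHom A (q ^ (2 * (i : ℤ) - N))))

/-- The pairwise factors of the bracket of `X(u)`, in the slots in which they are inverse to the
pairwise factors of the bracket of `S(u)` up to conjugation. -/
noncomputable def dualPairFactor (N : ℕ) (A : Type*) [Ring A] [Algebra ℂ A] (q : ℂ)
    (i j : Fin N) : Matrix (Fin N → Fin N) (Fin N → Fin N) (PowerSeries A) :=
  onSlots i j (scalarMatrix A (rBarT N q⁻¹
    ((q⁻¹ ^ (2 * N)) • (q ^ (2 * ((i : ℕ) + j)) • (PowerSeries.X ^ 2 : PowerSeries ℂ)))))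

theorem bracketFactor_mul_dual (hq : q ≠ 0) (hr : r ≠ 0)
    {S : Matrix (Fin N) (Fin N) (PowerSeries A)} (hS : IsUnit (S.map (dilate (q ^ (-(N : ℤ))))))
    (i : Fin N) : bracketFactor q N S i *
      twistHom (cDiag_ne_zero hr) (dualFactor q (xMatrix q r S) i) = 1 := by
  rw [bracketFactor, dualFactor, twistHom_onSlot, ← onSlot_mul, dilate_zpow, neg_mul, neg_neg,
    map_scaleHom_mul_twist_xMatrix hq hr hS, onSlot_one]

theorem scalarMatrix_one {ι : Type*} [DecidableEq ι] :
    scalarMatrix A (1 : Matrix ι ι (PowerSeries ℂ)) = 1 :=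
  Matrix.map_one _ (map_zero _) (map_one _)

theorem rBarTOn_mul_dual (hq : q ≠ 0) (hr : r ≠ 0) (hrq : r ^ 2 = -q) {i j : Fin N}
    (hij : i ≠ j) : rBarTOn N N A q i j *
      twistHom (cDiag_ne_zero hr) (dualPairFactor N A q j i) = 1 := by
  have h := rBarT_mul_twist (N := N) hq hrq
    (q ^ (2 * ((i : ℕ) + j)) • (PowerSeries.X ^ 2 : PowerSeries ℂ)) (by
      rw [Algebra.smul_def]
      simp)
  rw [rBarTOn_eq, dualPairFactor, twistHom_onSlots _ hij.symm, onSlots_flip j i,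
    ← onSlots_mul hij, ← onSlots_one i j]
  congr 1
  rw [← scalarMatrix_one, ← h, scalarMatrix_mul]
  congr 1
  ext1 a b
  simp only [Matrix.of_apply, Matrix.submatrix_apply, scalarMatrix, Matrix.map_apply, map_smul_algebraMap, Prod.fst_swap,
    Prod.snd_swap, add_comm (j : ℕ)]

theorem rBarT_map_scaleHom (c : ℂ) {x : PowerSeries ℂ} (hx : PowerSeries.constantCoeff x = 0) :
    (rBarT N q x).map (scaleHom ℂ c) = rBarT N q (scaleHom ℂ c x) := by
  have hc : ∀ f : PowerSeries ℂ, PowerSeries.constantCoeff (scaleHom ℂ c f) =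
      PowerSeries.constantCoeff f := fun f => by
    rw [← PowerSeries.coeff_zero_eq_constantCoeff_apply, coeff_scaleHom]
    simp
  have h : scaleHom ℂ c (x - 1)⁻¹ = (scaleHom ℂ c x - 1)⁻¹ := by
    rw [PowerSeries.eq_inv_iff_mul_eq_one (by simp [hc, hx])]
    have h := congrArg (scaleHom ℂ c) (PowerSeries.inv_mul_cancel (x - 1) (by simp [hx]))
    rwa [map_mul, map_sub, map_one] at h
  have e : rMatrix N q (scaleHom ℂ c x) 1 = (rMatrix N q x 1).map (scaleHom ℂ c) := by
    rw [rMatrix_map, map_one]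
  ext1 a b
  rw [rBarT, rBarT, ← h, e]
  simp [partialTranspose]

theorem scalarMatrix_map_scaleHom {ι : Type*} (c : ℂ) (M : Matrix ι ι (PowerSeries ℂ)) :
    (scalarMatrix A M).map (scaleHom A c) = scalarMatrix A (M.map (scaleHom ℂ c)) := by
  ext1 a b
  exact scaleHom_map c (M a b)

/-- Write `N = m + k`. The dual factor at position `N - 1 - i` carries the exponent `2 (N - 1 - i) -
N = (N - 2) - 2 i`. As `i` grows it follows the spectral shifts of a `q⁻¹`-bracket, with overall
dilation `q^{2-N}`. The pair factors shift consistently: `-2N + 2 (2N - 2 - i - j) = 2 (N - 2) - 2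
(i + j)`. -/
theorem pairProd_dual (hq : q ≠ 0) (X : Matrix (Fin (m + k)) (Fin (m + k)) (PowerSeries A)) :
    pairProd (dualFactor q X) (dualPairFactor (m + k) A q)
        ((List.finRange k).map (Fin.natAdd m)).reverse =
      embed (fun i : Fin k => Fin.natAdd m i.rev)
        ((bracket q⁻¹ k X).map (dilate (q ^ (2 - ((m + k : ℕ) : ℤ))))) := by
  have he := natAdd_rev_injective (m := m) (k := k)
  have hs : ∀ i : Fin k, dualFactor q X (Fin.natAdd m i.rev) =
      embedHom he ((scaleHom A (q ^ (-(2 - ((m + k : ℕ) : ℤ))))).toRingHom.mapMatrix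
        (bracketFactor q⁻¹ k X i)) := by
    intro i
    change _ = embed _ ((bracketFactor q⁻¹ k X i).map (scaleHom A _))
    rw [bracketFactor, onSlot_map _ _ _ (map_zero _), embed_onSlot he, dualFactor]
    congr 1
    ext1 a b
    simp only [Matrix.map_apply]
    rw [dilate_zpow, scaleHom_scaleHom, inv_zpow', ← zpow_add₀ hq]
    congr 3
    rw [Fin.val_natAdd, Fin.val_rev]
    have := i.isLt
    omega
  have hρ : ∀ i j : Fin k, dualPairFactor (m + k) A q (Fin.natAdd m i.rev) (Fin.natAdd m j.rev) =
      embedHom he ((scaleHom A (q ^ (-(2 - ((m + k : ℕ) : ℤ))))).toRingHom.mapMatrix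
        (rBarTOn (m + k) k A q⁻¹ i j)) := by
    intro i j
    change _ = embed _ ((rBarTOn (m + k) k A q⁻¹ i j).map (scaleHom A _))
    rw [rBarTOn_eq, onSlots_map _ _ _ _ (map_zero _), embed_onSlots he, dualPairFactor,
      scalarMatrix_map_scaleHom, rBarT_map_scaleHom]
    · congr 3
      rw [map_smul, map_pow, scaleHom_X, smul_pow, smul_smul, smul_smul]
      congr 1
      simp only [← zpow_natCast, inv_zpow', ← zpow_mul, ← zpow_add₀ hq]
      congr 1
      rw [Fin.val_natAdd, Fin.val_rev, Fin.val_natAdd, Fin.val_rev]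
      have := i.isLt
      have := j.isLt
      omega
    · rw [Algebra.smul_def]
      simp
  rw [← List.map_reverse, List.finRange_reverse, List.map_map, pairProd_map, dilate_zpow,
    bracket_eq_pairProd]
  change _ = embedHom he ((scaleHom A _).toRingHom.mapMatrix _)
  rw [map_pairProd, map_pairProd]
  exact pairProd_congr (List.nodup_finRange k) hs fun i j _ => hρ i j

/-- A nonzero entry of the antisymmetrizer joins sequences that are permutations of each other.
These have equal weights, so on a diagonal entry the conjugation cancels. -/
theorem seriesAntisymmetrizer_mul_twistHom {c : Fin N → ℂ} (hc : ∀ i, c i ≠ 0)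
    (V : Matrix (Fin m → Fin N) (Fin m → Fin N) (PowerSeries A)) (t : Fin m → Fin N) :
    (seriesAntisymmetrizer N m A q * twistHom hc V) t t =
      (seriesAntisymmetrizer N m A q * V) t t := by
  simp only [Matrix.mul_apply]
  refine Finset.sum_congr rfl fun a _ => ?_
  by_cases h : antisymmetrizer N m q t a = 0
  · simp [seriesAntisymmetrizer, h]
  · obtain ⟨σ, hσ⟩ := exists_perm_of_antisymmetrizer_ne_zero h
    rw [twistHom_apply, hσ, weight_comp_perm, div_self (weight_ne_zero hc a), one_smul]

theorem factorial_smul_mul_embed_castAdd (hq : q ≠ 0) {f : Fin m → Fin N} {g : Fin k → Fin N}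
    (hfg : Function.Injective (Fin.append f g))
    (Y : Matrix (Fin m → Fin N) (Fin m → Fin N) (PowerSeries A)) :
    ((m + k).factorial : ℂ) • (seriesAntisymmetrizer N (m + k) A q * embed (Fin.castAdd k) Y)
        (Fin.append f g) (Fin.append f g) =
      (m.factorial : ℂ) • (seriesAntisymmetrizer N m A q * Y) f f := by
  have hg : Function.Injective g := fun i j h => by
    simpa using @hfg (Fin.natAdd m i) (Fin.natAdd m j) (by simpa using h)
  rw [mul_embed_apply (Fin.castAdd_injective m k), Matrix.mul_apply, Finset.smul_sum,
    Finset.smul_sum]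
  refine Finset.sum_congr rfl fun J _ => ?_
  have hc : Fin.append f g ∘ Fin.castAdd k = f := by
    ext i; simp
  rw [extend_castAdd, hc]
  simp only [seriesAntisymmetrizer, Matrix.map_apply, ← Algebra.smul_def, smul_smul]
  rw [antisymmetrizer_append hq hfg (Or.inr rfl), factorial_mul_antisymmetrizer_self hg, mul_one]

/-- `A_N^q` restricted to the last slots is `A_k^q`; reading these slots backwards turns it into
`A_k^{q⁻¹}` by `antisymmetrizer_inv_rev`. -/
theorem factorial_smul_mul_embed_natAdd_rev (hq : q ≠ 0) {f : Fin m → Fin N} {g : Fin k → Fin N}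
    (hfg : Function.Injective (Fin.append f g))
    (Y : Matrix (Fin k → Fin N) (Fin k → Fin N) (PowerSeries A)) :
    ((m + k).factorial : ℂ) • (seriesAntisymmetrizer N (m + k) A q *
        embed (fun i : Fin k => Fin.natAdd m i.rev) Y) (Fin.append f g) (Fin.append f g) =
      (k.factorial : ℂ) • (seriesAntisymmetrizer N k A q⁻¹ * Y) (g ∘ Fin.rev) (g ∘ Fin.rev) := by
  have hf : Function.Injective f := fun i j h => by
    simpa using @hfg (Fin.castAdd k i) (Fin.castAdd k j) (by simpa using h)
  rw [mul_embed_apply natAdd_rev_injective, Matrix.mul_apply, Finset.smul_sum,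
    Finset.smul_sum]
  refine Finset.sum_congr rfl fun K _ => ?_
  have hc : Fin.append f g ∘ (fun i : Fin k => Fin.natAdd m i.rev) = g ∘ Fin.rev := by
    ext i; simp
  have hK : (K ∘ Fin.rev) ∘ Fin.rev = K := by
    ext i; simp
  rw [extend_natAdd_rev, hc]
  simp only [seriesAntisymmetrizer, Matrix.map_apply, ← Algebra.smul_def, smul_smul]
  rw [antisymmetrizer_append hq hfg (Or.inl rfl), factorial_mul_antisymmetrizer_self hf, one_mul,
    ← antisymmetrizer_inv_rev, hK]

theorem crossProd_fixesVector {f : Fin m → Fin N} {g : Fin k → Fin N}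
    (hfg : Function.Injective (Fin.append f g)) :
    FixesVector (crossProd (rBarTOn N (m + k) A q) ((List.finRange m).map (Fin.castAdd k))
      ((List.finRange k).map (Fin.natAdd m))) (Fin.append f g) := by
  refine FixesVector.list_prod fun i hi => FixesVector.list_prod fun j hj =>
    rBarTOn_fixesVector fun h => ?_
  obtain ⟨i, -, rfl⟩ := List.mem_map.1 hi
  obtain ⟨j, -, rfl⟩ := List.mem_map.1 hj
  have := congrArg Fin.val (hfg h)
  simp at this
  omega

theorem pairProd_castAdd (S : Matrix (Fin N) (Fin N) (PowerSeries A)) :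
    pairProd (bracketFactor q (m + k) S) (rBarTOn N (m + k) A q)
        ((List.finRange m).map (Fin.castAdd k)) =
      embed (Fin.castAdd k) (bracket q m S) := by
  have he := Fin.castAdd_injective m k
  rw [pairProd_map, bracket_eq_pairProd]
  change _ = embedHom he _
  rw [map_pairProd]
  refine pairProd_congr (List.nodup_finRange m) (fun i => ?_) fun i j _ => ?_
  · exact (embed_onSlot he _ _).symm
  · exact (embed_onSlots he _ _ _).symm

theorem sklyaninMinor_eq_sdet_mul (hq : q ≠ 0) (hq2 : q ^ 2 ≠ 1) (hr : r ^ 2 = -q)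
    {S : Matrix (Fin (m + k)) (Fin (m + k)) (PowerSeries A)} (hS : ReflectionRelation q S)
    (hU : IsUnit (S.map (dilate (q ^ (-((m + k : ℕ) : ℤ))))))
    {f : Fin m → Fin (m + k)} {g : Fin k → Fin (m + k)}
    (hfg : Function.Injective (Fin.append f g)) :
    sklyaninMinor q S f f = sdet q S * dilate (q ^ (2 - ((m + k : ℕ) : ℤ)))
      (sklyaninMinor q⁻¹ (xMatrix q r S) (g ∘ Fin.rev) (g ∘ Fin.rev)) := by
  have hr0 : r ≠ 0 := by
    rintro rfl
    apply hq
    simpa [eq_comm] using hr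
  set X := xMatrix q r S with hX
  set t := Fin.append f g with ht
  set Z := pairProd (bracketFactor q (m + k) S) (rBarTOn (m + k) (m + k) A q)
    ((List.finRange k).map (Fin.natAdd m)) with hZ
  set V := pairProd (dualFactor q X) (dualPairFactor (m + k) A q)
        ((List.finRange k).map (Fin.natAdd m)).reverse with hV
  have hnodup : ((List.finRange m).map (Fin.castAdd k) ++
      (List.finRange k).map (Fin.natAdd m)).Nodup := by
    rw [← finRange_add]
    exact List.nodup_finRange _
  have hdual : DisjointCommute (fun i => twistHom (cDiag_ne_zero hr0) (dualFactor q X i))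
      (fun i j => twistHom (cDiag_ne_zero hr0) (dualPairFactor (m + k) A q i j)) :=
    (disjointCommute_onSlot_onSlots _ _).map _
  have hdc : DisjointCommute (bracketFactor q (m + k) S) (rBarTOn (m + k) (m + k) A q) :=
    disjointCommute_onSlot_onSlots _ _
  have hZV : Z * twistHom (cDiag_ne_zero hr0) V = 1 := by
    rw [hZ, hV, map_pairProd]
    exact pairProd_mul_reverse hdual (List.nodup_append.1 hnodup).2.1
      (fun i => bracketFactor_mul_dual hq hr0 hU i)
      fun i j hij => rBarTOn_mul_dual hq hr0 hr hij
  -- The last `k` slots of the bracket form its rightmost part, so right multiplication by the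
  -- inverse removes them.
  have hB : bracket q (m + k) S * twistHom (cDiag_ne_zero hr0) V =
      embed (Fin.castAdd k) (bracket q m S) *
        crossProd (rBarTOn (m + k) (m + k) A q) ((List.finRange m).map (Fin.castAdd k))
          ((List.finRange k).map (Fin.natAdd m)) := by
    rw [bracket_eq_pairProd, finRange_add,
      pairProd_append hdc _ _ hnodup, mul_assoc, hZV, mul_one,
      pairProd_castAdd]
  -- On the column `t` the cross factors may be inserted freely. This restores the full bracket,
  -- whose product with `A_N` is `sdet q S` times `A_N`.
  have h1 : (seriesAntisymmetrizer (m + k) (m + k) A q *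
      embed (Fin.castAdd k) (bracket q m S)) t t =
      sdet q S * (seriesAntisymmetrizer (m + k) (m + k) A q * V) t t := by
    rw [← (crossProd_fixesVector (A := A) (q := q) hfg).mul_apply (_ * _) t, mul_assoc, ← hB, ← mul_assoc,
      Matrix.mul_apply]
    simp only [antisymmetrizer_mul_bracket_apply hq hq2 hS, mul_assoc]
    rw [← Finset.mul_sum, ← Matrix.mul_apply, seriesAntisymmetrizer_mul_twistHom]
  have h2 := congrArg (fun x => ((m + k).factorial : ℂ) • x) h1
  rw [← mul_smul_comm, hV, pairProd_dual hq, factorial_smul_mul_embed_castAdd hq hfg,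
    factorial_smul_mul_embed_natAdd_rev hq hfg] at h2
  rw [sklyaninMinor_eq, h2, sklyaninMinor_eq]
  congr 1
  simp only [dilate_zpow, map_smul]
  congr 1
  simp only [Matrix.mul_apply, map_sum, map_mul, Matrix.map_apply]
  refine Finset.sum_congr rfl fun a _ => ?_
  congr 1
  exact ((scaleHom A _).commutes _).symm

end JacobiIdentity

end SklyaninJacobi

namespace SklyaninJacobi

/-! ### The reflection relation for `X(u)` -/

section Dual

variable {A : Type*} [Ring A] [Algebra ℂ A] {q r : ℂ} {N : ℕ}

theorem twistHom_injective {B : Type*} [Ring B] [Algebra ℂ B] {n : ℕ} {c : Fin N → ℂ}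
    (hc : ∀ i, c i ≠ 0) :
    Function.Injective (twistHom hc : Matrix (Fin n → Fin N) (Fin n → Fin N) B → _) := by
  intro M M' h
  ext1 a b
  exact (IsUnit.mk0 _ (div_ne_zero (weight_ne_zero hc a) (weight_ne_zero hc b))).smul_left_cancel.1
    (congrFun (congrFun h a) b)

/-- `R` preserves weights and therefore commutes with `C ⊗ C`. -/
theorem twistHom_reflR {c : Fin N → ℂ} (hc : ∀ i, c i ≠ 0) :
    twistHom hc (reflR N A q) = reflR N A q := by
  ext1 a b
  rw [twistHom_apply]
  simp only [reflR, onSlots, Matrix.map_apply]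
  have e : ∀ k : Fin 2, k ≠ 0 → k ≠ 1 → a k = b k := by
    intro k h0 h1
    fin_cases k
    · exact absurd rfl h0
    · exact absurd rfl h1
  rw [if_pos e, rMatrix_eq]
  by_cases h1 : a 0 = b 0 ∧ a 1 = b 1
  · simp [weight, Fin.prod_univ_two, h1, hc]
  · by_cases h2 : a 0 = b 1 ∧ a 1 = b 0
    · simp [weight, Fin.prod_univ_two, h2, hc, mul_comm (c (b 1))]
    · simp [h1, h2]

theorem injective_one_zero : Function.Injective (![1, 0] : Fin 2 → Fin 2) :=
  injective_pair (by decide)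

/-- Exchange of the two variables and of the two tensor factors, together with a rescaling of the
variables. -/
noncomputable def flipScaleHom (N : ℕ) (A : Type*) [Ring A] [Algebra ℂ A] (c : ℂ) :
    Matrix (Fin 2 → Fin N) (Fin 2 → Fin N) (MvPowerSeries (Fin 2) A) →+*
      Matrix (Fin 2 → Fin N) (Fin 2 → Fin N) (MvPowerSeries (Fin 2) A) :=
  (embedHom injective_one_zero).comp (swapScaleHom A c).toRingHom.mapMatrix

theorem flipScaleHom_apply (c : ℂ)
    (M : Matrix (Fin 2 → Fin N) (Fin 2 → Fin N) (MvPowerSeries (Fin 2) A)) :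
    flipScaleHom N A c M = embed ![1, 0] (M.map (swapScaleHom A c)) := rfl

theorem map_swapScaleHom_map (c : ℂ) {ι : Type*} (M : Matrix ι ι (MvPowerSeries (Fin 2) ℂ)) :
    (M.map (MvPowerSeries.map (algebraMap ℂ A))).map (swapScaleHom A c) =
      (M.map (swapScaleHom ℂ c)).map (MvPowerSeries.map (algebraMap ℂ A)) := by
  ext1 a b
  exact swapScaleHom_map c (M a b)

theorem flipScaleHom_onSlot (c : ℂ) (p k : Fin 2) (S : Matrix (Fin N) (Fin N) (PowerSeries A)) :
    flipScaleHom N A c (onSlot p (S.map (inVar k))) =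
      onSlot (Equiv.swap 0 1 p) ((S.map (scaleHom A c)).map (inVar (Equiv.swap 0 1 k))) := by
  rw [flipScaleHom_apply, onSlot_map _ _ _ (map_zero _), embed_onSlot injective_one_zero]
  have : (![1, 0] : Fin 2 → Fin 2) p = Equiv.swap 0 1 p := by
    fin_cases p <;> rfl
  rw [this]
  congr 1
  ext1 a b
  exact swapScaleHom_inVar c k (S a b)

theorem flipScaleHom_reflR (c : ℂ) :
    flipScaleHom N A c (reflR N A q) = (-c) • reflR N A q⁻¹ := by
  rw [flipScaleHom_apply, reflR, onSlots_map _ _ _ _ (map_zero _), embed_onSlots injective_one_zero,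
    map_swapScaleHom_map, rMatrix_map, swapScaleHom_X, swapScaleHom_X]
  simp only [Matrix.cons_val, Equiv.swap_apply_left, Equiv.swap_apply_right]
  rw [onSlots_flip, reflR]
  ext1 a b
  simp only [onSlots, Matrix.smul_apply, Matrix.submatrix_apply, Matrix.map_apply,
    Prod.swap_prod_mk, smul_ite, smul_zero]
  refine if_congr Iff.rfl ?_ rfl
  rw [rMatrix_inv_flip, map_neg, neg_smul, smul_neg, neg_neg, Algebra.smul_def c (MvPowerSeries.X 0),
    Algebra.smul_def c (MvPowerSeries.X 1), rMatrix_smul, Matrix.smul_apply, smul_eq_mul,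
    ← Algebra.smul_def]
  exact map_smul (scalarHom (Fin 2) A) c _

theorem flipScaleHom_reflRt (c : ℂ) :
    flipScaleHom N A c (reflRt N A q) = onSlots 1 0 ((partialTranspose (rMatrix N q
      (c ^ 2 • (MvPowerSeries.X 0 * MvPowerSeries.X 1) : MvPowerSeries (Fin 2) ℂ) 1)).map
        (MvPowerSeries.map (algebraMap ℂ A))) := by
  have h : ∀ M : Matrix (Fin N × Fin N) (Fin N × Fin N) (MvPowerSeries (Fin 2) ℂ),
    (partialTranspose M).map (swapScaleHom ℂ c) = partialTranspose (M.map (swapScaleHom ℂ c)) :=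
      fun _ => rfl
  rw [flipScaleHom_apply, reflRt, onSlots_map _ _ _ _ (map_zero _),
    embed_onSlots injective_one_zero, map_swapScaleHom_map, h, rMatrix_map, map_mul,
    swapScaleHom_X, swapScaleHom_X, map_one (swapScaleHom ℂ c), smul_mul_smul_comm, ← pow_two]
  simp only [Matrix.cons_val, Equiv.swap_apply_left, Equiv.swap_apply_right]
  rw [mul_comm (MvPowerSeries.X 1)]

theorem onSlots_one_zero_mul_twist (hq : q ≠ 0) (hr0 : r ≠ 0) (hr : r ^ 2 = -q)
    (x y : MvPowerSeries (Fin 2) ℂ) (hy : y = (q⁻¹ ^ (2 * N)) • x) :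
    (onSlots 1 0 ((partialTranspose (rMatrix N q x 1)).map (MvPowerSeries.map (algebraMap ℂ A))) :
        Matrix (Fin 2 → _) _ _) *
      twistHom (cDiag_ne_zero hr0) (onSlots 0 1 ((partialTranspose (rMatrix N q⁻¹ y 1)).map
        (MvPowerSeries.map (algebraMap ℂ A)))) =
      MvPowerSeries.map (algebraMap ℂ A) ((x - 1) * (y - 1)) • 1 := by
  have h := crossing_mul_twist (N := N) hq hr x y hy
  rw [twistHom_onSlots _ (by decide), onSlots_flip 0 1, ← onSlots_mul (by decide)]
  have e1 : (Matrix.of fun a b : Fin N × Fin N =>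
      ((cDiag N r a.1 a.1 * cDiag N r a.2 a.2) / (cDiag N r b.1 b.1 * cDiag N r b.2 b.2)) •
        ((partialTranspose (rMatrix N q⁻¹ y 1)).map (MvPowerSeries.map (algebraMap ℂ A))) a b).submatrix
          Prod.swap Prod.swap =
      (Matrix.of fun a b : Fin N × Fin N =>
        ((cDiag N r a.2 a.2 * cDiag N r a.1 a.1) / (cDiag N r b.2 b.2 * cDiag N r b.1 b.1)) •
          partialTranspose (rMatrix N q⁻¹ y 1) a.swap b.swap).map
            (MvPowerSeries.map (algebraMap ℂ A)) := by
    ext1 a b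
    exact (map_smul (scalarHom (Fin 2) A) _ _).symm
  rw [e1, ← Matrix.map_mul, h, ← onSlots_one (1 : Fin 2) 0, ← onSlots_smul]
  congr 1
  ext1 a b
  simp [Matrix.one_apply, apply_ite (MvPowerSeries.map (algebraMap ℂ A))]

theorem reflectionRelation_xMatrix (hq : q ≠ 0) (hr : r ^ 2 = -q)
    {S : Matrix (Fin N) (Fin N) (PowerSeries A)} (hS : ReflectionRelation q S)
    (hU : IsUnit (S.map (dilate (q ^ (-(N : ℤ)))))) :
    ReflectionRelation q⁻¹ (xMatrix q r S) := by
  have hr0 : r ≠ 0 := by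
    rintro rfl
    apply hq
    simpa [eq_comm] using hr
  have hdil : (dilate (q ^ (-(N : ℤ))) : PowerSeries A → _) = scaleHom A (q ^ N) := by
    rw [dilate_zpow, neg_neg, zpow_natCast]
  set U := S.map (dilate (q ^ (-(N : ℤ)))) with hUdef
  set T := Ring.inverse U with hT
  have hUT : U * T = 1 := Ring.mul_inverse_cancel _ hU
  have hTU : T * U = 1 := Ring.inverse_mul_cancel _ hU
  have hmap : ∀ (k p : Fin 2) (V W : Matrix (Fin N) (Fin N) (PowerSeries A)), V * W = 1 →
      (onSlot p (V.map (inVar k)) : Matrix (Fin 2 → _) _ _) * onSlot p (W.map (inVar k)) = 1 := by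
    intro k p V W h
    rw [← onSlot_mul, ← onSlot_one p]
    congr 1
    have := congrArg (inVarHom A k).toRingHom.mapMatrix h
    rwa [map_mul, map_one] at this
  set w : MvPowerSeries (Fin 2) ℂ := MvPowerSeries.X 0 * MvPowerSeries.X 1 with hw
  set x : MvPowerSeries (Fin 2) ℂ := (q ^ N) ^ 2 • w with hx
  set Rt : Matrix (Fin 2 → Fin N) (Fin 2 → Fin N) (MvPowerSeries (Fin 2) A) :=
    onSlots 1 0 ((partialTranspose (rMatrix N q x 1)).map (MvPowerSeries.map (algebraMap ℂ A)))
    with hRt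
  have hwx : w = (q⁻¹ ^ (2 * N)) • x := by
    rw [hx, smul_smul, ← pow_mul, mul_comm N 2, ← mul_pow, inv_mul_cancel₀ hq, one_pow, one_smul]
  set W := twistHom (cDiag_ne_zero hr0) (reflRt N A q⁻¹) with hW
  -- Crossing with `w = q^{-2N} x`: rescaling the variables by `q^N` produced `x = q^{2N} w`, so the
  -- `q⁻¹`-matrix has exactly the argument `1/uv`.
  have hRW : Rt * W = MvPowerSeries.map (algebraMap ℂ A) ((x - 1) * (w - 1)) • 1 :=
    onSlots_one_zero_mul_twist hq hr0 hr x w hwx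
  have hδ : IsUnit (MvPowerSeries.map (algebraMap ℂ A) ((x - 1) * (w - 1))) := by
    refine IsUnit.map _ ?_
    rw [MvPowerSeries.isUnit_iff_constantCoeff]
    rw [hx, Algebra.smul_def, hw]
    simp
  set δ := MvPowerSeries.map (algebraMap ℂ A) ((x - 1) * (w - 1)) with hδdef
  have hcomm : ∀ M M' : Matrix (Fin 2 → Fin N) (Fin 2 → Fin N) (MvPowerSeries (Fin 2) A),
      M * (δ • M') = δ • (M * M') := by
    intro M M'
    ext1 a b
    simp only [Matrix.mul_apply, Matrix.smul_apply, smul_eq_mul, Finset.mul_sum, ← mul_assoc]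
    refine Finset.sum_congr rfl fun d _ => ?_
    rw [(commute_mvPowerSeries_map _ (M a d)).eq]
  -- After this exchange the relation reads `R U1 Rt U0 = U0 Rt U1 R`, with `R` for `q⁻¹` and `U`
  -- the matrix `S(q^{-N}u)`. Inverting the `U` factors and `Rt` gives the relation for the
  -- inverses.
  have key := congrArg (flipScaleHom N A (q ^ N)) hS
  simp only [reflLeft, reflRight, map_mul, flipScaleHom_onSlot, flipScaleHom_reflR,
    flipScaleHom_reflRt, Equiv.swap_apply_left, Equiv.swap_apply_right] at key
  rw [← hdil, ← hUdef, ← hw, ← hx, ← hRt] at key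
  simp only [Matrix.smul_mul, Matrix.mul_smul] at key
  replace key := (IsUnit.mk0 _ (neg_ne_zero.2 (pow_ne_zero N hq))).smul_left_cancel.1 key
  set R := reflR N A q⁻¹ with hR
  set U0 : Matrix (Fin 2 → Fin N) (Fin 2 → Fin N) (MvPowerSeries (Fin 2) A) :=
    onSlot 0 (U.map (inVar 0)) with hU0
  set U1 : Matrix (Fin 2 → Fin N) (Fin 2 → Fin N) (MvPowerSeries (Fin 2) A) :=
    onSlot 1 (U.map (inVar 1)) with hU1
  set T0 : Matrix (Fin 2 → Fin N) (Fin 2 → Fin N) (MvPowerSeries (Fin 2) A) :=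
    onSlot 0 (T.map (inVar 0)) with hT0
  set T1 : Matrix (Fin 2 → Fin N) (Fin 2 → Fin N) (MvPowerSeries (Fin 2) A) :=
    onSlot 1 (T.map (inVar 1)) with hT1
  have hUT0 : U0 * T0 = 1 := hmap 0 0 _ _ hUT
  have hUT1 : U1 * T1 = 1 := hmap 1 1 _ _ hUT
  have hTU0 : T0 * U0 = 1 := hmap 0 0 _ _ hTU
  have hTU1 : T1 * U1 = 1 := hmap 1 1 _ _ hTU
  -- A one-sided inverse suffices for matrices over the commutative ring of scalar series; the
  -- two-sided inverse is then transported to `A`.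
  have hWR : IsUnit Rt := by
    have h1 := crossing_mul_twist (N := N) hq hr x w hwx
    have h2 : IsUnit ((x - 1) * (w - 1)) := by
      rw [MvPowerSeries.isUnit_iff_constantCoeff, hx, Algebra.smul_def, hw]
      simp
    have h3 : IsUnit (partialTranspose (rMatrix N q x 1)) := by
      obtain ⟨v, hv⟩ := h2.exists_right_inv
      have h3 := congrArg (v • ·) h1
      simp only [← Matrix.mul_smul, smul_smul, mul_comm v, hv, one_smul] at h3
      exact IsUnit.of_mul_eq_one _ h3
    obtain ⟨⟨P, P', hPP, hPP'⟩, h4⟩ := h3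
    simp only at h4
    subst h4
    refine ⟨⟨Rt, onSlots 1 0 (P'.map (MvPowerSeries.map (algebraMap ℂ A))), ?_, ?_⟩, rfl⟩
    · rw [hRt, ← onSlots_mul (by decide), ← Matrix.map_mul, hPP,
        Matrix.map_one _ (map_zero _) (map_one _), onSlots_one]
    · rw [hRt, ← onSlots_mul (by decide), ← Matrix.map_mul, hPP',
        Matrix.map_one _ (map_zero _) (map_one _), onSlots_one]
  have hM2 : IsUnit (U0 * Rt * U1) :=
    (IsUnit.mul ⟨⟨U0, T0, hUT0, hTU0⟩, rfl⟩ hWR).mul ⟨⟨U1, T1, hUT1, hTU1⟩, rfl⟩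
  have hgoal : T1 * W * T0 * R = R * T0 * W * T1 := by
    refine hM2.mul_left_cancel ?_
    calc U0 * Rt * U1 * (T1 * W * T0 * R)
        = U0 * Rt * (U1 * T1) * W * T0 * R := by simp only [mul_assoc]
      _ = U0 * (Rt * W) * T0 * R := by rw [hUT1, mul_one]; simp only [mul_assoc]
      _ = δ • R := by
        rw [hRW, hcomm, mul_one, Matrix.smul_mul, hUT0, Matrix.smul_mul, one_mul]
      _ = R * (U1 * (Rt * W) * T1) := by
        rw [hRW, hcomm, mul_one, Matrix.smul_mul, hUT1, hcomm, mul_one]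
      _ = R * U1 * Rt * (U0 * T0) * W * T1 := by rw [hUT0, mul_one]; simp only [mul_assoc]
      _ = R * U1 * Rt * U0 * (T0 * W * T1) := by simp only [mul_assoc]
      _ = U0 * Rt * U1 * (R * T0 * W * T1) := by rw [key]; simp only [mul_assoc]
  have htw : ∀ p k : Fin 2, twistHom (cDiag_ne_zero hr0) (onSlot p ((xMatrix q r S).map (inVar k)) :
      Matrix (Fin 2 → _) _ _) = onSlot p (T.map (inVar k)) := by
    intro p k
    rw [twistHom_onSlot]
    congr 1
    ext1 a b
    rw [Matrix.of_apply, Matrix.map_apply, Matrix.map_apply, xMatrix_apply hr0, ← coe_inVarHom,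
      map_smul, smul_smul, div_mul_div_cancel₀ (cDiag_ne_zero hr0 b),
      div_self (cDiag_ne_zero hr0 a), one_smul]
  refine twistHom_injective (cDiag_ne_zero hr0) ?_
  simp only [reflLeft, reflRight, map_mul, htw, twistHom_reflR]
  exact hgoal.symm

end Dual

end SklyaninJacobi

namespace SklyaninJacobi

/-! ### Invertibility of matrices of series -/

section Invertible

variable {ι R : Type*} [Fintype ι] [DecidableEq ι] [Ring R]

/-- A power series with matrix coefficients as a matrix of power series. -/
noncomputable def matrixOfSeries (ι R : Type*) [Fintype ι] [DecidableEq ι] [Ring R] :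
    PowerSeries (Matrix ι ι R) →* Matrix ι ι (PowerSeries R) where
  toFun f := Matrix.of fun i j => PowerSeries.mk fun n => PowerSeries.coeff n f i j
  map_one' := by
    ext i j n
    rw [Matrix.of_apply, PowerSeries.coeff_mk, PowerSeries.coeff_one, Matrix.one_apply]
    by_cases h2 : i = j
    · subst h2
      rw [if_pos rfl, PowerSeries.coeff_one]
      split_ifs <;> simp
    · rw [if_neg h2]
      split_ifs <;> simp [h2]
  map_mul' f g := by
    ext i j n
    simp only [Matrix.of_apply, PowerSeries.coeff_mk, Matrix.mul_apply, PowerSeries.coeff_mul,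
      map_sum, Matrix.sum_apply]
    exact Finset.sum_comm

/-- Matrices of series are series with matrix coefficients, and such a series is invertible as soon
as its constant term is. -/
theorem isUnit_of_isUnit_constantCoeff (M : Matrix ι ι (PowerSeries R))
    (h : IsUnit (M.map PowerSeries.constantCoeff)) : IsUnit M := by
  set f : PowerSeries (Matrix ι ι R) :=
    PowerSeries.mk fun n => M.map (PowerSeries.coeff n) with hf
  have hfM : matrixOfSeries ι R f = M := by
    ext i j n
    simp [matrixOfSeries, hf]
  rw [← hfM]
  refine IsUnit.map _ (PowerSeries.isUnit_iff_constantCoeff.2 ?_)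
  have : PowerSeries.constantCoeff f = M.map PowerSeries.constantCoeff := by
    rw [← PowerSeries.coeff_zero_eq_constantCoeff_apply, hf, PowerSeries.coeff_mk]
    ext i j
    simp
  rwa [this]

/-- Each factor lowers the height by at least one, so a power exceeding the maximal height has no
nonzero entry. -/
theorem isNilpotent_of_height (M : Matrix ι ι R) (h : ι → ℕ) (hM : ∀ i j, M i j ≠ 0 → h j < h i) :
    IsNilpotent M := by
  have key : ∀ n i j, (M ^ n) i j ≠ 0 → h j + n ≤ h i := by
    intro n
    induction n with
    | zero =>
      intro i j hij
      rw [pow_zero] at hij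
      have : i = j := by
        by_contra hne
        exact hij (Matrix.one_apply_ne hne)
      simp [this]
    | succ n ih =>
      intro i j hij
      rw [pow_succ, Matrix.mul_apply] at hij
      obtain ⟨k, -, hk⟩ := Finset.exists_ne_zero_of_sum_ne_zero hij
      have h1 := ih i k (left_ne_zero_of_mul hk)
      have h2 := hM k j (right_ne_zero_of_mul hk)
      omega
  refine ⟨Finset.univ.sup h + 1, ?_⟩
  ext i j
  by_contra hij
  have h1 := key _ i j hij
  have h2 := Finset.le_sup (f := h) (Finset.mem_univ i)
  omega

theorem isUnit_of_blockTriangular {κ : Type*} [Fintype κ] [DecidableEq κ] {n : ℕ}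
    (M : Matrix (κ × Fin n) (κ × Fin n) R)
    (hM : ∀ a b : κ × Fin n, a.2 < b.2 → M a b = 0)
    (hD : ∀ k, IsUnit (Matrix.of fun i j => M (i, k) (j, k))) : IsUnit M := by
  set d : Fin n → Matrix κ κ R := fun k => Matrix.of fun i j => M (i, k) (j, k) with hd
  obtain ⟨u, hu⟩ : IsUnit d := Pi.isUnit_iff.2 hD
  set e := (↑u⁻¹ : Fin n → Matrix κ κ R)
  have hDe : Matrix.blockDiagonal d * Matrix.blockDiagonal e = 1 := by
    rw [← hu, ← Matrix.blockDiagonal_one, ← Units.mul_inv u]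
    exact (Matrix.blockDiagonal_mul _ _).symm
  have hDu : IsUnit (Matrix.blockDiagonal d) :=
    (IsUnit.map (Matrix.blockDiagonalRingHom κ (Fin n) R) ⟨u, hu⟩)
  -- The correction to `1` is strictly lower triangular in the block index, hence nilpotent.
  have hMD : M = Matrix.blockDiagonal d *
      (1 + Matrix.blockDiagonal e * (M - Matrix.blockDiagonal d)) := by
    rw [mul_add, ← mul_assoc, hDe, one_mul, mul_one, add_sub_cancel]
  rw [hMD]
  refine hDu.mul (IsNilpotent.isUnit_one_add (isNilpotent_of_height _ (fun a => (a.2 : ℕ)) ?_))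
  intro a b hab
  rw [Matrix.mul_apply] at hab
  obtain ⟨c, -, hc⟩ := Finset.exists_ne_zero_of_sum_ne_zero hab
  have h1 := left_ne_zero_of_mul hc
  have h2 := right_ne_zero_of_mul hc
  rw [Matrix.blockDiagonal_apply] at h1
  have hac : a.2 = c.2 := by
    by_contra hne
    exact h1 (if_neg hne)
  rw [Matrix.sub_apply, Matrix.blockDiagonal_apply] at h2
  rw [hac, ← Fin.lt_def]
  by_contra hlt
  rcases (not_lt.1 hlt).lt_or_eq with hlt | heq
  · rw [hM _ _ hlt, if_neg hlt.ne, sub_zero] at h2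
    exact h2 rfl
  · rw [if_pos heq, hd] at h2
    apply h2
    obtain ⟨c1, c2⟩ := c
    obtain ⟨b1, b2⟩ := b
    simp only at heq
    subst heq
    simp

/-- The `2 × 2` blocks that occur in the symplectic case are invertible. -/
theorem isUnit_fin_two {A : Type*} [Ring A] [Algebra ℂ A] {q : ℂ} (hq : q ≠ 0) {a b c d β : A}
    (h1 : q ^ 2 • (a * b) = b * a) (h2 : d * a - q ^ 2 • (c * b) = algebraMap ℂ A (q ^ 3))
    (h3 : b * β = 1) (h4 : β * b = 1) : IsUnit !![a, b; c, d] := by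
  have h5 : β * a = (q⁻¹ ^ 2) • (a * β) := by
    have : a * β = q ^ 2 • (β * a) := by
      calc a * β = β * (b * a) * β := by rw [← mul_assoc, h4, one_mul]
        _ = q ^ 2 • (β * a * (b * β)) := by
          rw [← h1, mul_smul_comm, smul_mul_assoc]
          simp only [mul_assoc]
        _ = _ := by rw [h3, mul_one]
    rw [this, smul_smul, ← mul_pow, inv_mul_cancel₀ hq, one_pow, one_smul]
  have h6 : d * a = q ^ 3 • 1 + q ^ 2 • (c * b) := by
    rw [← Algebra.algebraMap_eq_smul_one, ← h2, sub_add_cancel]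
  have e1 : q⁻¹ ^ 2 * q⁻¹ * q ^ 3 = 1 := by field_simp
  have e2 : q⁻¹ ^ 2 * q⁻¹ * q ^ 2 = q⁻¹ := by field_simp
  have hd : ∀ x, d * (a * x) = q ^ 3 • x + q ^ 2 • (c * (b * x)) := fun x => by
    rw [← mul_assoc, h6, add_mul, smul_mul_assoc, smul_mul_assoc, one_mul, mul_assoc]
  -- A `q`-analogue of the adjugate divided by the determinant. The entry in the place of `-c` is
  -- expressed through `β` and the determinant relation, which avoids a commutation rule between `c`
  -- and `b`; similarly `b * (d * β)` replaces `d`.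
  refine ⟨⟨!![a, b; c, d], !![q⁻¹ • (b * (d * β)), -(q⁻¹ • b);
    β - (q⁻¹ ^ 2 * q⁻¹) • (a * (d * β)), (q⁻¹ ^ 2 * q⁻¹) • a], ?_, ?_⟩, rfl⟩
  · rw [Matrix.mul_fin_two, Matrix.one_fin_two]
    congr 1
    simp only [mul_sub, mul_smul_comm, mul_neg, hd, h6, h3, smul_add,
      smul_smul, e1, e2, one_smul]
    refine Matrix.of.symm.injective (funext fun i => funext fun j => ?_)
    have hab : a * (b * (d * β)) = q⁻¹ ^ 2 • (b * (a * (d * β))) := by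
      rw [← mul_assoc b a, ← h1, smul_mul_assoc, smul_smul, ← mul_pow, inv_mul_cancel₀ hq, one_pow,
        one_smul, mul_assoc]
    have hab' : a * b = q⁻¹ ^ 2 • (b * a) := by
      rw [← h1, smul_smul, ← mul_pow, inv_mul_cancel₀ hq, one_pow, one_smul]
    fin_cases i <;> fin_cases j <;> simp [hab, hab', smul_smul, mul_comm q⁻¹]
  · rw [Matrix.mul_fin_two, Matrix.one_fin_two]
    simp only [sub_mul, neg_mul, smul_mul_assoc, mul_assoc, h5, h4, mul_one, mul_smul_comm, hd,
      smul_add, smul_smul, mul_add]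
    refine Matrix.of.symm.injective (funext fun i => funext fun j => ?_)
    have e4 : q⁻¹ * ((q ^ 2)⁻¹ * q ^ 3) = 1 := by field_simp
    have e5 : q⁻¹ * ((q ^ 2)⁻¹ * q ^ 2) = q⁻¹ := by field_simp
    fin_cases i <;> fin_cases j <;> simp [e4, e5, h3]

end Invertible


/-! ### The constant term of the reflection relation -/

section ConstantTerm

variable {N : ℕ} {q : ℂ}

theorem sum_fin_two_fun {M : Type*} [AddCommMonoid M] (F : (Fin 2 → Fin N) → M) :
    ∑ c, F c = ∑ x, ∑ y, F ![x, y] := by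
  rw [← Equiv.sum_comp (finTwoArrowEquiv (Fin N)).symm, Fintype.sum_prod_type]
  rfl

theorem onSlot_zero_apply {B : Type*} [Zero B] (M : Matrix (Fin N) (Fin N) B) (x y z w : Fin N) :
    onSlot (0 : Fin 2) M ![x, y] ![z, w] = if y = w then M x z else 0 := by
  simp [onSlot, Fin.forall_fin_two]

theorem onSlot_one_apply {B : Type*} [Zero B] (M : Matrix (Fin N) (Fin N) B) (x y z w : Fin N) :
    onSlot (1 : Fin 2) M ![x, y] ![z, w] = if x = z then M y w else 0 := by
  simp [onSlot, Fin.forall_fin_two]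

theorem onSlots_pair_apply {B : Type*} [Zero B] (M : Matrix (Fin N × Fin N) (Fin N × Fin N) B)
    (x y z w : Fin N) :
    onSlots (0 : Fin 2) 1 M ![x, y] ![z, w] = M (x, y) (z, w) := by
  simp [onSlots, Fin.forall_fin_two]

variable {A : Type*} [Ring A] [Algebra ℂ A]

/-- Setting `v⁻¹ = 0` makes both R-matrices constant. The entry in row `(i, i)` and column `(i, j)`
then has a single term on each side: `R` and `R^t` each contribute `-q` on the left and `-1` on the
right. -/
theorem ReflectionRelation.constantCoeff_mul {S : Matrix (Fin N) (Fin N) (PowerSeries A)}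
    (hS : ReflectionRelation q S) {i j : Fin N} (hij : i < j) :
    q ^ 2 • (PowerSeries.constantCoeff (S i i) * PowerSeries.constantCoeff (S i j)) =
      PowerSeries.constantCoeff (S i j) * PowerSeries.constantCoeff (S i i) := by
  have h := congrArg PowerSeries.constantCoeff
    (congrFun (congrFun (evalVars_reflection hS ![1, 0]) ![i, i]) ![i, j])
  have hR1 : ∀ z w, rMatrix N q (0 : PowerSeries ℂ) 1 (i, i) (z, w) =
      if z = i then if w = i then -(algebraMap ℂ _ q) else 0 else 0 := by
    intro z w
    rw [← ite_and]
    by_cases hzw : z = i ∧ w = i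
    · simp [rMatrix, hzw, Algebra.smul_def]
    · rw [if_neg hzw, rMatrix, if_neg, if_neg]
      · rintro ⟨e1, e2⟩
        exact hzw ⟨e2.symm, e1.symm⟩
      · intro e
        rw [Prod.mk.injEq] at e
        exact hzw ⟨e.1.symm, e.2.symm⟩
  have hR2 : ∀ z w, rMatrix N q (0 : PowerSeries ℂ) 1 (z, w) (i, j) =
      if z = i then if w = j then -1 else 0 else 0 := by
    intro z w
    rw [← ite_and]
    by_cases hzw : z = i ∧ w = j
    · simp [rMatrix, hzw, hij.ne]
    · rw [if_neg hzw, rMatrix, if_neg (by simpa using hzw)]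
      refine ite_eq_right_iff.2 ?_
      rintro ⟨e1, e2⟩
      simp only at e1 e2
      rw [if_pos (by rw [e1, e2]; exact hij), smul_zero]
  have hs : ∀ (c : ℂ) (f : PowerSeries A),
      PowerSeries.constantCoeff (scaleHom A c f) = PowerSeries.constantCoeff f := by
    intro c f
    rw [← PowerSeries.coeff_zero_eq_constantCoeff_apply, coeff_scaleHom, pow_zero, one_smul,
      PowerSeries.coeff_zero_eq_constantCoeff_apply]
  simp only [Matrix.mul_apply, sum_fin_two_fun, onSlot_zero_apply, onSlot_one_apply,
    onSlots_pair_apply, Matrix.cons_val_zero, Matrix.cons_val_one, map_zero, map_one, zero_smul,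
    mul_zero, scalarMatrix, Matrix.map_apply, partialTranspose, hR1, hR2] at h
  simp [hs, apply_ite (PowerSeries.map (algebraMap ℂ A))] at h
  simp [hR1, hR2, apply_ite (PowerSeries.map (algebraMap ℂ A)),
    apply_ite PowerSeries.constantCoeff] at h
  rw [← h, pow_two, mul_smul, Algebra.smul_def, Algebra.smul_def, ← Algebra.commutes q (_ * _),
    mul_assoc, mul_assoc]

end ConstantTerm

end SklyaninJacobi

namespace SklyaninJacobi

/-! ### The twisted q-Yangians -/

section Yangian

variable {q : ℂ}

theorem reflR_map {A A' : Type*} [Ring A] [Algebra ℂ A] [Ring A'] [Algebra ℂ A'] {N : ℕ}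
    (φ : A →ₐ[ℂ] A') :
    (reflR N A q).map (MvPowerSeries.map (φ : A →+* A')) = reflR N A' q := by
  have h : (MvPowerSeries.map (σ := Fin 2) (φ : A →+* A')).comp (MvPowerSeries.map (algebraMap ℂ A)) =
      MvPowerSeries.map (algebraMap ℂ A') := by
    rw [← MvPowerSeries.map_comp, AlgHom.comp_algebraMap]
  rw [reflR, reflR, onSlots_map _ _ _ _ (map_zero _), Matrix.map_map, ← RingHom.coe_comp, h]

theorem reflRt_map {A A' : Type*} [Ring A] [Algebra ℂ A] [Ring A'] [Algebra ℂ A'] {N : ℕ}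
    (φ : A →ₐ[ℂ] A') :
    (reflRt N A q).map (MvPowerSeries.map (φ : A →+* A')) = reflRt N A' q := by
  have h : (MvPowerSeries.map (σ := Fin 2) (φ : A →+* A')).comp (MvPowerSeries.map (algebraMap ℂ A)) =
      MvPowerSeries.map (algebraMap ℂ A') := by
    rw [← MvPowerSeries.map_comp, AlgHom.comp_algebraMap]
  rw [reflRt, reflRt, onSlots_map _ _ _ _ (map_zero _), Matrix.map_map, ← RingHom.coe_comp, h]

theorem onSlot_inVar_map {A A' : Type*} [Ring A] [Ring A'] {N : ℕ}
    (φ : A →+* A') (p k : Fin 2) (S : Matrix (Fin N) (Fin N) (PowerSeries A)) :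
    (onSlot p (S.map (inVar k)) : Matrix (Fin 2 → _) _ _).map (MvPowerSeries.map φ) =
      onSlot p ((S.map (PowerSeries.map φ)).map (inVar k)) := by
  rw [onSlot_map _ _ _ (map_zero _)]
  congr 1
  ext1 a b
  exact (inVar_map φ k (S a b)).symm

theorem reflLeft_map {A A' : Type*} [Ring A] [Algebra ℂ A] [Ring A'] [Algebra ℂ A'] {N : ℕ}
    (φ : A →ₐ[ℂ] A') (S : Matrix (Fin N) (Fin N) (PowerSeries A)) :
    (reflLeft q S).map (MvPowerSeries.map (φ : A →+* A')) =
      reflLeft q (S.map (PowerSeries.map (φ : A →+* A'))) := by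
  simp only [reflLeft, Matrix.map_mul, reflR_map, reflRt_map, onSlot_inVar_map]

theorem reflRight_map {A A' : Type*} [Ring A] [Algebra ℂ A] [Ring A'] [Algebra ℂ A'] {N : ℕ}
    (φ : A →ₐ[ℂ] A') (S : Matrix (Fin N) (Fin N) (PowerSeries A)) :
    (reflRight q S).map (MvPowerSeries.map (φ : A →+* A')) =
      reflRight q (S.map (PowerSeries.map (φ : A →+* A'))) := by
  simp only [reflRight, Matrix.map_mul, reflR_map, reflRt_map, onSlot_inVar_map]

theorem genMatrix_eq (q : ℂ) {N : ℕ} (g : ClassicalType N) :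
    genMatrix q g = (freeMatrix g).map
      (PowerSeries.map (RingQuot.mkAlgHom ℂ (Rel q g) : _ →+* TwistedQYangian q g)) := by
  ext i j n
  rw [Matrix.map_apply, PowerSeries.coeff_map, freeMatrix, PowerSeries.coeff_mk, genMatrix,
    PowerSeries.coeff_mk]
  rfl

theorem reflectionRelation_genMatrix (q : ℂ) {N : ℕ} (g : ClassicalType N) :
    ReflectionRelation q (genMatrix q g) := by
  rw [ReflectionRelation, genMatrix_eq, ← reflLeft_map, ← reflRight_map]
  ext a b d
  rw [Matrix.map_apply, Matrix.map_apply, MvPowerSeries.coeff_map, MvPowerSeries.coeff_map]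
  exact RingQuot.mkAlgHom_rel ℂ (Rel.reflection g a b d)

theorem constantCoeff_genMatrix (q : ℂ) {N : ℕ} (g : ClassicalType N) (i j : Fin N) :
    PowerSeries.constantCoeff (genMatrix q g i j) =
      RingQuot.mkAlgHom ℂ (Rel q g) (freeS g i j 0) := by
  rw [← PowerSeries.coeff_zero_eq_constantCoeff_apply, genMatrix, PowerSeries.coeff_mk]

theorem isUnit_genMatrix_o (q : ℂ) (N : ℕ) : IsUnit (genMatrix q (.o N)) := by
  refine isUnit_of_isUnit_constantCoeff _ ?_
  set M := (genMatrix q (.o N)).map PowerSeries.constantCoeff with hM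
  have h0 : ∀ i j, i < j → M i j = 0 := fun i j hij => by
    rw [hM, Matrix.map_apply, constantCoeff_genMatrix,
      RingQuot.mkAlgHom_rel ℂ (Rel.o_upper i j hij), map_zero]
  have h1 : ∀ i, M i i = 1 := fun i => by
    rw [hM, Matrix.map_apply, constantCoeff_genMatrix, RingQuot.mkAlgHom_rel ℂ (Rel.o_diag i),
      map_one]
  rw [← add_sub_cancel 1 M]
  refine IsNilpotent.isUnit_one_add (isNilpotent_of_height _ (fun i => (i : ℕ)) ?_)
  intro i j hij
  by_contra hlt
  apply hij
  rcases (not_lt.1 hlt).lt_or_eq with hlt | heq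
  · rw [Matrix.sub_apply, h0 i j hlt, Matrix.one_apply_ne (ne_of_lt (Fin.lt_def.2 hlt)), sub_zero]
  · rw [Fin.ext heq, Matrix.sub_apply, h1, Matrix.one_apply_eq, sub_self]

/-- The position of the first or second index of a pair. -/
def pairEquiv (n : ℕ) : Fin 2 × Fin n ≃ Fin (2 * n) :=
  ((Equiv.prodComm _ _).trans finProdFinEquiv).trans (finCongr (mul_comm n 2))

theorem pairEquiv_zero {n : ℕ} (k : Fin n) : pairEquiv n (0, k) = fst k := by
  ext
  simp [pairEquiv, fst, finProdFinEquiv]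

theorem pairEquiv_one {n : ℕ} (k : Fin n) : pairEquiv n (1, k) = snd k := by
  ext
  simp [pairEquiv, snd, finProdFinEquiv, add_comm]

/-- Grouping the indices into the pairs `{i, i'}` makes the matrix lower block triangular: above the
diagonal only the positions `(i, i')` survive, and these lie in the diagonal blocks. -/
theorem isUnit_of_pairs {R : Type*} [Ring R] {n : ℕ} (M : Matrix (Fin (2 * n)) (Fin (2 * n)) R)
    (hM : ∀ i j, i < j → (∀ k, ¬(i = fst k ∧ j = snd k)) → M i j = 0)
    (hD : ∀ k, IsUnit !![M (fst k) (fst k), M (fst k) (snd k);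
      M (snd k) (fst k), M (snd k) (snd k)]) : IsUnit M := by
  suffices h : IsUnit (M.submatrix (pairEquiv n) (pairEquiv n)) by
    simpa using h.map (Matrix.reindexAlgEquiv ℤ R (pairEquiv n))
  refine isUnit_of_blockTriangular _ ?_ ?_
  · rintro ⟨i, k⟩ ⟨j, l⟩ hkl
    simp only at hkl
    rw [Fin.lt_def] at hkl
    have hv : ∀ (i : Fin 2) (k : Fin n), (pairEquiv n (i, k) : ℕ) = 2 * k + i := fun i k => by
      simp [pairEquiv, finProdFinEquiv, add_comm]
    rw [Matrix.submatrix_apply]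
    refine hM _ _ ?_ ?_
    · rw [Fin.lt_def, hv, hv]
      omega
    · rintro t ⟨h1, h2⟩
      have h1' := congrArg Fin.val h1
      have h2' := congrArg Fin.val h2
      rw [hv] at h1' h2'
      simp only [fst, snd] at h1' h2'
      omega
  · intro k
    have e : (Matrix.of fun i j => M.submatrix (pairEquiv n) (pairEquiv n) (i, k) (j, k)) =
        !![M (fst k) (fst k), M (fst k) (snd k); M (snd k) (fst k), M (snd k) (snd k)] := by
      ext i j
      fin_cases i <;> fin_cases j <;> simp [pairEquiv_zero, pairEquiv_one]
    rw [e]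
    exact hD k

theorem isUnit_genMatrix_sp (hq : q ≠ 0) (n : ℕ) : IsUnit (genMatrix q (.sp n)) := by
  refine isUnit_of_isUnit_constantCoeff _ (isUnit_of_pairs _ ?_ ?_)
  · intro i j hij h
    rw [Matrix.map_apply, constantCoeff_genMatrix,
      RingQuot.mkAlgHom_rel ℂ (Rel.sp_upper i j hij h), map_zero]
  · intro k
    have hlt : fst k < snd k := by
      simp [Fin.lt_def, fst, snd]
    have h1 := (reflectionRelation_genMatrix q (.sp n)).constantCoeff_mul hlt
    simp only [Matrix.map_apply, constantCoeff_genMatrix] at h1 ⊢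
    refine isUnit_fin_two (β := RingQuot.mkAlgHom ℂ (Rel q (.sp n))
      (FreeAlgebra.ι ℂ (Gen.inv k))) hq h1 ?_ ?_ ?_
    · have h2 := RingQuot.mkAlgHom_rel ℂ (Rel.sp_det (q := q) k)
      rwa [map_sub, map_smul, map_mul, map_mul, AlgHom.commutes] at h2
    · have h2 := RingQuot.mkAlgHom_rel ℂ (Rel.sp_mul_inv (q := q) k)
      rwa [map_mul, map_one] at h2
    · have h2 := RingQuot.mkAlgHom_rel ℂ (Rel.sp_inv_mul (q := q) k)
      rwa [map_mul, map_one] at h2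

theorem isUnit_genMatrix (hq : q ≠ 0) {N : ℕ} (g : ClassicalType N) : IsUnit (genMatrix q g) := by
  cases g with
  | o => exact isUnit_genMatrix_o q _
  | sp n => exact isUnit_genMatrix_sp hq n

theorem isUnit_map_dilate {A : Type*} [Ring A] [Algebra ℂ A] {N : ℕ}
    {S : Matrix (Fin N) (Fin N) (PowerSeries A)} (hS : IsUnit S) (c : ℂ) :
    IsUnit (S.map (dilate c)) := by
  rw [dilate_eq]
  exact hS.map ((scaleHom A c⁻¹).toRingHom.mapMatrix)

end Yangian

/-! ### From complementary index sequences to subsets. -/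

section Subsets

variable {A : Type*} [Ring A] [Algebra ℂ A] {N : ℕ} {q r : ℂ}

theorem sklyaninMinor_eq_sdet_mul_of_complement (hq : q ≠ 0) (hq2 : q ^ 2 ≠ 1) (hr : r ^ 2 = -q)
    {S : Matrix (Fin N) (Fin N) (PowerSeries A)} (hS : ReflectionRelation q S)
    (hU : IsUnit (S.map (dilate (q ^ (-(N : ℤ)))))) {m k : ℕ} (h : m + k = N)
    {f : Fin m → Fin N} {g : Fin k → Fin N} (hf : Function.Injective f)
    (hg : Function.Injective g) (hfg : ∀ i j, f i ≠ g j) :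
    sklyaninMinor q S f f =
      sdet q S * dilate (q ^ (2 - (N : ℤ))) (sklyaninMinor q⁻¹ (xMatrix q r S) g g) := by
  subst h
  -- The reversal built into the identity is compensated by feeding it the reversed sequence.
  have key := sklyaninMinor_eq_sdet_mul hq hq2 hr hS hU (f := f) (g := g ∘ Fin.rev) ?_
  · have e : (g ∘ Fin.rev) ∘ Fin.rev = g := by
      ext i
      simp
    rwa [e] at key
  · rw [Fin.append_injective_iff]
    exact ⟨hf, hg.comp Fin.rev_injective, fun i j => hfg i _⟩

theorem sdetSub_eq_sdet_mul (hq : q ≠ 0) (hq2 : q ^ 2 ≠ 1) (hr : r ^ 2 = -q)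
    {S : Matrix (Fin N) (Fin N) (PowerSeries A)} (hS : ReflectionRelation q S)
    (hU : IsUnit (S.map (dilate (q ^ (-(N : ℤ)))))) (I : Finset (Fin N)) :
    sdetSub q S I =
      sdet q S * dilate (q ^ (2 - (N : ℤ))) (sdetSub q⁻¹ (xMatrix q r S) Iᶜ) := by
  refine sklyaninMinor_eq_sdet_mul_of_complement hq hq2 hr hS hU (by
    rw [Finset.card_add_card_compl, Fintype.card_fin]) (RelEmbedding.injective _)
    (RelEmbedding.injective _) ?_
  intro i j h
  have h1 := Finset.orderEmbOfFin_mem I rfl i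
  have h2 := Finset.orderEmbOfFin_mem Iᶜ rfl j
  rw [← h] at h2
  exact Finset.mem_compl.1 h2 h1

theorem sdet_mul_dilate_sdet (hq : q ≠ 0) (hq2 : q ^ 2 ≠ 1) (hr : r ^ 2 = -q)
    {S : Matrix (Fin N) (Fin N) (PowerSeries A)} (hS : ReflectionRelation q S)
    (hU : IsUnit (S.map (dilate (q ^ (-(N : ℤ)))))) :
    sdet q S * dilate (q ^ (2 - (N : ℤ))) (sdet q⁻¹ (xMatrix q r S)) = 1 := by
  -- The case `m = 0`: the complementary sequence is `id`, and the empty minor on the other side is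
  -- `1`.
  rw [sdet.eq_1 q⁻¹, ← sklyaninMinor_eq_sdet_mul_of_complement hq hq2 hr hS hU (zero_add N)
    (f := Fin.elim0) (fun i => i.elim0) Function.injective_id fun i => i.elim0]
  simp [sklyaninMinor, antisymmetrizer, bracket, qPerm_one]

end Subsets

end SklyaninJacobi

theorem mainTheorem1 (q : ℂ) (hq0 : q ≠ 0) (hq : ∀ n : ℕ, 0 < n → q ^ n ≠ 1)
    (r : ℂ) (hr : r ^ 2 = -q) {N : ℕ} (g : SklyaninJacobi.ClassicalType N)
    (S X : Matrix (Fin N) (Fin N) (PowerSeries (SklyaninJacobi.TwistedQYangian q g)))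
    (hS : S = SklyaninJacobi.genMatrix q g)
    (hX : X = SklyaninJacobi.xMatrix q r S) :
    IsUnit (S.map (SklyaninJacobi.dilate (q ^ (-(N : ℤ))))) ∧
    SklyaninJacobi.ReflectionRelation q⁻¹ X ∧
    (∀ I : Finset (Fin N),
      SklyaninJacobi.sdetSub q S I =
        SklyaninJacobi.sdet q S *
          SklyaninJacobi.dilate (q ^ (2 - (N : ℤ))) (SklyaninJacobi.sdetSub q⁻¹ X Iᶜ)) ∧
    SklyaninJacobi.sdet q S *
      SklyaninJacobi.dilate (q ^ (2 - (N : ℤ))) (SklyaninJacobi.sdet q⁻¹ X) = 1 := by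
  subst hX hS
  have hR := SklyaninJacobi.reflectionRelation_genMatrix q g
  have hU := SklyaninJacobi.isUnit_map_dilate (SklyaninJacobi.isUnit_genMatrix hq0 g)
    (q ^ (-(N : ℤ)))
  have hq2 := hq 2 two_pos
  exact ⟨hU, SklyaninJacobi.reflectionRelation_xMatrix hq0 hr hR hU,
    SklyaninJacobi.sdetSub_eq_sdet_mul hq0 hq2 hr hR hU,
    SklyaninJacobi.sdet_mul_dilate_sdet hq0 hq2 hr hR hU⟩
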